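/- Let $D_0,D_1,D_2$ be $m\times m$ complex hermitian matrices such that $\Delta(x)=\det(x_0D_0+x_1D_1-x_2D_2)$ is irreducible in $\mathbb C[x_0,x_1,x_2]$; write $D(x)=x_0D_0+x_1D_1-x_2D_2$ and $C=\{\Delta=0\}\subset\mathbb P^2(\mathbb C)$. Let $n\ge 1$, let $p_0,p_1,p_2\in\mathbb R[x_0,x_1,x_2]$ be homogeneous of degree $n$, and put $r=(p_0,p_1,p_2)$ and $r(C)=\{(p_0(x):p_1(x):p_2(x)) : x\in C,\ (p_0(x),p_1(x),p_2(x))\neq 0\}$. The base points are the points $y\in C$ with $p_0(y)=p_1(y)=p_2(y)=0$. Assume that $r(C)$ has more than one point and that every base point $y$ is simple: for some $a\in\mathbb C^3$ the curve $a_0p_0+a_1p_1+a_2p_2=0$ is smooth at $y$, and its tangent line there meets $C$ at $y$ with multiplicity exactly $\dim\ker D(y)$. (At a smooth point $y$ of $C$ this means that this curve is transversal to $C$ at $y$.) Let $W_n$ be the space of families $w=(w_i)_{|i|=n-1}$, $w_i\in\mathbb C^m$, $i=(i_0,i_1,i_2)\in\mathbb Z_{\ge0}^3$, with its standard inner product,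 and let $\mathbf e_0,\mathbf e_1,\mathbf e_2$ be the standard basis of $\mathbb Z^3$. Put $$V_n=\{w\in W_n : D_0w_{j+\mathbf e_0}+D_1w_{j+\mathbf e_1}-D_2w_{j+\mathbf e_2}=0\ \text{ for all } |j|=n-2\},$$ and let $\bar V_n$ be the subspace of $V_n$ orthogonal to all Vandermonde vectors $(y^ie)_{|i|=n-1}$, where $y$ is a base point and $D(y)e=0$. For homogeneous $p,q$ of degree $n$ there are symmetric matrices $\beta^{10},\beta^{20},\beta^{12}$, indexed by the $i$ with $|i|=n-1$, such that $$p(x)q(y)-q(x)p(y)=\sum_{|i|=|j|=n-1}x^i\left[\beta^{10}_{ij}(x_1y_0-x_0y_1)+\beta^{20}_{ij}(x_2y_0-x_0y_2)+\beta^{12}_{ij}(x_1y_2-x_2y_1)\right]y^j.$$ For any choice of them set $B(p,q)=\beta^{12}\otimes D_0+\beta^{20}\otimes D_1+\beta^{10}\otimes D_2$ on $W_n$, $B'(p,q)=\mathcal P_{V_n}B(p,q)\mathcal P_{V_n}$, and let $\bar B(p,q)=\mathcal P_{\bar V_n}B'(p,q)|_{\bar V_n}$, with $\mathcal P$ the orthogonal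 projections; in an orthonormal basis of $\bar V_n$, $\bar B(p,q)$ is a square matrix. **Theorem.** The curve $r(C)$ has the determinantal representation $$F(x)=\det\left(x_0\bar B(p_1,p_2)-x_1\bar B(p_0,p_2)+x_2\bar B(p_0,p_1)\right).$$ That is: the three matrices $\bar B$ are hermitian; the zero locus of $F$ in $\mathbb P^2(\mathbb C)$ is the Zariski closure of $r(C)$, and it is $r(C)$ itself if there are no base points; and if $r$ is one-to-one on $C$ outside a finite set of points, then $F$ is irreducible. -/

import Mathlib

open scoped Kronecker LinearAlgebra.Projectivization

noncomputable section

namespace CurveElim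

/-- The complex projective plane. -/
abbrev Plane : Type := ℙ ℂ (Fin 3 → ℂ)

/-! ### Plane curves and determinantal representations -/

/-- The form `det (x₀ A₀ + x₁ A₁ - x₂ A₂)` in the variables `x₀, x₁, x₂`. -/
def detForm {ι : Type*} [Fintype ι] [DecidableEq ι] (A₀ A₁ A₂ : Matrix ι ι ℂ) :
    MvPolynomial (Fin 3) ℂ :=
  Matrix.det ((MvPolynomial.X 0 : MvPolynomial (Fin 3) ℂ) • A₀.map MvPolynomial.C
    + (MvPolynomial.X 1 : MvPolynomial (Fin 3) ℂ) • A₁.map MvPolynomial.C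
    - (MvPolynomial.X 2 : MvPolynomial (Fin 3) ℂ) • A₂.map MvPolynomial.C)

/-- The zero locus in the plane of a form `G`. For homogeneous `G` the vanishing at `P` does not
depend on the chosen vector `P.rep` of homogeneous coordinates. -/
def zeroLocus (G : MvPolynomial (Fin 3) ℂ) : Set Plane :=
  {P | MvPolynomial.eval P.rep G = 0}

/-- The Zariski closure of a subset of the plane: the points at which every form that vanishes
on the subset vanishes. -/
def zariskiClosure (S : Set Plane) : Set Plane :=
  {P | ∀ (d : ℕ) (G : MvPolynomial (Fin 3) ℂ), G.IsHomogeneous d →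
    S ⊆ zeroLocus G → P ∈ zeroLocus G}

/-- The matrix `x₀ D₀ + x₁ D₁ - x₂ D₂` at a vector `x`. -/
def pencil {m : ℕ} (D : Fin 3 → Matrix (Fin m) (Fin m) ℂ) (x : Fin 3 → ℂ) :
    Matrix (Fin m) (Fin m) ℂ :=
  x 0 • D 0 + x 1 • D 1 - x 2 • D 2

/-- The curve `C` of the determinantal representation `det (x₀ D₀ + x₁ D₁ - x₂ D₂)`. -/
def curve {m : ℕ} (D : Fin 3 → Matrix (Fin m) (Fin m) ℂ) : Set Plane :=
  zeroLocus (detForm (D 0) (D 1) (D 2))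

/-! ### Rational transformations -/

/-- The value `(p₀(x), p₁(x), p₂(x))` at a complex vector `x`. -/
def values (p : Fin 3 → MvPolynomial (Fin 3) ℝ) (x : Fin 3 → ℂ) : Fin 3 → ℂ :=
  fun k => MvPolynomial.aeval x (p k)

/-- The common zeros of `p₀, p₁, p₂` on the set `C`. -/
def basePoints (p : Fin 3 → MvPolynomial (Fin 3) ℝ) (C : Set Plane) : Set Plane :=
  {P | P ∈ C ∧ values p P.rep = 0}

/-- The image of `C` under `r = (p₀, p₁, p₂)`, which is defined off the common zeros. -/
def image (p : Fin 3 → MvPolynomial (Fin 3) ℝ) (C : Set Plane) : Set Plane :=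
  {Q | ∃ P ∈ C, ∃ h : values p P.rep ≠ 0, Q = Projectivization.mk ℂ (values p P.rep) h}

/-- `r = (p₀, p₁, p₂)` is one-to-one on `C` outside a finite set of points. -/
def GenericallyInjective (p : Fin 3 → MvPolynomial (Fin 3) ℝ) (C : Set Plane) : Prop :=
  ∃ S : Set Plane, S.Finite ∧ ∀ P ∈ C \ S, ∀ P' ∈ C \ S,
    ∀ (h : values p P.rep ≠ 0) (h' : values p P'.rep ≠ 0),
      Projectivization.mk ℂ (values p P.rep) h = Projectivization.mk ℂ (values p P'.rep) h' →
        P = P'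

/-- The differential at `y` of `a₀ p₀ + a₁ p₁ + a₂ p₂`, applied to `v`. -/
def diffComb (p : Fin 3 → MvPolynomial (Fin 3) ℝ) (a y v : Fin 3 → ℂ) : ℂ :=
  ∑ k, a k * ∑ l, MvPolynomial.aeval y (MvPolynomial.pderiv l (p k)) * v l

/-- The restriction `G (y + t v)` of a polynomial `G` to the line through `y` in direction `v`,
as a polynomial in `t`. -/
def alongLine (G : MvPolynomial (Fin 3) ℂ) (y v : Fin 3 → ℂ) : Polynomial ℂ :=
  MvPolynomial.aeval (fun l => Polynomial.C (y l) + Polynomial.C (v l) * Polynomial.X) G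

/-- The base point `y` is simple for the determinantal representation `D` of `C`: some curve
`a₀ p₀ + a₁ p₁ + a₂ p₂ = 0` is smooth at `y`, and its tangent line there meets `C` at `y`
with multiplicity exactly `dim ker (y₀ D₀ + y₁ D₁ - y₂ D₂)`.

At a smooth point of `C` the kernel is a line, and this says that the two curves meet
transversally at `y`. At a singular point it says that the kernel has the maximal possible
dimension, the multiplicity of `C` at `y`, and that the two curves have no common tangent. -/
def IsSimpleBasePoint {m : ℕ} (D : Fin 3 → Matrix (Fin m) (Fin m) ℂ)
    (p : Fin 3 → MvPolynomial (Fin 3) ℝ) (y : Fin 3 → ℂ) : Prop :=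
  ∃ a v : Fin 3 → ℂ, (∃ u, diffComb p a y u ≠ 0) ∧ diffComb p a y v = 0 ∧
    (alongLine (detForm (D 0) (D 1) (D 2)) y v).rootMultiplicity 0 =
      Module.finrank ℂ (LinearMap.ker (pencil D y).mulVecLin)

/-! ### Vandermonde vectors and the principal subspace -/

/-- The exponents `i = (i₀, i₁, i₂)` with `|i| = n - 1`. -/
abbrev Expo (n : ℕ) : Type :=
  {i : Fin 3 → ℕ // i ∈ Finset.piAntidiag (Finset.univ : Finset (Fin 3)) (n - 1)}

/-- The monomial `x₀ ^ i₀ * x₁ ^ i₁ * x₂ ^ i₂`. -/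
def monom (i : Fin 3 → ℕ) (x : Fin 3 → ℂ) : ℂ := ∏ k, x k ^ i k

/-- The blown up space `W_n`, of dimension `m n (n + 1) / 2`, with its standard inner product.
The component `w_i` of a vector `w` is `fun s => w (i, s)`. -/
abbrev BlownUp (m n : ℕ) : Type := EuclideanSpace ℂ (Expo n × Fin m)

/-- The component `w_i` in `ℂ ^ m` of a vector `w` of the blown up space. -/
def component {m n : ℕ} (w : BlownUp m n) (i : Expo n) : Fin m → ℂ := fun s => w (i, s)

/-- The Vandermonde vector `(x ^ i e)_{|i| = n - 1}`. -/
def vandermonde {m : ℕ} (n : ℕ) (x : Fin 3 → ℂ) (e : Fin m → ℂ) : BlownUp m n :=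
  WithLp.toLp 2 (fun is => monom is.1.1 x * e is.2)

/-- The principal subspace `V_n`: all `w` in `W_n` such that
`D₀ w_{j + (1,0,0)} + D₁ w_{j + (0,1,0)} - D₂ w_{j + (0,0,1)} = 0` for all `j` with
`|j| = n - 2`. -/
def principal {m : ℕ} (n : ℕ) (D : Fin 3 → Matrix (Fin m) (Fin m) ℂ) :
    Submodule ℂ (BlownUp m n) where
  carrier := {w | ∀ (j : Fin 3 → ℕ) (i : Fin 3 → Expo n), (∀ k, (i k).1 = j + Pi.single k 1) →
    (D 0).mulVec (component w (i 0)) + (D 1).mulVec (component w (i 1))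
      - (D 2).mulVec (component w (i 2)) = 0}
  zero_mem' := by
    intro j i _
    have h : ∀ k, component (0 : BlownUp m n) (i k) = 0 := fun k => rfl
    simp [h]
  add_mem' := by
    intro w w' hw hw' j i hi
    have h : ∀ k, component (w + w') (i k) = component w (i k) + component w' (i k) :=
      fun k => rfl
    have h1 := hw j i hi
    have h2 := hw' j i hi
    simp only [h, Matrix.mulVec_add]
    linear_combination (exp := 1) h1 + h2
  smul_mem' := by
    intro c w hw j i hi
    have h : ∀ k, component (c • w) (i k) = c • component w (i k) := fun k => rfl
    have h1 := hw j i hi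
    simp only [h, Matrix.mulVec_smul, ← smul_add, ← smul_sub, h1, smul_zero]

/-- The span of the Vandermonde vectors at the base points of `r = (p₀, p₁, p₂)` on the
curve of `D`. -/
def baseSpan {m : ℕ} (n : ℕ) (D : Fin 3 → Matrix (Fin m) (Fin m) ℂ)
    (p : Fin 3 → MvPolynomial (Fin 3) ℝ) : Submodule ℂ (BlownUp m n) :=
  Submodule.span ℂ {w | ∃ y ∈ basePoints p (curve D), ∃ e : Fin m → ℂ,
    (pencil D y.rep).mulVec e = 0 ∧ w = vandermonde n y.rep e}

/-- The subspace of the principal subspace that is orthogonal to the Vandermonde vectors at the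
base points. -/
def reduced {m : ℕ} (n : ℕ) (D : Fin 3 → Matrix (Fin m) (Fin m) ℂ)
    (p : Fin 3 → MvPolynomial (Fin 3) ℝ) : Submodule ℂ (BlownUp m n) :=
  principal n D ⊓ (baseSpan n D p)ᗮ

/-! ### Generalized Bezout matrices -/

/-- Symmetric coefficient matrices `β¹⁰, β²⁰, β¹²` of a decomposition of `p(x) q(y) - q(x) p(y)`
for two forms `p, q` of degree `n`. They exist (see `exists_bezoutCoeffs`), but are not unique. -/
structure BezoutCoeffs (n : ℕ) (p q : MvPolynomial (Fin 3) ℝ) where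
  b10 : Matrix (Expo n) (Expo n) ℂ
  b20 : Matrix (Expo n) (Expo n) ℂ
  b12 : Matrix (Expo n) (Expo n) ℂ
  symm10 : b10.IsSymm
  symm20 : b20.IsSymm
  symm12 : b12.IsSymm
  decomp : ∀ x y : Fin 3 → ℂ,
    MvPolynomial.aeval x p * MvPolynomial.aeval y q
        - MvPolynomial.aeval x q * MvPolynomial.aeval y p =
      ∑ i : Expo n, ∑ j : Expo n,
        (b10 i j * (monom i.1 x * (x 1 * y 0 - x 0 * y 1) * monom j.1 y)
          + b20 i j * (monom i.1 x * (x 2 * y 0 - x 0 * y 2) * monom j.1 y)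
          + b12 i j * (monom i.1 x * (x 1 * y 2 - x 2 * y 1) * monom j.1 y))

/-- The three factors `x₁ y₀ - x₀ y₁`, `x₂ y₀ - x₀ y₂`, `x₁ y₂ - x₂ y₁`. -/
def cross (x y : Fin 3 → ℂ) : Fin 3 → ℂ :=
  ![x 1 * y 0 - x 0 * y 1, x 2 * y 0 - x 0 * y 2, x 1 * y 2 - x 2 * y 1]

def gen (n : ℕ) (c : Fin 3 × Expo n × Expo n) : (Fin 3 → ℂ) → (Fin 3 → ℂ) → ℂ :=
  fun x y => monom c.2.1.1 x * cross x y c.1 * monom c.2.2.1 y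

def genSpan (n : ℕ) : Submodule ℂ ((Fin 3 → ℂ) → (Fin 3 → ℂ) → ℂ) :=
  Submodule.span ℂ (Set.range (gen n))

theorem monom_add (i j : Fin 3 → ℕ) (x : Fin 3 → ℂ) :
    monom (i + j) x = monom i x * monom j x := by
  simp [monom, pow_add, Finset.prod_mul_distrib]

theorem monom_single (s : Fin 3) (x : Fin 3 → ℂ) : monom (Pi.single s 1) x = x s := by
  unfold monom
  rw [Finset.prod_eq_single s]
  · simp
  · intro b _ hb
    simp [hb]
  · simp

theorem expo_mem {k : ℕ} {i : Fin 3 → ℕ} (hi : ∑ l, i l = k) :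
    i ∈ Finset.piAntidiag (Finset.univ : Finset (Fin 3)) (k + 1 - 1) := by
  simp [Finset.mem_piAntidiag, hi]

theorem cross_mem {k : ℕ} {i j : Fin 3 → ℕ} (hi : ∑ l, i l = k) (hj : ∑ l, j l = k)
    (s t : Fin 3) :
    (fun x y => monom i x * (x s * y t - x t * y s) * monom j y) ∈ genSpan (k + 1) := by
  have key : ∀ c : Fin 3, (fun x y => monom i x * cross x y c * monom j y) ∈ genSpan (k + 1) :=
    fun c => Submodule.subset_span ⟨(c, ⟨i, expo_mem hi⟩, ⟨j, expo_mem hj⟩), rfl⟩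
  have keyn : ∀ c : Fin 3,
      (fun x y => monom i x * (-cross x y c) * monom j y) ∈ genSpan (k + 1) := by
    intro c
    convert (genSpan (k + 1)).neg_mem (key c) using 1
    funext x y
    simp
  have kz : ∀ f : (Fin 3 → ℂ) → (Fin 3 → ℂ) → ℂ, (∀ x y, f x y = 0) → f ∈ genSpan (k + 1) := by
    intro f hf
    convert (genSpan (k + 1)).zero_mem using 1
    funext x y
    simp [hf]
  fin_cases s <;> fin_cases t
  · exact kz _ (fun x y => by simp [mul_comm])
  · convert keyn 0 using 3
    simp [cross]
  · convert keyn 1 using 3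
    simp [cross]
  · exact key 0
  · exact kz _ (fun x y => by simp [mul_comm])
  · exact key 2
  · exact key 1
  · convert keyn 2 using 3
    simp [cross]
  · exact kz _ (fun x y => by simp [mul_comm])

theorem mul_mem {k : ℕ} {f : (Fin 3 → ℂ) → (Fin 3 → ℂ) → ℂ} (hf : f ∈ genSpan (k + 1))
    (s t : Fin 3) : (fun x y => x s * y t * f x y) ∈ genSpan (k + 2) := by
  unfold genSpan at hf
  induction hf using Submodule.span_induction with
  | mem f hf =>
    obtain ⟨⟨c, i, j⟩, rfl⟩ := hf
    have hi := (Finset.mem_piAntidiag.1 i.2).1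
    have hj := (Finset.mem_piAntidiag.1 j.2).1
    refine Submodule.subset_span ⟨(c, ⟨i.1 + Pi.single s 1, expo_mem ?_⟩,
      ⟨j.1 + Pi.single t 1, expo_mem ?_⟩), ?_⟩
    · simp [Finset.sum_add_distrib, hi]
    · simp [Finset.sum_add_distrib, hj]
    · funext x y
      simp only [gen, monom_add, monom_single]
      ring
  | zero =>
    convert (genSpan (k + 2)).zero_mem using 1
    funext x y
    simp
  | add f g _ _ hf hg =>
    convert (genSpan (k + 2)).add_mem hf hg using 1
    funext x y
    simp [mul_add]
  | smul c f _ hf =>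
    convert (genSpan (k + 2)).smul_mem c hf using 1
    funext x y
    simp [mul_left_comm]

theorem exists_pred {k : ℕ} {a : Fin 3 → ℕ} (ha : ∑ l, a l = k + 1) :
    ∃ (s : Fin 3) (a' : Fin 3 → ℕ), a = a' + Pi.single s 1 ∧ ∑ l, a' l = k := by
  obtain ⟨s, hs⟩ : ∃ s, a s ≠ 0 := by
    by_contra! h
    simp [h] at ha
  have h : a = (a - Pi.single s 1) + Pi.single s 1 := by
    funext l
    by_cases hl : l = s
    · subst hl
      simp
      omega
    · simp [hl]
  refine ⟨s, _, h, ?_⟩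
  rw [h] at ha
  simpa [Finset.sum_add_distrib] using ha

theorem monom_mem (k : ℕ) (a b : Fin 3 → ℕ) (ha : ∑ l, a l = k) (hb : ∑ l, b l = k) :
    (fun x y => monom a x * monom b y - monom b x * monom a y) ∈ genSpan k := by
  induction k generalizing a b with
  | zero =>
    have h : a = b := by
      funext l
      have h1 := (Finset.sum_eq_zero_iff.1 ha) l (Finset.mem_univ l)
      have h2 := (Finset.sum_eq_zero_iff.1 hb) l (Finset.mem_univ l)
      rw [h1, h2]
    subst h
    convert (genSpan 0).zero_mem using 1
    funext x y
    simp
  | succ k ih =>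
    obtain ⟨s, a', rfl, ha'⟩ := exists_pred ha
    obtain ⟨t, b', rfl, hb'⟩ := exists_pred hb
    have h1 : (fun x y : Fin 3 → ℂ =>
        x s * y t * (monom a' x * monom b' y - monom b' x * monom a' y)) ∈ genSpan (k + 1) := by
      cases k with
      | zero =>
        have h : a' = b' := by
          funext l
          have h1 := (Finset.sum_eq_zero_iff.1 ha') l (Finset.mem_univ l)
          have h2 := (Finset.sum_eq_zero_iff.1 hb') l (Finset.mem_univ l)
          rw [h1, h2]
        subst h
        convert (genSpan (0 + 1)).zero_mem using 1
        funext x y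
        simp
      | succ k => exact mul_mem (ih a' b' ha' hb') s t
    convert (genSpan (k + 1)).add_mem h1 (cross_mem hb' ha' s t) using 1
    funext x y
    simp only [monom_add, monom_single, Pi.add_apply]
    ring

theorem bezout_mem {n : ℕ} {p q : MvPolynomial (Fin 3) ℝ} (hp : p.IsHomogeneous n)
    (hq : q.IsHomogeneous n) :
    (fun x y : Fin 3 → ℂ => MvPolynomial.aeval x p * MvPolynomial.aeval y q
      - MvPolynomial.aeval x q * MvPolynomial.aeval y p) ∈ genSpan n := by
  have hev : ∀ (f : MvPolynomial (Fin 3) ℝ) (x : Fin 3 → ℂ),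
      MvPolynomial.aeval x f = ∑ a ∈ f.support, ((f.coeff a : ℝ) : ℂ) * monom a x := by
    intro f x
    rw [MvPolynomial.aeval_eq_eval₂Hom, MvPolynomial.coe_eval₂Hom, MvPolynomial.eval₂_eq']
    rfl
  have hdeg : ∀ {f : MvPolynomial (Fin 3) ℝ}, f.IsHomogeneous n → ∀ a ∈ f.support,
      ∑ l, a l = n := by
    intro f hf a ha
    have h := hf (MvPolynomial.mem_support_iff.1 ha)
    rw [Finsupp.weight_apply, Finsupp.sum_fintype _ _ (by simp)] at h
    simpa using h
  have hsum : (∑ a ∈ p.support, ∑ b ∈ q.support, (((p.coeff a : ℝ) : ℂ) * ((q.coeff b : ℝ) : ℂ)) •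
      (fun x y : Fin 3 → ℂ => monom a x * monom b y - monom b x * monom a y)) ∈ genSpan n :=
    Submodule.sum_mem _ fun a ha => Submodule.sum_mem _ fun b hb =>
      Submodule.smul_mem _ _ (monom_mem n a b (hdeg hp a ha) (hdeg hq b hb))
  convert hsum using 1
  funext x y
  rw [hev p x, hev q y, hev q x, hev p y, mul_comm (∑ a ∈ q.support, _), Finset.sum_mul_sum,
    Finset.sum_mul_sum]
  simp only [Finset.sum_apply, Pi.smul_apply, smul_eq_mul, ← Finset.sum_sub_distrib]
  refine Finset.sum_congr rfl fun a _ => Finset.sum_congr rfl fun b _ => ?_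
  ring

/-- Every two forms of degree `n` have symmetric Bezout coefficient matrices. -/
theorem exists_bezoutCoeffs {n : ℕ} {p q : MvPolynomial (Fin 3) ℝ} (hp : p.IsHomogeneous n)
    (hq : q.IsHomogeneous n) : Nonempty (BezoutCoeffs n p q) := by
  obtain ⟨c, hc⟩ := (Submodule.mem_span_range_iff_exists_fun ℂ).1 (bezout_mem hp hq)
  have h1 : ∀ x y : Fin 3 → ℂ, MvPolynomial.aeval x p * MvPolynomial.aeval y q
      - MvPolynomial.aeval x q * MvPolynomial.aeval y p = ∑ i : Expo n, ∑ j : Expo n,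
        (c (0, i, j) * (monom i.1 x * (x 1 * y 0 - x 0 * y 1) * monom j.1 y)
          + c (1, i, j) * (monom i.1 x * (x 2 * y 0 - x 0 * y 2) * monom j.1 y)
          + c (2, i, j) * (monom i.1 x * (x 1 * y 2 - x 2 * y 1) * monom j.1 y)) := by
    intro x y
    have h := congrFun (congrFun hc x) y
    rw [← h]
    simp only [Finset.sum_apply, Pi.smul_apply, smul_eq_mul, Fintype.sum_prod_type,
      Fin.sum_univ_three, gen, cross, Finset.sum_add_distrib]
    simp
  refine ⟨⟨fun i j => (c (0, i, j) + c (0, j, i)) / 2, fun i j => (c (1, i, j) + c (1, j, i)) / 2,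
    fun i j => (c (2, i, j) + c (2, j, i)) / 2, ?_, ?_, ?_, ?_⟩⟩
  · ext i j
    simp [Matrix.transpose, add_comm]
  · ext i j
    simp [Matrix.transpose, add_comm]
  · ext i j
    simp [Matrix.transpose, add_comm]
  · intro x y
    have h2 := h1 x y
    have h3 := h1 y x
    rw [Finset.sum_comm] at h3
    have h4 : MvPolynomial.aeval x p * MvPolynomial.aeval y q
        - MvPolynomial.aeval x q * MvPolynomial.aeval y p =
        ((MvPolynomial.aeval x p * MvPolynomial.aeval y q
          - MvPolynomial.aeval x q * MvPolynomial.aeval y p)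
        - (MvPolynomial.aeval y p * MvPolynomial.aeval x q
          - MvPolynomial.aeval y q * MvPolynomial.aeval x p)) / 2 := by
      ring
    rw [h4, h2, h3]
    simp only [← Finset.sum_sub_distrib, Finset.sum_div]
    refine Finset.sum_congr rfl fun i _ => Finset.sum_congr rfl fun j _ => ?_
    ring

/-- The Bezout matrix `B(p, q) = β¹² ⊗ D₀ + β²⁰ ⊗ D₁ + β¹⁰ ⊗ D₂` on the blown up space. -/
def bezout {m n : ℕ} {p q : MvPolynomial (Fin 3) ℝ} (D : Fin 3 → Matrix (Fin m) (Fin m) ℂ)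
    (b : BezoutCoeffs n p q) : Matrix (Expo n × Fin m) (Expo n × Fin m) ℂ :=
  b.b12 ⊗ₖ D 0 + b.b20 ⊗ₖ D 1 + b.b10 ⊗ₖ D 2

/-- The Bezout matrix along the curve, `B'(p, q) = P_V B(p, q) P_V`, where `P_V` is the orthogonal
projection of the blown up space onto the principal subspace. -/
def bezoutCurve {m n : ℕ} {p q : MvPolynomial (Fin 3) ℝ}
    (D : Fin 3 → Matrix (Fin m) (Fin m) ℂ) (b : BezoutCoeffs n p q) :
    BlownUp m n →ₗ[ℂ] BlownUp m n :=
  (principal n D).starProjection.toLinearMap ∘ₗ Matrix.toEuclideanLin (bezout D b) ∘ₗ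
    (principal n D).starProjection.toLinearMap

/-- The compression `T ↦ P_U T|_U` of an operator to a subspace `U`, as a matrix in an orthonormal
basis of `U`. -/
def compress {m n : ℕ} (U : Submodule ℂ (BlownUp m n)) (T : BlownUp m n →ₗ[ℂ] BlownUp m n) :
    Matrix (Fin (Module.finrank ℂ U)) (Fin (Module.finrank ℂ U)) ℂ :=
  LinearMap.toMatrix (stdOrthonormalBasis ℂ U).toBasis (stdOrthonormalBasis ℂ U).toBasis
    (U.orthogonalProjectionOnto.toLinearMap ∘ₗ T ∘ₗ U.subtype)

/-- The compression of the Bezout matrix `B'(f, g)` to the subspace of the principal subspace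
orthogonal to the Vandermonde vectors at the base points of `p`. -/
def bezoutBar {m n : ℕ} {f g : MvPolynomial (Fin 3) ℝ}
    (D : Fin 3 → Matrix (Fin m) (Fin m) ℂ) (p : Fin 3 → MvPolynomial (Fin 3) ℝ)
    (b : BezoutCoeffs n f g) :
    Matrix (Fin (Module.finrank ℂ (reduced n D p))) (Fin (Module.finrank ℂ (reduced n D p))) ℂ :=
  compress (reduced n D p) (bezoutCurve D b)

end CurveElim

end

noncomputable section
namespace CurveElim

/-! ### Functionals on forms -/

/-! Put A = (D_0, D_1, -D_2) and consider the linear functionals E from ternary polynomials to ℂ^m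
with ∑ A_k E(x_k h) = 0 for all h. They form a module under (gE)(h) = E(gh), and evaluation at y
along e is one of them exactly when D(y)e = 0. The space V_n consists of their restrictions to
degree n - 1. Choose linear coordinates x, u, z (a `Frame`) such that the pencil is invertible at
the first basis vector. A functional with zE = E, that is, one living on the affine part z = 1, is
then the same as an arbitrary sequence E(u^k), because x acts by a first order recurrence
(`ofSeq_mem`, `affine_ext`).

If a form P of degree n has no zero on the curve at infinity, PE = 0 is a recurrence of order n with
invertible leading matrix, so V_n is identified with {E : PE = 0} (`exists_affine_of_initial`,
`affine_eq_zero_of_act`). By `bez_key`, moving u across the Bezout pairing costs only the boundary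
terms F(P)ᵀ A E(Q) - F(Q)ᵀ A E(P), with A taken at the first basis vector. It follows that the
kernel of the Bezout form of P and Q on V_n is {E : PE = QE = 0} (`act_eq_zero_of_bez`). This is a
finite dimensional space with commuting coordinates. It is spanned by evaluations, whose
restrictions are Vandermonde vectors, unless some common zero carries a second order functional
(`mem_span_evalFun`).

For ξ = a × b the net of Bezout matrices at ξ belongs to the pair a·p, b·p (`netCoef_isBezout`),
whose common zeros on C are the fibre over ξ and the base points. The base Vandermonde vectors lie
in the kernel for every ξ and are removed by the compression. A Vandermonde vector over a point of
r(C) survives (`vandermonde_notMem_baseSpan`), so F vanishes on r(C). Conversely, if F(ξ) = 0, then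
ξ is in r(C) or some base point carries a second order functional. Simplicity turns that functional
into a tangent direction τ of C with dp(τ) = ξ (`IsSimpleAt.exists_isTangent`), and comparing lowest
terms along lines through the base point puts ξ in the closure of r(C) (`eval_dirDeriv_eq_zero`).

Hermitian symmetry holds because the conjugate coefficients decompose the same real polynomial, and
different decompositions induce the same form on V_n (`bez_eq_zero_of_trivial`).

For irreducibility, take a generic point y of C: r is immersive there, y is alone in its fibre, and
r(y) is not the image of a tangent direction at a base point. The kernel over r(y) is then at most a
line, and differentiating the Bezout decomposition on the diagonal shows that F vanishes there to
first order only (`IsGenericAt.exists_alongLine_ne_zero`). An irreducible factor G of F with G ∘ p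
divisible by Δ vanishes on the whole zero locus of F, so a second factor would be associated to G
and would force a double zero at r(y). -/

/-- Complex ternary polynomials. -/
abbrev Poly : Type := MvPolynomial (Fin 3) ℂ

/-- Linear functionals on ternary polynomials with values in `ℂ ^ m`. -/
abbrev Functional (m : ℕ) : Type := Poly →ₗ[ℂ] (Fin m → ℂ)

/-- The module structure on functionals: `(g E)(h) = E (g h)`. -/
def act {m : ℕ} (g : Poly) (E : Functional m) : Functional m := E ∘ₗ LinearMap.mulLeft ℂ g

@[simp] theorem act_apply {m : ℕ} (g : Poly) (E : Functional m) (h : Poly) :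
    act g E h = E (g * h) := rfl

/-- Monomials are built up one variable at a time, with the degree as a parameter of the predicate:
functionals and restrictions to lines are compared degree by degree. -/
theorem hom_induction {p : ℕ → Poly → Prop} (zero : ∀ n, p n 0)
    (add : ∀ n f g, p n f → p n g → p n (f + g))
    (const : ∀ c, p 0 (MvPolynomial.C c))
    (mulX : ∀ n k f, p n f → p (n + 1) (MvPolynomial.X k * f)) {n : ℕ} {f : Poly}
    (hf : f.IsHomogeneous n) : p n f := by
  have hmon : ∀ (n : ℕ) (d : Fin 3 →₀ ℕ) (c : ℂ), d.degree = n →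
      p n (MvPolynomial.monomial d c) := by
    intro n
    induction n with
    | zero =>
      intro d c hd
      rw [Finsupp.degree_eq_zero_iff] at hd
      subst hd
      exact const c
    | succ n ih =>
      intro d c hd
      obtain ⟨k, hk⟩ : ∃ k, d k ≠ 0 := by
        by_contra! h
        have : d = 0 := by ext k; exact h k
        subst this
        simp at hd
      have hle : Finsupp.single k 1 ≤ d := by
        rw [Finsupp.single_le_iff]
        omega
      have hdd : d = Finsupp.single k 1 + (d - Finsupp.single k 1) :=
        (add_tsub_cancel_of_le hle).symm
      have hm : MvPolynomial.monomial d c =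
          MvPolynomial.X k * MvPolynomial.monomial (d - Finsupp.single k 1) c := by
        rw [MvPolynomial.X, MvPolynomial.monomial_mul, one_mul, ← hdd]
      rw [hm]
      refine mulX n k _ (ih _ _ ?_)
      have h1 := congrArg Finsupp.degree hdd
      rw [map_add, Finsupp.degree_single, hd] at h1
      omega
  rw [f.as_sum]
  have : ∀ s ⊆ f.support, p n (∑ v ∈ s, MvPolynomial.monomial v (f.coeff v)) := by
    intro s
    induction s using Finset.induction_on with
    | empty => intro _; simpa using zero n
    | insert a s ha ih =>
      intro hs
      rw [Finset.sum_insert ha]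
      refine add _ _ _ (hmon n a _ ?_) (ih fun x hx => hs (Finset.mem_insert_of_mem hx))
      have h := hf (MvPolynomial.mem_support_iff.1 (hs (Finset.mem_insert_self _ _)))
      exact (congrFun (congrArg DFunLike.coe (Finsupp.degree_eq_weight_one (σ := Fin 3) (R := ℕ))) a).trans h
  exact this _ subset_rfl

/-- The matrix `∑ k, v k • A k`. -/
def comb {m : ℕ} (A : Fin 3 → Matrix (Fin m) (Fin m) ℂ) (v : Fin 3 → ℂ) :
    Matrix (Fin m) (Fin m) ℂ := ∑ k, v k • A k

/-- The functionals annihilated by the pencil `A`. -/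
def kerFunctionals {m : ℕ} (A : Fin 3 → Matrix (Fin m) (Fin m) ℂ) :
    Submodule ℂ (Functional m) where
  carrier := {E | ∀ h, ∑ k, (A k).mulVec (E (MvPolynomial.X k * h)) = 0}
  zero_mem' := by intro h; simp
  add_mem' := by
    intro E F hE hF h
    simp only [LinearMap.add_apply, Matrix.mulVec_add, Finset.sum_add_distrib]
    rw [hE h, hF h, add_zero]
  smul_mem' := by
    intro c E hE h
    simp only [LinearMap.smul_apply, Matrix.mulVec_smul, ← Finset.smul_sum]
    rw [hE h, smul_zero]

theorem mem_kerFunctionals {m : ℕ} {A : Fin 3 → Matrix (Fin m) (Fin m) ℂ} {E : Functional m} :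
    E ∈ kerFunctionals A ↔ ∀ h, ∑ k, (A k).mulVec (E (MvPolynomial.X k * h)) = 0 := Iff.rfl

theorem act_mem {m : ℕ} {A : Fin 3 → Matrix (Fin m) (Fin m) ℂ} {E : Functional m}
    (hE : E ∈ kerFunctionals A) (g : Poly) : act g E ∈ kerFunctionals A := by
  intro h
  have := hE (g * h)
  simpa only [act_apply, mul_left_comm g] using this

/-! ### Frames: linear coordinates x, u, z and their dual basis vectors. -/

/-- A linear coordinate change of `ℂ ^ 3`. -/
structure Frame where
  mat : Fin 3 → Fin 3 → ℂ
  inv : Fin 3 → Fin 3 → ℂ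
  mul_inv : ∀ i k, ∑ j, mat i j * inv j k = if i = k then 1 else 0

namespace Frame

/-- The basis vectors of a frame. -/
def pt (g : Frame) (j : Fin 3) : Fin 3 → ℂ := fun k => g.mat k j

/-- The dual linear forms of a frame. -/
def form (g : Frame) (j : Fin 3) : Poly := ∑ k, MvPolynomial.C (g.inv j k) * MvPolynomial.X k

theorem X_eq (g : Frame) (k : Fin 3) :
    (MvPolynomial.X k : Poly) = ∑ j, MvPolynomial.C (g.mat k j) * g.form j := by
  simp only [form, Finset.mul_sum, ← mul_assoc, ← map_mul]
  rw [Finset.sum_comm]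
  simp only [← Finset.sum_mul, ← map_sum, g.mul_inv]
  simp

theorem inv_mul (g : Frame) (i k : Fin 3) :
    ∑ j, g.inv i j * g.mat j k = if i = k then 1 else 0 := by
  have h : (Matrix.of g.mat) * (Matrix.of g.inv) = 1 := by
    ext i k
    rw [Matrix.mul_apply, Matrix.one_apply]
    exact g.mul_inv i k
  have h1 : (Matrix.of g.inv) * (Matrix.of g.mat) = 1 := mul_eq_one_comm.1 h
  have h' := congrFun (congrFun h1 i) k
  rwa [Matrix.mul_apply, Matrix.one_apply] at h'

theorem eval_form_pt (g : Frame) (i j : Fin 3) :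
    MvPolynomial.eval (g.pt j) (g.form i) = if i = j then 1 else 0 := by
  have h := g.inv_mul i j
  simpa [form, pt] using h

theorem eval_form (g : Frame) (i : Fin 3) (x : Fin 3 → ℂ) :
    MvPolynomial.eval x (g.form i) = ∑ k, g.inv i k * x k := by
  simp [form]

theorem expand (g : Frame) (x : Fin 3 → ℂ) :
    x = ∑ j, MvPolynomial.eval x (g.form j) • g.pt j := by
  funext k
  have h := congrArg (MvPolynomial.eval x) (g.X_eq k)
  simp only [MvPolynomial.eval_X, map_sum, map_mul, MvPolynomial.eval_C] at h
  simp only [Finset.sum_apply, Pi.smul_apply, smul_eq_mul, pt]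
  rw [h]
  exact Finset.sum_congr rfl fun j _ => mul_comm _ _

theorem form_isHomogeneous (g : Frame) (j : Fin 3) : (g.form j).IsHomogeneous 1 := by
  refine MvPolynomial.IsHomogeneous.sum _ _ _ fun k _ => ?_
  have := (MvPolynomial.isHomogeneous_C (Fin 3) (g.inv j k)).mul (MvPolynomial.isHomogeneous_X ℂ k)
  simpa using this

end Frame

theorem act_C_mul {m : ℕ} (E : Functional m) (c : ℂ) (h : Poly) :
    E (MvPolynomial.C c * h) = c • E h := by
  rw [MvPolynomial.C_mul', map_smul]

/-! ### Functionals on an affine chart as sequences. -/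

section

variable {m : ℕ} {A : Fin 3 → Matrix (Fin m) (Fin m) ℂ} (g : Frame)

/-- The relation is linear in the variables, so a change of coordinates merely replaces the matrices
A k by the values of the pencil at the basis vectors. -/
theorem frame_relation {E : Functional m} (hE : E ∈ kerFunctionals A) (h : Poly) :
    ∑ j, (comb A (g.pt j)).mulVec (E (g.form j * h)) = 0 := by
  rw [← hE h]
  have : ∀ k, E (MvPolynomial.X k * h) = ∑ j, g.mat k j • E (g.form j * h) := by
    intro k
    conv_lhs => rw [g.X_eq k]
    simp only [Finset.sum_mul, map_sum, mul_assoc, act_C_mul]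
  simp only [this, comb, Matrix.sum_mulVec, Matrix.mulVec_sum, Matrix.smul_mulVec,
    Matrix.mulVec_smul, Frame.pt]
  exact Finset.sum_comm

/-- Multiplication by the first coordinate on sequences, leading coefficient. -/
def stepA (A : Fin 3 → Matrix (Fin m) (Fin m) ℂ) (g : Frame) : Matrix (Fin m) (Fin m) ℂ :=
  -((comb A (g.pt 0))⁻¹ * comb A (g.pt 1))

/-- Multiplication by the first coordinate on sequences, constant coefficient. -/
def stepB (A : Fin 3 → Matrix (Fin m) (Fin m) ℂ) (g : Frame) : Matrix (Fin m) (Fin m) ℂ :=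
  -((comb A (g.pt 0))⁻¹ * comb A (g.pt 2))

/-- Invertibility at the first basis vector solves the pencil relation for x. This is what
eliminates x in favour of u and z throughout. -/
theorem form_zero_apply (h0 : IsUnit (comb A (g.pt 0)).det) {E : Functional m}
    (hE : E ∈ kerFunctionals A) (h : Poly) :
    E (g.form 0 * h) = (stepA A g).mulVec (E (g.form 1 * h))
      + (stepB A g).mulVec (E (g.form 2 * h)) := by
  have h1 := frame_relation g hE h
  rw [Fin.sum_univ_three] at h1
  have h2 := congrArg (comb A (g.pt 0))⁻¹.mulVec h1
  simp only [Matrix.mulVec_add, Matrix.mulVec_mulVec, Matrix.nonsing_inv_mul _ h0,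
    Matrix.one_mulVec, Matrix.mulVec_zero] at h2
  simp only [stepA, stepB, Matrix.neg_mulVec]
  linear_combination (exp := 1) h2

/-- A functional in the kernel of the pencil is determined on forms of degree `N` by its values
on monomials in two coordinates. -/
theorem eq_zero_of_two_var (h0 : IsUnit (comb A (g.pt 0)).det) {E : Functional m}
    (hE : E ∈ kerFunctionals A) {N : ℕ}
    (hN : ∀ a b, a + b = N → E (g.form 1 ^ a * g.form 2 ^ b) = 0) {h : Poly}
    (hh : h.IsHomogeneous N) : E h = 0 := by
  -- The multiplier u^a z^b absorbs the variables stripped from h and keeps the total degree equal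
  -- to N. Only a = b = 0 is needed in the end.
  have key : ∀ a b, a + b + N = N → E (g.form 1 ^ a * g.form 2 ^ b * h) = 0 := by
    refine hom_induction (p := fun j h => ∀ a b, a + b + j = N →
      E (g.form 1 ^ a * g.form 2 ^ b * h) = 0) ?_ ?_ ?_ ?_ hh
    · intro n a b _
      simp
    · intro n f f' hf hf' a b hab
      rw [mul_add, map_add, hf a b hab, hf' a b hab, add_zero]
    · intro c a b hab
      rw [mul_comm, act_C_mul, hN a b (by omega), smul_zero]
    · intro n k f hf a b hab
      have e1 : E (g.form 1 * (g.form 1 ^ a * g.form 2 ^ b * f)) = 0 := by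
        have := hf (a + 1) b (by omega)
        rw [pow_succ'] at this
        rwa [← mul_assoc, ← mul_assoc]
      have e2 : E (g.form 2 * (g.form 1 ^ a * g.form 2 ^ b * f)) = 0 := by
        have := hf a (b + 1) (by omega)
        rw [pow_succ'] at this
        rw [← this]
        congr 1
        ring
      have e0 : E (g.form 0 * (g.form 1 ^ a * g.form 2 ^ b * f)) = 0 := by
        rw [form_zero_apply g h0 hE, e1, e2]
        simp
      rw [mul_left_comm, g.X_eq k]
      simp only [Finset.sum_mul, map_sum, mul_assoc, act_C_mul]
      simp only [mul_assoc] at e0 e1 e2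
      simp [Fin.sum_univ_three, e0, e1, e2]
  simpa using key 0 0 (by omega)

/-- The functionals in the kernel of the pencil that live on the affine plane where the last
coordinate of the frame is one. -/
def affineFunctionals (A : Fin 3 → Matrix (Fin m) (Fin m) ℂ) (g : Frame) :
    Submodule ℂ (Functional m) where
  carrier := {E | E ∈ kerFunctionals A ∧ act (g.form 2) E = E}
  zero_mem' := ⟨Submodule.zero_mem _, LinearMap.ext fun h => by simp⟩
  add_mem' := by
    rintro E F ⟨hE, hE'⟩ ⟨hF, hF'⟩
    refine ⟨Submodule.add_mem _ hE hF, ?_⟩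
    refine LinearMap.ext fun h => ?_
    have h1 := DFunLike.congr_fun hE' h
    have h2 := DFunLike.congr_fun hF' h
    simp only [act_apply, LinearMap.add_apply] at *
    rw [h1, h2]
  smul_mem' := by
    rintro c E ⟨hE, hE'⟩
    refine ⟨Submodule.smul_mem _ c hE, ?_⟩
    refine LinearMap.ext fun h => ?_
    have h1 := DFunLike.congr_fun hE' h
    simp only [act_apply, LinearMap.smul_apply] at *
    rw [h1]

theorem mem_affineFunctionals {E : Functional m} :
    E ∈ affineFunctionals A g ↔ E ∈ kerFunctionals A ∧ ∀ h, E (g.form 2 * h) = E h := by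
  constructor
  · rintro ⟨h1, h2⟩
    exact ⟨h1, fun h => DFunLike.congr_fun h2 h⟩
  · rintro ⟨h1, h2⟩
    refine ⟨h1, ?_⟩
    refine LinearMap.ext fun h => ?_
    exact h2 h

theorem act_mem_affine {E : Functional m} (hE : E ∈ affineFunctionals A g) (f : Poly) :
    act f E ∈ affineFunctionals A g := by
  rw [mem_affineFunctionals] at *
  refine ⟨act_mem hE.1 f, fun h => ?_⟩
  rw [act_apply, act_apply, mul_left_comm, hE.2]

theorem affine_pow {E : Functional m} (hE : E ∈ affineFunctionals A g) (b : ℕ) (h : Poly) :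
    E (h * g.form 2 ^ b) = E h := by
  rw [mem_affineFunctionals] at hE
  induction b with
  | zero => simp
  | succ b ih => rw [pow_succ', mul_left_comm, hE.2, ih]

/-- The values of a functional on the powers of the second coordinate. -/
def seqOf (E : Functional m) (k : ℕ) : Fin m → ℂ := E (g.form 1 ^ k)

/-- Since z acts as the identity, E takes the same value on u^a z^b as on u^a. Forms of degree N
therefore see only the terms of the sequence with index at most N. -/
theorem affine_eq_zero_of_hom (h0 : IsUnit (comb A (g.pt 0)).det) {E : Functional m}
    (hE : E ∈ affineFunctionals A g) {N : ℕ} (hN : ∀ k ≤ N, seqOf g E k = 0) {h : Poly}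
    (hh : h.IsHomogeneous N) : E h = 0 := by
  refine eq_zero_of_two_var g h0 hE.1 ?_ hh
  intro a b hab
  rw [affine_pow g hE]
  exact hN a (by omega)

theorem affine_eq_zero (h0 : IsUnit (comb A (g.pt 0)).det) {E : Functional m}
    (hE : E ∈ affineFunctionals A g) (hN : ∀ k, seqOf g E k = 0) : E = 0 := by
  refine LinearMap.ext fun h => ?_
  rw [← MvPolynomial.sum_homogeneousComponent h, map_sum]
  exact Finset.sum_eq_zero fun i _ => affine_eq_zero_of_hom g h0 hE (fun k _ => hN k)
    (MvPolynomial.homogeneousComponent_isHomogeneous i h)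

/-- A first order recurrence operator on sequences. -/
def shiftOp (M N : Matrix (Fin m) (Fin m) ℂ) :
    (ℕ → Fin m → ℂ) →ₗ[ℂ] (ℕ → Fin m → ℂ) where
  toFun e := fun k => M.mulVec (e (k + 1)) + N.mulVec (e k)
  map_add' e f := by
    funext k
    simp only [Pi.add_apply, Matrix.mulVec_add]
    abel
  map_smul' c e := by
    funext k
    simp only [Pi.smul_apply, Matrix.mulVec_smul, smul_add, RingHom.id_apply]

theorem shiftOp_apply (M N : Matrix (Fin m) (Fin m) ℂ) (e : ℕ → Fin m → ℂ) (k : ℕ) :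
    shiftOp M N e k = M.mulVec (e (k + 1)) + N.mulVec (e k) := rfl

/-- The functional on polynomials in standard coordinates with given sequence. -/
def stdFunctional (M N : Matrix (Fin m) (Fin m) ℂ) (e : ℕ → Fin m → ℂ) : Functional m :=
  (MvPolynomial.basisMonomials (Fin 3) ℂ).constr ℂ fun d => (shiftOp M N ^ d 0) e (d 1)

theorem stdFunctional_monomial (M N : Matrix (Fin m) (Fin m) ℂ) (e : ℕ → Fin m → ℂ)
    (d : Fin 3 →₀ ℕ) :
    stdFunctional M N e (MvPolynomial.monomial d 1) = (shiftOp M N ^ d 0) e (d 1) := by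
  have := (MvPolynomial.basisMonomials (Fin 3) ℂ).constr_basis ℂ
    (fun d => (shiftOp M N ^ d 0) e (d 1)) d
  simpa [stdFunctional] using this

theorem functional_ext {E F : Functional m}
    (h : ∀ d, E (MvPolynomial.monomial d 1) = F (MvPolynomial.monomial d 1)) : E = F :=
  (MvPolynomial.basisMonomials (Fin 3) ℂ).ext fun d => by simpa using h d

theorem X_mul_monomial_one (k : Fin 3) (d : Fin 3 →₀ ℕ) :
    (MvPolynomial.X k : Poly) * MvPolynomial.monomial d 1 =
      MvPolynomial.monomial (Finsupp.single k 1 + d) 1 := by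
  rw [MvPolynomial.X, MvPolynomial.monomial_mul, one_mul]

theorem stdFunctional_two (M N : Matrix (Fin m) (Fin m) ℂ) (e : ℕ → Fin m → ℂ) (h : Poly) :
    stdFunctional M N e (MvPolynomial.X 2 * h) = stdFunctional M N e h := by
  have : act (MvPolynomial.X 2) (stdFunctional M N e) = stdFunctional M N e := by
    refine functional_ext fun d => ?_
    rw [act_apply, X_mul_monomial_one, stdFunctional_monomial, stdFunctional_monomial]
    simp
  exact DFunLike.congr_fun this h

/-- The third coordinate acts trivially, the second as the shift and the first as `shiftOp`. This is
`form_zero_apply` in standard coordinates, read as a construction. -/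
theorem stdFunctional_zero (M N : Matrix (Fin m) (Fin m) ℂ) (e : ℕ → Fin m → ℂ) (h : Poly) :
    stdFunctional M N e (MvPolynomial.X 0 * h) =
      M.mulVec (stdFunctional M N e (MvPolynomial.X 1 * h)) +
        N.mulVec (stdFunctional M N e h) := by
  have : act (MvPolynomial.X 0) (stdFunctional M N e) =
      M.mulVecLin ∘ₗ act (MvPolynomial.X 1) (stdFunctional M N e) +
        N.mulVecLin ∘ₗ stdFunctional M N e := by
    refine functional_ext fun d => ?_
    simp only [act_apply, LinearMap.add_apply, LinearMap.comp_apply, Matrix.mulVecLin_apply,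
      X_mul_monomial_one, stdFunctional_monomial]
    simp only [Finsupp.add_apply, Finsupp.single_apply]
    simp only [if_true, if_false, zero_add, Fin.isValue, one_ne_zero, zero_ne_one]
    rw [add_comm 1 (d 0), pow_succ', Module.End.mul_apply, shiftOp_apply, add_comm 1 (d 1)]
  exact DFunLike.congr_fun this h

/-- The coordinate change of polynomials given by a frame. -/
def Frame.subst (g : Frame) : Poly →ₐ[ℂ] Poly :=
  MvPolynomial.aeval fun k => ∑ j, MvPolynomial.C (g.mat k j) * MvPolynomial.X j

theorem Frame.subst_form (g : Frame) (j : Fin 3) : g.subst (g.form j) = MvPolynomial.X j := by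
  simp only [form, map_sum, map_mul, MvPolynomial.algHom_C, subst, MvPolynomial.aeval_X,
    Finset.mul_sum, MvPolynomial.algebraMap_eq, ← mul_assoc]
  simp only [← map_mul]
  rw [Finset.sum_comm]
  simp only [← Finset.sum_mul, ← map_sum, g.inv_mul]
  simp

/-- The functional with given sequence of values on the powers of the second coordinate. -/
def ofSeq (A : Fin 3 → Matrix (Fin m) (Fin m) ℂ) (g : Frame) (e : ℕ → Fin m → ℂ) :
    Functional m :=
  stdFunctional (stepA A g) (stepB A g) e ∘ₗ g.subst.toLinearMap

theorem seqOf_ofSeq (e : ℕ → Fin m → ℂ) : seqOf g (ofSeq A g e) = e := by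
  funext k
  simp only [seqOf, ofSeq, LinearMap.comp_apply, AlgHom.toLinearMap_apply, map_pow,
    Frame.subst_form]
  rw [MvPolynomial.X_pow_eq_monomial, stdFunctional_monomial]
  simp

/-- The step matrices are the solution of the pencil relation for x, so the relation holds
identically and puts no constraint on the sequence. -/
theorem ofSeq_mem (h0 : IsUnit (comb A (g.pt 0)).det) (e : ℕ → Fin m → ℂ) :
    ofSeq A g e ∈ affineFunctionals A g := by
  rw [mem_affineFunctionals]
  constructor
  · intro h
    have hX : ∀ k, ofSeq A g e (MvPolynomial.X k * h) =
        ∑ j, g.mat k j • stdFunctional (stepA A g) (stepB A g) e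
          (MvPolynomial.X j * g.subst h) := by
      intro k
      simp only [ofSeq, LinearMap.comp_apply, AlgHom.toLinearMap_apply, map_mul]
      conv_lhs => rw [Frame.subst, MvPolynomial.aeval_X]
      simp only [Finset.sum_mul, map_sum, mul_assoc, act_C_mul]
      rfl
    simp only [hX, Matrix.mulVec_sum, Matrix.mulVec_smul]
    rw [Finset.sum_comm]
    have : ∀ j, ∑ k, g.mat k j • (A k).mulVec (stdFunctional (stepA A g) (stepB A g) e
          (MvPolynomial.X j * g.subst h)) = (comb A (g.pt j)).mulVec
            (stdFunctional (stepA A g) (stepB A g) e (MvPolynomial.X j * g.subst h)) := by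
      intro j
      simp only [comb, Matrix.sum_mulVec, Matrix.smul_mulVec, Frame.pt]
    have hA : comb A (g.pt 0) * stepA A g = -comb A (g.pt 1) := by
      rw [stepA, mul_neg, Matrix.mul_nonsing_inv_cancel_left _ _ h0]
    have hB : comb A (g.pt 0) * stepB A g = -comb A (g.pt 2) := by
      rw [stepB, mul_neg, Matrix.mul_nonsing_inv_cancel_left _ _ h0]
    rw [Finset.sum_congr rfl fun j _ => this j, Fin.sum_univ_three, stdFunctional_zero,
      stdFunctional_two, Matrix.mulVec_add, Matrix.mulVec_mulVec, Matrix.mulVec_mulVec, hA, hB,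
      Matrix.neg_mulVec, Matrix.neg_mulVec]
    abel
  · intro h
    simp only [ofSeq, LinearMap.comp_apply, AlgHom.toLinearMap_apply, map_mul, Frame.subst_form]
    exact stdFunctional_two _ _ _ _

theorem affine_ext (h0 : IsUnit (comb A (g.pt 0)).det) {E F : Functional m}
    (hE : E ∈ affineFunctionals A g) (hF : F ∈ affineFunctionals A g)
    (h : seqOf g E = seqOf g F) : E = F := by
  rw [← sub_eq_zero]
  refine affine_eq_zero g h0 (Submodule.sub_mem _ hE hF) fun k => ?_
  have := congrFun h k
  simp only [seqOf, LinearMap.sub_apply] at *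
  rw [this, sub_self]

/-- The value on a form of a functional whose sequence begins with zeros. -/
theorem apply_form_of_vanishing (h0 : IsUnit (comb A (g.pt 0)).det) {E : Functional m}
    (hE : E ∈ affineFunctionals A g) {k : ℕ} (hk : ∀ j < k, seqOf g E j = 0) {h : Poly}
    (hh : h.IsHomogeneous k) :
    E h = (Polynomial.aeval (stepA A g) (alongLine h (g.pt 1) (g.pt 0))).mulVec (seqOf g E k) := by
  revert E
  refine hom_induction (p := fun k h => ∀ {E : Functional m}, E ∈ affineFunctionals A g →
    (∀ j < k, seqOf g E j = 0) → E h = (Polynomial.aeval (stepA A g)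
      (alongLine h (g.pt 1) (g.pt 0))).mulVec (seqOf g E k)) ?_ ?_ ?_ ?_ hh
  · intro n E _ _
    simp [alongLine]
  · intro n f f' hf hf' E hE hn
    rw [map_add, hf hE hn, hf' hE hn, alongLine, alongLine, alongLine, map_add, map_add,
      Matrix.add_mulVec]
  · intro c E _ _
    have h1 := act_C_mul E c 1
    rw [mul_one] at h1
    rw [h1, alongLine, MvPolynomial.algHom_C, Polynomial.algebraMap_eq, Polynomial.aeval_C,
      Algebra.algebraMap_eq_smul_one, Matrix.smul_mulVec, Matrix.one_mulVec, seqOf, pow_zero]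
  · intro n l f hf E hE hn
    -- Multiplication by `X l` is again a first order recurrence. Its leading coefficient is the
    -- restriction of `X l` to the line pt 1 + t pt 0 at t = `stepA`, so passing to (X l) E
    -- multiplies the matrix polynomial by that factor.
    have hs : ∀ j, seqOf g (act (MvPolynomial.X l) E) j =
        (g.mat l 0 • stepA A g + g.mat l 1 • 1).mulVec (seqOf g E (j + 1)) +
        (g.mat l 0 • stepB A g + g.mat l 2 • 1).mulVec (seqOf g E j) := by
      intro j
      rw [seqOf, act_apply, g.X_eq l]
      simp only [Fin.sum_univ_three, add_mul, map_add, mul_assoc, act_C_mul]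
      rw [form_zero_apply g h0 hE.1, (mem_affineFunctionals g).1 hE |>.2, ← pow_succ']
      simp only [Matrix.add_mulVec, Matrix.smul_mulVec, Matrix.one_mulVec, seqOf, smul_add]
      abel
    have h1 := hf (act_mem_affine g hE (MvPolynomial.X l)) (by
      intro j hj
      rw [hs, hn j (by omega), hn (j + 1) (by omega)]
      simp)
    rw [← act_apply, h1, hs, hn n (by omega), Matrix.mulVec_zero, add_zero, Matrix.mulVec_mulVec]
    congr 1
    rw [mul_comm, alongLine, alongLine, map_mul, map_mul, MvPolynomial.aeval_X]
    congr 1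
    simp only [Frame.pt, map_add, map_mul, Polynomial.aeval_C, Polynomial.aeval_X,
      Algebra.algebraMap_eq_smul_one, smul_mul_assoc, one_mul]
    abel

end

end CurveElim
end

/-! ### Recurrences defined by a form. -/

noncomputable section
namespace CurveElim

section

variable {m : ℕ} {A : Fin 3 → Matrix (Fin m) (Fin m) ℂ} (g : Frame)

theorem alongLine_mul (G H : Poly) (y v : Fin 3 → ℂ) :
    alongLine (G * H) y v = alongLine G y v * alongLine H y v := map_mul _ _ _

theorem alongLine_add (G H : Poly) (y v : Fin 3 → ℂ) :
    alongLine (G + H) y v = alongLine G y v + alongLine H y v := map_add _ _ _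

theorem alongLine_pow (G : Poly) (k : ℕ) (y v : Fin 3 → ℂ) :
    alongLine (G ^ k) y v = alongLine G y v ^ k := map_pow _ _ _

theorem alongLine_form_one : alongLine (g.form 1) (g.pt 1) (g.pt 0) = 1 := by
  have h0 := g.inv_mul 1 0
  have h1 := g.inv_mul 1 1
  simp only [Fin.sum_univ_three] at h0 h1
  simp only [alongLine, Frame.form, Fin.sum_univ_three, map_add, map_mul, MvPolynomial.algHom_C,
    MvPolynomial.aeval_X, Frame.pt, Polynomial.algebraMap_eq]
  have e0 := congrArg Polynomial.C h0
  have e1 := congrArg Polynomial.C h1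
  simp at e0 e1
  linear_combination e1 + Polynomial.X * e0

/-- Along the line used for leading terms u is identically 1, so the factor u^k moves the index
without changing the matrix. -/
theorem apply_mul_pow_of_vanishing (h0 : IsUnit (comb A (g.pt 0)).det) {E : Functional m}
    (hE : E ∈ affineFunctionals A g) {n k : ℕ} (hk : ∀ j < n + k, seqOf g E j = 0) {P : Poly}
    (hP : P.IsHomogeneous n) :
    E (P * g.form 1 ^ k) = (Polynomial.aeval (stepA A g)
      (alongLine P (g.pt 1) (g.pt 0))).mulVec (seqOf g E (n + k)) := by
  have hh : (P * g.form 1 ^ k).IsHomogeneous (n + k) := by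
    have := hP.mul ((g.form_isHomogeneous 1).pow k)
    simpa using this
  rw [apply_form_of_vanishing g h0 hE hk hh, alongLine_mul, alongLine_pow, alongLine_form_one]
  simp

/-- The leading matrix of a form `P` along a frame. -/
def leadMatrix (A : Fin 3 → Matrix (Fin m) (Fin m) ℂ) (g : Frame) (P : Poly) :
    Matrix (Fin m) (Fin m) ℂ :=
  Polynomial.aeval (stepA A g) (alongLine P (g.pt 1) (g.pt 0))

theorem mulVec_eq_zero_of_isUnit {M : Matrix (Fin m) (Fin m) ℂ} (hM : IsUnit M.det)
    {v : Fin m → ℂ} (h : M.mulVec v = 0) : v = 0 := by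
  have := congrArg M⁻¹.mulVec h
  simpa [Matrix.mulVec_mulVec, Matrix.nonsing_inv_mul _ hM] using this

/-- Once the earlier terms vanish, (PE)(u^l) is the leading matrix applied to the term of index n +
l, so zeros propagate. -/
theorem affine_eq_zero_of_act (h0 : IsUnit (comb A (g.pt 0)).det) {n : ℕ} {P : Poly}
    (hP : P.IsHomogeneous n) (hH : IsUnit (leadMatrix A g P).det) {E : Functional m}
    (hE : E ∈ affineFunctionals A g) (hPE : act P E = 0) (hn : ∀ j < n, seqOf g E j = 0) :
    E = 0 := by
  refine affine_eq_zero g h0 hE fun k => ?_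
  induction k using Nat.strong_induction_on with
  | _ k ih =>
    rcases lt_or_ge k n with hk | hk
    · exact hn k hk
    · obtain ⟨l, rfl⟩ := Nat.exists_eq_add_of_le hk
      have h1 := apply_mul_pow_of_vanishing g h0 hE ih hP
      rw [← act_apply, hPE, LinearMap.zero_apply] at h1
      exact mulVec_eq_zero_of_isUnit hH h1.symm

/-- The solution of the recurrence defined by a form `P` with given initial values. -/
def solveSeq (A : Fin 3 → Matrix (Fin m) (Fin m) ℂ) (g : Frame) (P : Poly) (n : ℕ)
    (e : ℕ → Fin m → ℂ) (k : ℕ) : Fin m → ℂ :=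
  if k < n then e k else
    -((leadMatrix A g P)⁻¹.mulVec
      (ofSeq A g (fun j => if _ : j < k then solveSeq A g P n e j else 0)
        (P * g.form 1 ^ (k - n))))
termination_by k

/-- An invertible leading matrix allows PE = 0 to be solved forward as a recurrence of order n. With
`affine_eq_zero_of_act` the functionals killed by P correspond to their first n terms. -/
theorem exists_affine_of_initial (h0 : IsUnit (comb A (g.pt 0)).det) {n : ℕ} {P : Poly}
    (hP : P.IsHomogeneous n) (hH : IsUnit (leadMatrix A g P).det) (e : ℕ → Fin m → ℂ) :
    ∃ E ∈ affineFunctionals A g, act P E = 0 ∧ ∀ j < n, seqOf g E j = e j := by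
  have hmem := ofSeq_mem g h0 (solveSeq A g P n e)
  refine ⟨ofSeq A g (solveSeq A g P n e), hmem, ?_, ?_⟩
  · refine affine_eq_zero g h0 (act_mem_affine g hmem P) fun k => ?_
    -- T keeps the terms of index below n + k. The difference starts at index n + k, so its value on
    -- P u^k is the leading matrix times that term, which `solveSeq` chose to cancel the
    -- contribution of T.
    set T := ofSeq A g (fun j => if j < n + k then solveSeq A g P n e j else 0) with hT
    have hTm : T ∈ affineFunctionals A g := ofSeq_mem g h0 _
    have hsub : ∀ j, seqOf g (ofSeq A g (solveSeq A g P n e) - T) j =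
        if j < n + k then 0 else solveSeq A g P n e j := by
      intro j
      have h1 := congrFun (seqOf_ofSeq (A := A) g (solveSeq A g P n e)) j
      have h2 := congrFun (seqOf_ofSeq (A := A) g
        (fun j => if j < n + k then solveSeq A g P n e j else 0)) j
      simp only [seqOf, LinearMap.sub_apply] at *
      rw [h1, h2]
      split_ifs <;> simp
    have h3 := apply_mul_pow_of_vanishing g h0 (Submodule.sub_mem _ hmem hTm) (n := n) (k := k)
      (fun j hj => by rw [hsub, if_pos hj]) hP
    rw [hsub, if_neg (lt_irrefl _), LinearMap.sub_apply, sub_eq_iff_eq_add] at h3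
    change act P (ofSeq A g (solveSeq A g P n e)) (g.form 1 ^ k) = 0
    rw [act_apply, h3]
    conv_lhs => rw [solveSeq]
    rw [if_neg (by omega), Matrix.mulVec_neg, Matrix.mulVec_mulVec]
    change -(leadMatrix A g P * (leadMatrix A g P)⁻¹).mulVec _ + _ = 0
    rw [Matrix.mul_nonsing_inv _ hH, Matrix.one_mulVec, hT]
    simp only [Nat.add_sub_cancel_left, dite_eq_ite]
    exact neg_add_cancel _
  · intro j hj
    rw [seqOf_ofSeq, solveSeq, if_pos hj]

end

/-! ### The Bezout pairing -/

/-- The monomial with given exponents. -/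
def mon (i : Fin 3 → ℕ) : Poly := ∏ k, MvPolynomial.X k ^ i k

@[simp] theorem eval_mon (i : Fin 3 → ℕ) (x : Fin 3 → ℂ) :
    MvPolynomial.eval x (mon i) = monom i x := by
  simp [mon, monom]

theorem mon_isHomogeneous (i : Fin 3 → ℕ) : (mon i).IsHomogeneous (∑ k, i k) := by
  refine MvPolynomial.IsHomogeneous.prod _ _ _ fun k _ => ?_
  have := (MvPolynomial.isHomogeneous_X ℂ k).pow (i k)
  simpa using this

theorem expo_sum {n : ℕ} (i : Expo n) : ∑ k, i.1 k = n - 1 :=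
  (Finset.mem_piAntidiag.1 i.2).1

/-- The coefficients `γ` decompose `P(x) Q(y) - Q(x) P(y)`. -/
def IsBezout {n : ℕ} (γ : Fin 3 → Expo n → Expo n → ℂ) (P Q : Poly) : Prop :=
  ∀ x y : Fin 3 → ℂ, MvPolynomial.eval x P * MvPolynomial.eval y Q
      - MvPolynomial.eval x Q * MvPolynomial.eval y P =
    ∑ i : Expo n, ∑ j : Expo n,
      (γ 0 i j * (monom i.1 x * (x 1 * y 2 - x 2 * y 1) * monom j.1 y)
        + γ 1 i j * (monom i.1 x * (x 2 * y 0 - x 0 * y 2) * monom j.1 y)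
        + γ 2 i j * (monom i.1 x * (x 0 * y 1 - x 1 * y 0) * monom j.1 y))

/-- A polynomial identity in two separate groups of variables survives applying one linear
functional to each group, in place of evaluation at points. -/
theorem IsBezout.functional {n : ℕ} {γ : Fin 3 → Expo n → Expo n → ℂ} {P Q : Poly}
    (h : IsBezout γ P Q) (ψ φ : Poly →ₗ[ℂ] ℂ) :
    ψ P * φ Q - ψ Q * φ P = ∑ i : Expo n, ∑ j : Expo n,
      (γ 0 i j * (ψ (MvPolynomial.X 1 * mon i.1) * φ (MvPolynomial.X 2 * mon j.1)
          - ψ (MvPolynomial.X 2 * mon i.1) * φ (MvPolynomial.X 1 * mon j.1))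
        + γ 1 i j * (ψ (MvPolynomial.X 2 * mon i.1) * φ (MvPolynomial.X 0 * mon j.1)
          - ψ (MvPolynomial.X 0 * mon i.1) * φ (MvPolynomial.X 2 * mon j.1))
        + γ 2 i j * (ψ (MvPolynomial.X 0 * mon i.1) * φ (MvPolynomial.X 1 * mon j.1)
          - ψ (MvPolynomial.X 1 * mon i.1) * φ (MvPolynomial.X 0 * mon j.1))) := by
  -- With x frozen this is an identity of polynomials in y, to which φ applies. The result is an
  -- identity of polynomials in x, to which ψ applies.
  have h1 : ∀ x : Fin 3 → ℂ, MvPolynomial.eval x P • Q - MvPolynomial.eval x Q • P =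
      ∑ i : Expo n, ∑ j : Expo n,
        ((γ 0 i j * monom i.1 x) • (x 1 • (MvPolynomial.X 2 * mon j.1)
            - x 2 • (MvPolynomial.X 1 * mon j.1))
          + (γ 1 i j * monom i.1 x) • (x 2 • (MvPolynomial.X 0 * mon j.1)
            - x 0 • (MvPolynomial.X 2 * mon j.1))
          + (γ 2 i j * monom i.1 x) • (x 0 • (MvPolynomial.X 1 * mon j.1)
            - x 1 • (MvPolynomial.X 0 * mon j.1))) := by
    intro x
    refine MvPolynomial.funext fun y => ?_
    simp only [map_sub, MvPolynomial.smul_eval, h x y, map_sum, map_add, map_mul,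
      MvPolynomial.eval_X, eval_mon]
    exact Finset.sum_congr rfl fun i _ => Finset.sum_congr rfl fun j _ => by ring
  have h2 : φ Q • P - φ P • Q =
      ∑ i : Expo n, ∑ j : Expo n,
        (γ 0 i j • (φ (MvPolynomial.X 2 * mon j.1) • (MvPolynomial.X 1 * mon i.1)
            - φ (MvPolynomial.X 1 * mon j.1) • (MvPolynomial.X 2 * mon i.1))
          + γ 1 i j • (φ (MvPolynomial.X 0 * mon j.1) • (MvPolynomial.X 2 * mon i.1)
            - φ (MvPolynomial.X 2 * mon j.1) • (MvPolynomial.X 0 * mon i.1))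
          + γ 2 i j • (φ (MvPolynomial.X 1 * mon j.1) • (MvPolynomial.X 0 * mon i.1)
            - φ (MvPolynomial.X 0 * mon j.1) • (MvPolynomial.X 1 * mon i.1))) := by
    refine MvPolynomial.funext fun x => ?_
    have h3 := congrArg φ (h1 x)
    simp only [map_sub, map_smul, map_sum, map_add, smul_eq_mul] at h3
    simp only [map_sub, MvPolynomial.smul_eval, map_sum, map_add, map_mul, eval_mon,
      MvPolynomial.eval_X]
    rw [mul_comm (φ Q), mul_comm (φ P), h3]
    exact Finset.sum_congr rfl fun i _ => Finset.sum_congr rfl fun j _ => by ring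
  have h3 := congrArg ψ h2
  simp only [map_sub, map_smul, map_sum, map_add, smul_eq_mul] at h3
  rw [mul_comm (ψ P), mul_comm (ψ Q), h3]
  exact Finset.sum_congr rfl fun i _ => Finset.sum_congr rfl fun j _ => by ring

section

variable {m : ℕ} {A : Fin 3 → Matrix (Fin m) (Fin m) ℂ} (g : Frame)

/-- The pairing of two functionals through a matrix. -/
def pair (M : Matrix (Fin m) (Fin m) ℂ) (F E : Functional m) (f h : Poly) : ℂ :=
  F f ⬝ᵥ M.mulVec (E h)

/-- The Bezout pairing of two functionals. -/
def bez {n : ℕ} (γ : Fin 3 → Expo n → Expo n → ℂ) (A : Fin 3 → Matrix (Fin m) (Fin m) ℂ)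
    (F E : Functional m) : ℂ :=
  ∑ i : Expo n, ∑ j : Expo n, ∑ k, γ k i j * pair (A k) F E (mon i.1) (mon j.1)

theorem pair_eq_sum (M : Matrix (Fin m) (Fin m) ℂ) (F E : Functional m) (f h : Poly) :
    pair M F E f h = ∑ a, ∑ b, M a b * (F f a * E h b) := by
  simp only [pair, dotProduct, Matrix.mulVec, Finset.mul_sum]
  exact Finset.sum_congr rfl fun a _ => Finset.sum_congr rfl fun b _ => by ring

theorem IsBezout.pair {n : ℕ} {γ : Fin 3 → Expo n → Expo n → ℂ} {P Q : Poly}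
    (h : IsBezout γ P Q) (M : Matrix (Fin m) (Fin m) ℂ) (F E : Functional m) :
    pair M F E P Q - pair M F E Q P = ∑ i : Expo n, ∑ j : Expo n,
      (γ 0 i j * (pair M F E (MvPolynomial.X 1 * mon i.1) (MvPolynomial.X 2 * mon j.1)
          - pair M F E (MvPolynomial.X 2 * mon i.1) (MvPolynomial.X 1 * mon j.1))
        + γ 1 i j * (pair M F E (MvPolynomial.X 2 * mon i.1) (MvPolynomial.X 0 * mon j.1)
          - pair M F E (MvPolynomial.X 0 * mon i.1) (MvPolynomial.X 2 * mon j.1))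
        + γ 2 i j * (pair M F E (MvPolynomial.X 0 * mon i.1) (MvPolynomial.X 1 * mon j.1)
          - pair M F E (MvPolynomial.X 1 * mon i.1) (MvPolynomial.X 0 * mon j.1))) := by
  have key := fun a b => h.functional (LinearMap.proj a ∘ₗ F) (LinearMap.proj b ∘ₗ E)
  simp only [LinearMap.comp_apply, LinearMap.proj_apply] at key
  simp only [pair_eq_sum, ← Finset.sum_sub_distrib, ← mul_sub, key]
  simp only [Finset.mul_sum, ← Finset.sum_add_distrib]
  rw [Finset.sum_congr rfl fun a _ => Finset.sum_comm, Finset.sum_comm]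
  refine Finset.sum_congr rfl fun i _ => ?_
  rw [Finset.sum_congr rfl fun a _ => Finset.sum_comm, Finset.sum_comm]
  refine Finset.sum_congr rfl fun j _ => Finset.sum_congr rfl fun a _ =>
    Finset.sum_congr rfl fun b _ => by ring

theorem pair_rel_right {F E : Functional m} (hE : E ∈ kerFunctionals A) (f h : Poly) :
    ∑ k, pair (A k) F E f (MvPolynomial.X k * h) = 0 := by
  simp only [pair, ← dotProduct_sum, hE h, dotProduct_zero]

theorem pair_rel_left {F E : Functional m} (hF : F ∈ kerFunctionals fun k => (A k).transpose)
    (f h : Poly) : ∑ k, pair (A k) F E (MvPolynomial.X k * f) h = 0 := by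
  have h1 : ∀ k, pair (A k) F E (MvPolynomial.X k * f) h =
      (A k).transpose.mulVec (F (MvPolynomial.X k * f)) ⬝ᵥ E h := by
    intro k
    rw [pair, Matrix.dotProduct_mulVec, Matrix.mulVec_transpose]
  simp only [h1, ← sum_dotProduct, hF f, zero_dotProduct]

theorem pair_expand (M : Matrix (Fin m) (Fin m) ℂ) (F E : Functional m) (p q : Fin 3)
    (f h : Poly) : pair M F E (MvPolynomial.X p * f) (MvPolynomial.X q * h) =
      ∑ a, ∑ b, g.mat p a * g.mat q b * pair M F E (g.form a * f) (g.form b * h) := by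
  have h1 : ∀ (T : Functional m) (p : Fin 3) (f : Poly), T (MvPolynomial.X p * f) =
      ∑ a, g.mat p a • T (g.form a * f) := by
    intro T p f
    conv_lhs => rw [g.X_eq p]
    simp only [Finset.sum_mul, map_sum, mul_assoc, act_C_mul]
  rw [pair, h1, h1]
  simp only [sum_dotProduct, Matrix.mulVec_sum, dotProduct_sum, smul_dotProduct,
    Matrix.mulVec_smul, dotProduct_smul, smul_eq_mul, pair, mul_assoc, Finset.mul_sum]
  rw [Finset.sum_comm]
  exact Finset.sum_congr rfl fun a _ => Finset.sum_congr rfl fun b _ => by ring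

/-- The determinant of a frame. -/
def Frame.det (g : Frame) : ℂ := (Matrix.of g.mat).det

theorem Frame.det_ne_zero (g : Frame) : g.det ≠ 0 := by
  have h : (Matrix.of g.mat) * (Matrix.of g.inv) = 1 := by
    ext i k
    rw [Matrix.mul_apply, Matrix.one_apply]
    exact g.mul_inv i k
  intro h0
  have := congrArg Matrix.det h
  rw [Matrix.det_mul, Matrix.det_one] at this
  rw [Frame.det] at h0
  rw [h0, zero_mul] at this
  exact zero_ne_one this

/-- Expanding in the frame produces the 2 × 2 minors, contracted with the first column. This is a
cofactor expansion: it yields the determinant for the pair u, z and a determinant with a repeated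
column for the other pairs. -/
theorem pair_frame (M : Matrix (Fin m) (Fin m) ℂ) (F E : Functional m) (f h : Poly) :
    g.mat 0 0 * (pair M F E (MvPolynomial.X 1 * f) (MvPolynomial.X 2 * h)
          - pair M F E (MvPolynomial.X 2 * f) (MvPolynomial.X 1 * h))
      + g.mat 1 0 * (pair M F E (MvPolynomial.X 2 * f) (MvPolynomial.X 0 * h)
          - pair M F E (MvPolynomial.X 0 * f) (MvPolynomial.X 2 * h))
      + g.mat 2 0 * (pair M F E (MvPolynomial.X 0 * f) (MvPolynomial.X 1 * h)
          - pair M F E (MvPolynomial.X 1 * f) (MvPolynomial.X 0 * h)) =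
    g.det * (pair M F E (g.form 1 * f) (g.form 2 * h)
      - pair M F E (g.form 2 * f) (g.form 1 * h)) := by
  simp only [pair_expand g, Fin.sum_univ_three, Frame.det, Matrix.det_fin_three, Matrix.of_apply]
  ring

theorem bez_key_aux {n : ℕ} {γ : Fin 3 → Expo n → Expo n → ℂ} {P Q : Poly}
    (h : IsBezout γ P Q) {F E : Functional m}
    (hF : F ∈ kerFunctionals fun k => (A k).transpose) (hE : E ∈ kerFunctionals A) :
    ∑ k, g.mat k 0 * (pair (A k) F E P Q - pair (A k) F E Q P) =
      ∑ i : Expo n, ∑ j : Expo n, ∑ k, γ k i j * (g.det *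
        (pair (A k) F E (g.form 1 * mon i.1) (g.form 2 * mon j.1)
          - pair (A k) F E (g.form 2 * mon i.1) (g.form 1 * mon j.1))) := by
  simp only [h.pair, Finset.mul_sum (s := Finset.univ (α := Expo n))]
  rw [Finset.sum_comm]
  refine Finset.sum_congr rfl fun i _ => ?_
  rw [Finset.sum_comm]
  refine Finset.sum_congr rfl fun j _ => ?_
  simp only [← pair_frame g]
  have hr := fun p => pair_rel_right (F := F) hE (MvPolynomial.X p * mon i.1) (mon j.1)
  have hl := fun q => pair_rel_left (E := E) hF (mon i.1) (MvPolynomial.X q * mon j.1)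
  have r0 := hr 0
  have r1 := hr 1
  have r2 := hr 2
  have l0 := hl 0
  have l1 := hl 1
  have l2 := hl 2
  simp only [Fin.sum_univ_three] at r0 r1 r2 l0 l1 l2 ⊢
  -- Exchanging the roles of γ and the first column of the frame leaves terms with the cross product
  -- of these two vectors. By the triple product identity each of them contains the pencil relation
  -- on the right or on the left.
  linear_combination (exp := 1) (γ 1 i j * g.mat 0 0 - γ 0 i j * g.mat 1 0) * (r2 - l2)
    + (γ 2 i j * g.mat 1 0 - γ 1 i j * g.mat 2 0) * (r0 - l0)
    + (γ 0 i j * g.mat 2 0 - γ 2 i j * g.mat 0 0) * (r1 - l1)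

theorem sum_pair (M : Fin 3 → Matrix (Fin m) (Fin m) ℂ) (v : Fin 3 → ℂ) (F E : Functional m)
    (f h : Poly) : ∑ k, v k * pair (M k) F E f h = pair (comb M v) F E f h := by
  simp only [pair, comb, Matrix.sum_mulVec, dotProduct_sum, Matrix.smul_mulVec,
    dotProduct_smul, smul_eq_mul]

/-- The intertwining relation of the Bezout pairing. -/
theorem bez_key {n : ℕ} {γ : Fin 3 → Expo n → Expo n → ℂ} {P Q : Poly}
    (h : IsBezout γ P Q) {F E : Functional m}
    (hF : F ∈ affineFunctionals (fun k => (A k).transpose) g) (hE : E ∈ affineFunctionals A g) :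
    g.det * (bez γ A (act (g.form 1) F) E - bez γ A F (act (g.form 1) E)) =
      pair (comb A (g.pt 0)) F E P Q - pair (comb A (g.pt 0)) F E Q P := by
  rw [← sum_pair, ← sum_pair, ← Finset.sum_sub_distrib]
  simp only [← mul_sub]
  rw [show (∑ k, g.pt 0 k * (pair (A k) F E P Q - pair (A k) F E Q P)) =
    ∑ k, g.mat k 0 * (pair (A k) F E P Q - pair (A k) F E Q P) from rfl,
    bez_key_aux g h hF.1 hE.1, bez, bez, ← Finset.sum_sub_distrib, Finset.mul_sum]
  refine Finset.sum_congr rfl fun i _ => ?_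
  rw [← Finset.sum_sub_distrib, Finset.mul_sum]
  refine Finset.sum_congr rfl fun j _ => ?_
  rw [← Finset.sum_sub_distrib, Finset.mul_sum]
  refine Finset.sum_congr rfl fun k _ => ?_
  simp only [pair, act_apply, ((mem_affineFunctionals g).1 hE).2,
    ((mem_affineFunctionals g).1 hF).2]
  ring

theorem bez_congr {n : ℕ} (γ : Fin 3 → Expo n → Expo n → ℂ) {F F' E E' : Functional m}
    (hF : ∀ i : Expo n, F (mon i.1) = F' (mon i.1))
    (hE : ∀ i : Expo n, E (mon i.1) = E' (mon i.1)) : bez γ A F E = bez γ A F' E' := by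
  simp only [bez, pair, hF, hE]

theorem bez_zero_left {n : ℕ} (γ : Fin 3 → Expo n → Expo n → ℂ) {F : Functional m}
    (E : Functional m) (hF : ∀ i : Expo n, F (mon i.1) = 0) : bez γ A F E = 0 := by
  simp [bez, pair, hF]

theorem bez_sub_left {n : ℕ} (γ : Fin 3 → Expo n → Expo n → ℂ) (F F' E : Functional m) :
    bez γ A (F - F') E = bez γ A F E - bez γ A F' E := by
  simp only [bez, pair, LinearMap.sub_apply, sub_dotProduct, mul_sub, Finset.sum_sub_distrib]

theorem bez_smul_left {n : ℕ} (γ : Fin 3 → Expo n → Expo n → ℂ) (c : ℂ) (F E : Functional m) :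
    bez γ A (c • F) E = c * bez γ A F E := by
  simp only [bez, pair, LinearMap.smul_apply, smul_dotProduct, smul_eq_mul, Finset.mul_sum,
    mul_left_comm]

theorem bez_smul_right {n : ℕ} (γ : Fin 3 → Expo n → Expo n → ℂ) (c : ℂ) (F E : Functional m) :
    bez γ A F (c • E) = c * bez γ A F E := by
  simp only [bez, pair, LinearMap.smul_apply, Matrix.mulVec_smul, dotProduct_smul, smul_eq_mul,
    Finset.mul_sum, mul_left_comm]

theorem affine_mon_eq_zero (h0 : IsUnit (comb A (g.pt 0)).det) {n : ℕ} (hn : 0 < n)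
    {E : Functional m} (hE : E ∈ affineFunctionals A g) (h : ∀ j < n, seqOf g E j = 0)
    (i : Expo n) : E (mon i.1) = 0 :=
  affine_eq_zero_of_hom g h0 hE (N := n - 1) (fun k hk => h k (by omega))
    (by simpa only [expo_sum] using mon_isHomogeneous i.1)

theorem isUnit_transpose_comb (h0 : IsUnit (comb A (g.pt 0)).det) :
    IsUnit (comb (fun k => (A k).transpose) (g.pt 0)).det := by
  have : comb (fun k => (A k).transpose) (g.pt 0) = (comb A (g.pt 0)).transpose := by
    simp [comb, Matrix.transpose_sum, Matrix.transpose_smul]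
  rwa [this, Matrix.det_transpose]

theorem seqOf_act_one (E : Functional m) (k : ℕ) :
    seqOf g (act (g.form 1) E) k = seqOf g E (k + 1) := by
  rw [seqOf, act_apply, ← pow_succ', seqOf]

/-- A functional killed by `P` in the kernel of the Bezout pairing of `P` and `Q` is killed
by `Q`. -/
theorem act_eq_zero_of_bez (h0 : IsUnit (comb A (g.pt 0)).det) {n : ℕ} (hn : 0 < n)
    {γ : Fin 3 → Expo n → Expo n → ℂ} {P Q : Poly} (hP : P.IsHomogeneous n)
    (hb : IsBezout γ P Q)
    (hH : IsUnit (leadMatrix (fun k => (A k).transpose) g P).det) {E : Functional m}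
    (hE : E ∈ affineFunctionals A g) (hPE : act P E = 0)
    (hker : ∀ F ∈ affineFunctionals (fun k => (A k).transpose) g, bez γ A F E = 0) :
    act Q E = 0 := by
  have h0' := isUnit_transpose_comb g h0
  have main : ∀ E ∈ affineFunctionals A g, act P E = 0 →
      (∀ F ∈ affineFunctionals (fun k => (A k).transpose) g, bez γ A F E = 0) → E Q = 0 := by
    intro E hE hPE hker
    have hP0 : E P = 0 := by
      have := DFunLike.congr_fun hPE 1
      simpa using this
    refine mulVec_eq_zero_of_isUnit h0 ?_
    refine mulVec_eq_zero_of_isUnit (M := (leadMatrix (fun k => (A k).transpose) g P).transpose)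
      (by rwa [Matrix.det_transpose]) ?_
    refine dotProduct_eq_zero _ fun v => ?_
    -- A test functional concentrated at index n. It vanishes in degree n - 1, so its pairing with
    -- uE is zero, while F(P) is the leading matrix times the arbitrary vector v. With E(P) = 0,
    -- `bez_key` reduces to F(P)ᵀ A E(Q) = 0.
    set f : ℕ → Fin m → ℂ := fun j => if j = n then v else 0 with hf
    set F := ofSeq (fun k => (A k).transpose) g f with hFdef
    have hF : F ∈ affineFunctionals (fun k => (A k).transpose) g := ofSeq_mem g h0' f
    have hseq : seqOf g F = f := seqOf_ofSeq g f
    have hz : ∀ i : Expo n, F (mon i.1) = 0 := affine_mon_eq_zero g h0' hn hF (by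
      intro j hj
      rw [hseq, hf]
      simp only
      rw [if_neg (by omega)])
    have h1 := bez_key g hb hF hE
    rw [hker _ (act_mem_affine g hF _), bez_zero_left γ _ hz] at h1
    have h2 := apply_mul_pow_of_vanishing g h0' hF (n := n) (k := 0) (by
      intro j hj
      rw [hseq, hf]
      simp only
      rw [if_neg (by omega)]) hP
    rw [pow_zero, mul_one, add_zero, hseq] at h2
    simp only [pair, hP0, Matrix.mulVec_zero, dotProduct_zero, sub_zero, mul_zero] at h1
    rw [h2, hf] at h1
    simp only [if_true] at h1
    rw [Matrix.mulVec_transpose, ← Matrix.dotProduct_mulVec, dotProduct_comm]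
    simpa [leadMatrix] using h1.symm
  -- Since E(P) = E(Q) = 0, the boundary terms in `bez_key` vanish and uE is again in the kernel. So
  -- `main` applies to each u^k E and gives E(Q u^k) = 0.
  have iter : ∀ k, act (g.form 1 ^ k) E ∈ affineFunctionals A g ∧
      act P (act (g.form 1 ^ k) E) = 0 ∧
      ∀ F ∈ affineFunctionals (fun k => (A k).transpose) g,
        bez γ A F (act (g.form 1 ^ k) E) = 0 := by
    intro k
    induction k with
    | zero =>
      have : act (g.form 1 ^ 0) E = E := LinearMap.ext fun h => by simp
      rw [this]
      exact ⟨hE, hPE, hker⟩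
    | succ k ih =>
      obtain ⟨h1, h2, h3⟩ := ih
      have he : act (g.form 1 ^ (k + 1)) E = act (g.form 1) (act (g.form 1 ^ k) E) :=
        LinearMap.ext fun h => by simp [pow_succ, mul_assoc]
      have hc : act P (act (g.form 1) (act (g.form 1 ^ k) E)) =
          act (g.form 1) (act P (act (g.form 1 ^ k) E)) :=
        LinearMap.ext fun h => by simp [mul_left_comm]
      refine ⟨act_mem_affine g hE _, ?_, ?_⟩
      · rw [he, hc, h2]
        exact LinearMap.ext fun h => by simp
      · intro F hF
        have h4 := bez_key g hb hF h1
        have hP0 : act (g.form 1 ^ k) E P = 0 := by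
          have := DFunLike.congr_fun h2 1
          simpa using this
        have hQ0 := main _ h1 h2 h3
        rw [h3 _ (act_mem_affine g hF _)] at h4
        simp only [pair, hP0, hQ0, Matrix.mulVec_zero, dotProduct_zero, sub_zero, zero_sub] at h4
        rw [he]
        simpa [g.det_ne_zero] using h4
  refine affine_eq_zero g h0 (act_mem_affine g hE Q) fun k => ?_
  obtain ⟨h1, h2, h3⟩ := iter k
  have := main _ h1 h2 h3
  rw [seqOf, act_apply, mul_comm]
  simpa using this

/-- Eigenfunctionals at common zeros are in the kernel of the Bezout pairing. -/
theorem bez_eq_zero_of_eigen (h0 : IsUnit (comb A (g.pt 0)).det) {n : ℕ}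
    {γ : Fin 3 → Expo n → Expo n → ℂ} {P Q : Poly} (hb : IsBezout γ P Q) {E : Functional m}
    (hE : E ∈ affineFunctionals A g) {c : ℂ} (hc : act (g.form 1) E = c • E)
    (hP : E P = 0) (hQ : E Q = 0) {F : Functional m}
    (hF : F ∈ affineFunctionals (fun k => (A k).transpose) g) : bez γ A F E = 0 := by
  have h0' := isUnit_transpose_comb g h0
  -- Solves (u - c) F' = F by forward recurrence. As uE = cE and the boundary terms vanish, moving u
  -- - c across the pairing gives zero.
  set f : ℕ → Fin m → ℂ := fun k => Nat.rec 0 (fun j v => c • v + seqOf g F j) k with hf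
  set F' := ofSeq (fun k => (A k).transpose) g f with hFdef
  have hF' : F' ∈ affineFunctionals (fun k => (A k).transpose) g := ofSeq_mem g h0' f
  have hseq : seqOf g F' = f := seqOf_ofSeq g f
  have hFF : act (g.form 1) F' - c • F' = F := by
    refine affine_ext g h0' (Submodule.sub_mem _ (act_mem_affine g hF' _)
      (Submodule.smul_mem _ _ hF')) hF ?_
    funext k
    have h1 : seqOf g (act (g.form 1) F' - c • F') k =
        seqOf g (act (g.form 1) F') k - c • seqOf g F' k := rfl
    rw [h1, seqOf_act_one, hseq, hf]
    simp
  have h1 := bez_key g hb hF' hE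
  simp only [pair, hP, hQ, Matrix.mulVec_zero, dotProduct_zero, sub_zero] at h1
  rw [hc, bez_smul_right] at h1
  rw [← hFF, bez_sub_left, bez_smul_left]
  simpa [g.det_ne_zero] using h1

/-- The Bezout pairing does not depend on the choice of the coefficients. -/
theorem bez_eq_zero_of_trivial (h0 : IsUnit (comb A (g.pt 0)).det) {n : ℕ} (hn : 0 < n)
    {γ : Fin 3 → Expo n → Expo n → ℂ} (hb : IsBezout γ 0 0) {F E : Functional m}
    (hF : F ∈ affineFunctionals (fun k => (A k).transpose) g) (hE : E ∈ affineFunctionals A g) :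
    bez γ A F E = 0 := by
  have h0' := isUnit_transpose_comb g h0
  -- E' truncates E after n terms, which degree n - 1 does not notice, and F' delays F by n. Then
  -- u^n F' = F and u^n E' = 0, while u is self-adjoint for a decomposition of zero.
  set E' := ofSeq A g (fun j => if j < n then seqOf g E j else 0) with hE'def
  have hE' : E' ∈ affineFunctionals A g := ofSeq_mem g h0 _
  have hEseq : seqOf g E' = fun j => if j < n then seqOf g E j else 0 := seqOf_ofSeq g _
  set F' := ofSeq (fun k => (A k).transpose) g
    (fun j => if j < n then 0 else seqOf g F (j - n)) with hF'def
  have hF' : F' ∈ affineFunctionals (fun k => (A k).transpose) g := ofSeq_mem g h0' _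
  have hFseq : seqOf g F' = fun j => if j < n then 0 else seqOf g F (j - n) := seqOf_ofSeq g _
  have hmove : ∀ k, ∀ F' ∈ affineFunctionals (fun k => (A k).transpose) g,
      ∀ E' ∈ affineFunctionals A g,
      bez γ A (act (g.form 1 ^ k) F') E' = bez γ A F' (act (g.form 1 ^ k) E') := by
    intro k
    induction k with
    | zero =>
      intro F' _ E' _
      exact bez_congr γ (fun i => by simp) (fun i => by simp)
    | succ k ih =>
      intro F' hF' E' hE'
      have he : ∀ T : Functional m, act (g.form 1 ^ (k + 1)) T =
          act (g.form 1) (act (g.form 1 ^ k) T) :=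
        fun T => LinearMap.ext fun h => by simp [pow_succ, mul_assoc]
      have he' : ∀ T : Functional m, act (g.form 1 ^ (k + 1)) T =
          act (g.form 1 ^ k) (act (g.form 1) T) :=
        fun T => LinearMap.ext fun h => by simp [pow_succ, mul_left_comm, mul_assoc]
      have h1 := bez_key g hb (act_mem_affine g hF' (g.form 1 ^ k)) hE'
      simp only [pair, map_zero, Matrix.mulVec_zero, dotProduct_zero, sub_zero,
        mul_eq_zero, g.det_ne_zero, false_or] at h1
      rw [he, sub_eq_zero.1 h1, ih _ hF' _ (act_mem_affine g hE' _), ← he']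
  have hF2 : act (g.form 1 ^ n) F' = F := by
    refine affine_ext g h0' (act_mem_affine g hF' _) hF ?_
    funext k
    have : seqOf g (act (g.form 1 ^ n) F') k = seqOf g F' (n + k) := by
      rw [seqOf, act_apply, ← pow_add, seqOf]
    rw [this, hFseq]
    simp
  have hE2 : act (g.form 1 ^ n) E' = 0 := by
    refine affine_eq_zero g h0 (act_mem_affine g hE' _) fun k => ?_
    have : seqOf g (act (g.form 1 ^ n) E') k = seqOf g E' (n + k) := by
      rw [seqOf, act_apply, ← pow_add, seqOf]
    rw [this, hEseq]
    simp
  have hEE : ∀ i : Expo n, E (mon i.1) = E' (mon i.1) := by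
    intro i
    rw [← sub_eq_zero, ← LinearMap.sub_apply]
    refine affine_mon_eq_zero g h0 hn (Submodule.sub_mem _ hE hE') (fun j hj => ?_) i
    have : seqOf g (E - E') j = seqOf g E j - seqOf g E' j := rfl
    rw [this, hEseq]
    simp [hj]
  rw [bez_congr γ (fun i => rfl) hEE, ← hF2, hmove n _ hF' _ hE', hE2]
  simp [bez, pair]

end

end CurveElim
end

/-! ### Functionals killed by two forms, and evaluations. -/

noncomputable section
namespace CurveElim

/-- Vectors of a finite dimensional space are sums of joint generalized eigenvectors of
commuting operators. -/
theorem mem_span_joint_generalized {V : Type*} [AddCommGroup V] [Module ℂ V]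
    [FiniteDimensional ℂ V] (T : Fin 3 → Module.End ℂ V) (hT : ∀ k l, T k * T l = T l * T k)
    (v : V) : v ∈ Submodule.span ℂ {w : V | ∃ y : Fin 3 → ℂ, ∀ l, ∃ a : ℕ,
      (fun w => T l w - y l • w)^[a] w = 0} := by
  have htop := Module.End.iSup_iInf_maxGenEigenspace_eq_top_of_iSup_maxGenEigenspace_eq_top_of_commute
    T (fun k l _ => hT k l) (fun l => Module.End.iSup_maxGenEigenspace_eq_top _)
  have hmem : v ∈ ⨆ χ : Fin 3 → ℂ, ⨅ l, (T l).maxGenEigenspace (χ l) := by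
    rw [htop]
    trivial
  refine (iSup_le fun y => ?_ : (⨆ χ : Fin 3 → ℂ, ⨅ l, (T l).maxGenEigenspace (χ l)) ≤ _) hmem
  intro w hw
  refine Submodule.subset_span ⟨y, fun l => ?_⟩
  obtain ⟨a, ha⟩ := (Module.End.mem_maxGenEigenspace _ _ _).1 ((Submodule.mem_iInf _).1 hw l)
  refine ⟨a, ?_⟩
  rw [← ha]
  clear ha hw
  induction a generalizing w with
  | zero => rfl
  | succ a ih =>
    rw [Function.iterate_succ_apply, ih, pow_succ, Module.End.mul_apply]
    rfl

section

variable {m : ℕ} {A : Fin 3 → Matrix (Fin m) (Fin m) ℂ} (g : Frame)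

/-- Evaluation at `y` along the vector `e`. -/
def evalFun (y : Fin 3 → ℂ) (e : Fin m → ℂ) : Functional m :=
  (MvPolynomial.aeval y : Poly →ₐ[ℂ] ℂ).toLinearMap.smulRight e

@[simp] theorem evalFun_apply (y : Fin 3 → ℂ) (e : Fin m → ℂ) (h : Poly) :
    evalFun y e h = MvPolynomial.eval y h • e := by
  simp [evalFun, MvPolynomial.aeval_eq_eval]

theorem evalFun_mem_ker_iff {y : Fin 3 → ℂ} {e : Fin m → ℂ} :
    evalFun y e ∈ kerFunctionals A ↔ (comb A y).mulVec e = 0 := by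
  rw [mem_kerFunctionals]
  have : ∀ h : Poly, ∑ k, (A k).mulVec (evalFun y e (MvPolynomial.X k * h)) =
      MvPolynomial.eval y h • (comb A y).mulVec e := by
    intro h
    simp only [evalFun_apply, map_mul, MvPolynomial.eval_X, comb, Matrix.sum_mulVec,
      Matrix.mulVec_smul, Matrix.smul_mulVec, Finset.smul_sum, smul_smul, mul_comm]
  simp only [this]
  constructor
  · intro h
    simpa using h 1
  · intro h f
    rw [h, smul_zero]

theorem evalFun_mem_affine {y : Fin 3 → ℂ} {e : Fin m → ℂ} (he : (comb A y).mulVec e = 0)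
    (hz : MvPolynomial.eval y (g.form 2) = 1) : evalFun y e ∈ affineFunctionals A g := by
  rw [mem_affineFunctionals]
  exact ⟨evalFun_mem_ker_iff.2 he, fun h => by simp [hz]⟩

/-- The action of `x_k - y_k`. -/
def dev (y : Fin 3 → ℂ) (k : Fin 3) (E : Functional m) : Functional m :=
  act (MvPolynomial.X k - MvPolynomial.C (y k)) E

theorem apply_X_mul (y : Fin 3 → ℂ) (k : Fin 3) (E : Functional m) (h : Poly) :
    E (MvPolynomial.X k * h) = y k • E h + dev y k E h := by
  rw [dev, act_apply, sub_mul, map_sub, act_C_mul]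
  abel

/-- The coordinates generate the polynomial ring, so a joint eigenfunctional is determined by its
value at 1. -/
theorem eq_evalFun {y : Fin 3 → ℂ} {E : Functional m} (h : ∀ k, dev y k E = 0) :
    E = evalFun y (E 1) := by
  refine LinearMap.ext fun f => ?_
  induction f using MvPolynomial.induction_on with
  | C a =>
    have := act_C_mul E a 1
    rw [mul_one] at this
    simp [this]
  | add p q hp hq => rw [map_add, map_add, hp, hq]
  | mul_X p k hp =>
    rw [mul_comm, apply_X_mul y, h k, hp]
    simp [smul_smul]

/-- Each `dev y k E` is an evaluation by `eq_evalFun`, and the Leibniz rule drives the induction.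
Such an E is a first order jet at y with coefficients `E 1` and `dev y k E 1`. -/
theorem second_order_formula {y : Fin 3 → ℂ} {E : Functional m}
    (h : ∀ k l, dev y l (dev y k E) = 0) (f : Poly) :
    E f = MvPolynomial.eval y f • E 1 +
      ∑ k, MvPolynomial.eval y (MvPolynomial.pderiv k f) • dev y k E 1 := by
  have he := fun k => eq_evalFun (h k)
  induction f using MvPolynomial.induction_on with
  | C a =>
    have := act_C_mul E a 1
    rw [mul_one] at this
    simp [this]
  | add p q hp hq =>
    rw [map_add, hp, hq]
    simp only [map_add, add_smul, Finset.sum_add_distrib]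
    abel
  | mul_X p l hp =>
    rw [mul_comm, apply_X_mul y, hp, he l, evalFun_apply]
    simp only [Derivation.leibniz, smul_eq_mul, map_add, map_mul, MvPolynomial.eval_X,
      MvPolynomial.pderiv_X, add_smul, Finset.sum_add_distrib, Finset.smul_sum, smul_add, smul_smul]
    have h1 : ∑ k, (MvPolynomial.eval y p * MvPolynomial.eval y ((Pi.single k (1 : Poly) : Fin 3 → Poly) l)) •
        dev y k E 1 = MvPolynomial.eval y p • dev y l E 1 := by
      rw [Finset.sum_eq_single l]
      · simp
      · intro b _ hb
        rw [Pi.single_eq_of_ne hb.symm]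
        simp
      · simp
    rw [add_comm (∑ k, (y l * MvPolynomial.eval y (MvPolynomial.pderiv k p)) • dev y k E 1), h1]
    abel

/-- The functionals on the affine part killed by `P` and `Q`. -/
def commonKer (A : Fin 3 → Matrix (Fin m) (Fin m) ℂ) (g : Frame) (P Q : Poly) :
    Submodule ℂ (Functional m) where
  carrier := {E | E ∈ affineFunctionals A g ∧ act P E = 0 ∧ act Q E = 0}
  zero_mem' := ⟨Submodule.zero_mem _, rfl, rfl⟩
  add_mem' := by
    rintro E F ⟨hE, hE1, hE2⟩ ⟨hF, hF1, hF2⟩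
    refine ⟨Submodule.add_mem _ hE hF, ?_, ?_⟩
    · rw [act, LinearMap.add_comp]
      change act P E + act P F = 0
      rw [hE1, hF1, add_zero]
    · rw [act, LinearMap.add_comp]
      change act Q E + act Q F = 0
      rw [hE2, hF2, add_zero]
  smul_mem' := by
    rintro c E ⟨hE, hE1, hE2⟩
    refine ⟨Submodule.smul_mem _ c hE, ?_, ?_⟩
    · rw [act, LinearMap.smul_comp]
      change c • act P E = 0
      rw [hE1, smul_zero]
    · rw [act, LinearMap.smul_comp]
      change c • act Q E = 0
      rw [hE2, smul_zero]

theorem act_mem_commonKer {P Q : Poly} {E : Functional m} (hE : E ∈ commonKer A g P Q)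
    (f : Poly) : act f E ∈ commonKer A g P Q := by
  obtain ⟨h1, h2, h3⟩ := hE
  have hc : ∀ P : Poly, act P E = 0 → act P (act f E) = 0 := by
    intro P hP
    refine LinearMap.ext fun h => ?_
    have := DFunLike.congr_fun hP (f * h)
    simpa [mul_left_comm] using this
  exact ⟨act_mem_affine g h1 f, hc P h2, hc Q h3⟩

/-- The recurrence for P determines a functional by its first n terms. -/
theorem commonKer_finite (h0 : IsUnit (comb A (g.pt 0)).det) {n : ℕ} {P Q : Poly}
    (hP : P.IsHomogeneous n) (hH : IsUnit (leadMatrix A g P).det) :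
    FiniteDimensional ℂ (commonKer A g P Q) := by
  refine Module.Finite.of_injective (N := Fin n → Fin m → ℂ)
    ({ toFun := fun E j => seqOf g E.1 j
       map_add' := fun _ _ => rfl
       map_smul' := fun _ _ => rfl } : commonKer A g P Q →ₗ[ℂ] (Fin n → Fin m → ℂ)) ?_
  intro E E' hE
  refine Subtype.ext (sub_eq_zero.1 ?_)
  refine affine_eq_zero_of_act g h0 hP hH (Submodule.sub_mem _ E.2.1 E'.2.1)
    (Submodule.sub_mem _ E.2 E'.2).2.1 fun j hj => ?_
  exact sub_eq_zero.2 (congrFun hE ⟨j, hj⟩)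

/-- Multiplication by a coordinate on the common kernel. -/
def coordOp (A : Fin 3 → Matrix (Fin m) (Fin m) ℂ) (g : Frame) (P Q : Poly) (l : Fin 3) :
    Module.End ℂ (commonKer A g P Q) where
  toFun E := ⟨act (MvPolynomial.X l) E.1, act_mem_commonKer g E.2 _⟩
  map_add' _ _ := rfl
  map_smul' _ _ := rfl

theorem dev_comm (y : Fin 3 → ℂ) (k l : Fin 3) (E : Functional m) :
    dev y k (dev y l E) = dev y l (dev y k E) :=
  LinearMap.ext fun h => by simp only [dev, act_apply, mul_left_comm]

theorem dev_mem {y : Fin 3 → ℂ} {P Q : Poly} {E : Functional m} (hE : E ∈ commonKer A g P Q)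
    (k : Fin 3) : dev y k E ∈ commonKer A g P Q := act_mem_commonKer g hE _

theorem dev_iterate_comm (y : Fin 3 → ℂ) (k l : Fin 3) (a : ℕ) (E : Functional m) :
    (dev y k)^[a] (dev y l E) = dev y l ((dev y k)^[a] E) := by
  induction a generalizing E with
  | zero => rfl
  | succ a ih => rw [Function.iterate_succ_apply, Function.iterate_succ_apply, dev_comm, ih]

/-- If second order functionals at `y` are first order, then so are all functionals supported
at `y`. -/
theorem dev_eq_zero_of_iterate {y : Fin 3 → ℂ} {P Q : Poly}
    (hss : ∀ E ∈ commonKer A g P Q, (∀ k l, dev y l (dev y k E) = 0) → ∀ k, dev y k E = 0)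
    (d : ℕ) : ∀ (a : Fin 3 → ℕ), ∑ l, a l = d → ∀ E ∈ commonKer A g P Q,
      (∀ l, (dev y l)^[a l] E = 0) → ∀ k, dev y k E = 0 := by
  induction d with
  | zero =>
    intro a ha E _ h
    have h0 : a 0 = 0 := (Finset.sum_eq_zero_iff.1 ha) 0 (Finset.mem_univ _)
    have := h 0
    rw [h0] at this
    intro k
    rw [show E = 0 from this]
    rfl
  | succ d ih =>
    intro a ha E hE h
    by_cases hz : ∃ l, a l = 0
    · obtain ⟨l, hl⟩ := hz
      have := h l
      rw [hl] at this
      intro k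
      rw [show E = 0 from this]
      rfl
    · push Not at hz
      -- `dev y k E` satisfies the same conditions with the exponent of k lowered by one. By
      -- induction it is a joint eigenfunctional, which is the second order hypothesis on E.
      refine hss E hE fun k l => ?_
      refine ih (Function.update a k (a k - 1)) ?_ _ (dev_mem g hE k) (fun l => ?_) l
      · rw [Finset.sum_update_of_mem (Finset.mem_univ k)]
        rw [← Finset.sum_erase_add _ _ (Finset.mem_univ k)] at ha
        rw [Finset.sdiff_singleton_eq_erase]
        have := hz k
        omega
      · by_cases hl : l = k
        · subst hl
          rw [Function.update_self, ← Function.iterate_succ_apply,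
            Nat.succ_eq_add_one, Nat.sub_add_cancel (Nat.pos_of_ne_zero (hz l))]
          exact h l
        · rw [Function.update_of_ne hl, dev_iterate_comm, h l]
          rfl

/-- Joint generalized eigenvectors of the commuting coordinates span. The hypothesis makes each of
them a true eigenvector, hence an evaluation. -/
theorem mem_span_of_semisimple (h0 : IsUnit (comb A (g.pt 0)).det) {n : ℕ} {P Q : Poly}
    (hP : P.IsHomogeneous n) (hH : IsUnit (leadMatrix A g P).det)
    (hss : ∀ y, ∀ E ∈ commonKer A g P Q,
      (∀ k l, dev y l (dev y k E) = 0) → ∀ k, dev y k E = 0)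
    {E : Functional m} (hE : E ∈ commonKer A g P Q) :
    E ∈ Submodule.span ℂ {T | ∃ y e, T = evalFun y e ∧ T ∈ commonKer A g P Q} := by
  have hfin := commonKer_finite g (Q := Q) h0 hP hH
  have h1 := mem_span_joint_generalized (V := commonKer A g P Q) (coordOp A g P Q)
    (fun k l => LinearMap.ext fun E => Subtype.ext (LinearMap.ext fun h => congrArg E.1
      (mul_left_comm _ _ _))) ⟨E, hE⟩
  have h2 := Submodule.mem_map_of_mem (f := (commonKer A g P Q).subtype) h1
  rw [Submodule.map_span] at h2
  refine Submodule.span_mono ?_ h2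
  rintro _ ⟨T, ⟨y, hy⟩, rfl⟩
  choose a ha using hy
  have h3 : ∀ l (a : ℕ) (S : commonKer A g P Q),
      ((fun w => coordOp A g P Q l w - y l • w)^[a] S).1 = (dev y l)^[a] S.1 := by
    intro l a
    induction a with
    | zero => intro S; rfl
    | succ a ih =>
      intro S
      rw [Function.iterate_succ_apply, Function.iterate_succ_apply, ih]
      congr 1
      refine LinearMap.ext fun h => ?_
      rw [dev, act_apply, sub_mul, map_sub, act_C_mul]
      rfl
  have h4 := eq_evalFun (dev_eq_zero_of_iterate g (hss y) _ a rfl T.1 T.2 fun l => by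
    rw [← h3, ha l]
    rfl)
  exact ⟨y, _, h4, T.2⟩

theorem evalFun_mem_commonKer {P Q : Poly} {y : Fin 3 → ℂ} {e : Fin m → ℂ} (he : e ≠ 0)
    (h : evalFun y e ∈ commonKer A g P Q) :
    (comb A y).mulVec e = 0 ∧ MvPolynomial.eval y (g.form 2) = 1 ∧
      MvPolynomial.eval y P = 0 ∧ MvPolynomial.eval y Q = 0 := by
  obtain ⟨h1, h2, h3⟩ := h
  rw [mem_affineFunctionals] at h1
  refine ⟨evalFun_mem_ker_iff.1 h1.1, ?_, ?_, ?_⟩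
  · have := h1.2 1
    simp only [evalFun_apply, mul_one, map_one, one_smul] at this
    have h4 : (MvPolynomial.eval y (g.form 2) - 1) • e = 0 := by
      rw [sub_smul, one_smul, this, sub_self]
    exact sub_eq_zero.1 ((smul_eq_zero.1 h4).resolve_right he)
  · have := DFunLike.congr_fun h2 1
    simp only [act_apply, evalFun_apply, mul_one, LinearMap.zero_apply] at this
    exact (smul_eq_zero.1 this).resolve_right he
  · have := DFunLike.congr_fun h3 1
    simp only [act_apply, evalFun_apply, mul_one, LinearMap.zero_apply] at this
    exact (smul_eq_zero.1 this).resolve_right he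

/-- If the common zeros of `P` and `Q` on the curve carry no tangent functionals, then the
functionals killed by `P` and `Q` are spanned by evaluations. -/
theorem mem_span_evalFun (h0 : IsUnit (comb A (g.pt 0)).det) {n : ℕ} {P Q : Poly}
    (hP : P.IsHomogeneous n) (hH : IsUnit (leadMatrix A g P).det)
    (htf : ∀ (y : Fin 3 → ℂ) (ε : Fin m → ℂ) (e : Fin 3 → Fin m → ℂ),
      MvPolynomial.eval y (g.form 2) = 1 → MvPolynomial.eval y P = 0 →
      MvPolynomial.eval y Q = 0 →
      (comb A y).mulVec ε + ∑ k, (A k).mulVec (e k) = 0 →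
      (∀ k, (comb A y).mulVec (e k) = 0) →
      ∑ k, g.inv 2 k • e k = 0 →
      ∑ k, MvPolynomial.eval y (MvPolynomial.pderiv k P) • e k = 0 →
      ∑ k, MvPolynomial.eval y (MvPolynomial.pderiv k Q) • e k = 0 → ∀ k, e k = 0)
    {E : Functional m} (hE : E ∈ commonKer A g P Q) :
    E ∈ Submodule.span ℂ {T | ∃ y e, T = evalFun y e ∧ T ∈ commonKer A g P Q} := by
  refine mem_span_of_semisimple g h0 hP hH ?_ hE
  intro y E hE hdd
  have he := fun k => eq_evalFun (hdd k)
  by_contra! hne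
  obtain ⟨l, hl⟩ := hne
  have hl1 : dev y l E 1 ≠ 0 := by
    intro h
    apply hl
    rw [he l, h]
    refine LinearMap.ext fun f => by simp
  have hmem := fun k => dev_mem g (y := y) hE k
  have hml := hmem l
  rw [he l] at hml
  obtain ⟨-, hz, hPy, hQy⟩ := evalFun_mem_commonKer g hl1 hml
  have hform := second_order_formula hdd
  -- The five conditions on the jet are, in order, the pencil relation for E, the pencil relation
  -- for each `dev y k E`, zE = E, PE = 0 and QE = 0.
  refine hl1 (htf y (E 1) (fun k => dev y k E 1) hz hPy hQy ?_ ?_ ?_ ?_ ?_ l)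
  · have h1 := hE.1.1 1
    simp only [apply_X_mul y, Matrix.mulVec_add, Finset.sum_add_distrib] at h1
    rw [← h1, comb, Matrix.sum_mulVec]
    simp only [Matrix.smul_mulVec, Matrix.mulVec_smul]
  · intro k
    have h1 := (hmem k).1.1
    rw [he k, evalFun_mem_ker_iff] at h1
    exact h1
  · have h1 := ((mem_affineFunctionals g).1 hE.1).2 1
    rw [mul_one, hform, hz, one_smul, add_eq_left] at h1
    rw [← h1]
    refine Finset.sum_congr rfl fun k _ => ?_
    congr 1
    simp only [Frame.form, map_sum, Derivation.leibniz, MvPolynomial.pderiv_C,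
      MvPolynomial.pderiv_X, smul_eq_mul, mul_zero, add_zero, map_mul, MvPolynomial.eval_C]
    rw [Finset.sum_eq_single k]
    · simp
    · intro b _ hb
      rw [Pi.single_eq_of_ne hb]
      simp
    · simp
  · have h1 := DFunLike.congr_fun hE.2.1 1
    rw [act_apply, mul_one, hform, hPy, zero_smul, zero_add] at h1
    exact h1
  · have h1 := DFunLike.congr_fun hE.2.2 1
    rw [act_apply, mul_one, hform, hQy, zero_smul, zero_add] at h1
    exact h1

end

end CurveElim
end

noncomputable section
namespace CurveElim

/-! ### Determinants of linear pencils at a singular matrix -/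

section

variable {ι : Type*} [Fintype ι] [DecidableEq ι]

/-- R is a basis of the kernel and L a left inverse, so R L is a projection onto the kernel. The
factorization through size dim ker is what makes the determinant in `detLine_factor` computable. -/
theorem exists_kernel_projection (M : Matrix ι ι ℂ) :
    ∃ (R : Matrix ι (Fin (Module.finrank ℂ (LinearMap.ker M.mulVecLin))) ℂ)
      (L : Matrix (Fin (Module.finrank ℂ (LinearMap.ker M.mulVecLin))) ι ℂ),
      L * R = 1 ∧ M * R = 0 ∧ ∀ x, M.mulVec x = 0 → (R * L).mulVec x = x := by
  set d := Module.finrank ℂ (LinearMap.ker M.mulVecLin)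
  let b := Module.finBasis ℂ (LinearMap.ker M.mulVecLin)
  let f : (Fin d → ℂ) →ₗ[ℂ] (ι → ℂ) :=
    (LinearMap.ker M.mulVecLin).subtype ∘ₗ b.equivFun.symm.toLinearMap
  have hf : Function.Injective f :=
    Subtype.val_injective.comp b.equivFun.symm.injective
  obtain ⟨l, hl⟩ := LinearMap.exists_leftInverse_of_injective f (LinearMap.ker_eq_bot.2 hf)
  have hLR : LinearMap.toMatrix' l * LinearMap.toMatrix' f = 1 := by
    rw [← LinearMap.toMatrix'_comp, hl, LinearMap.toMatrix'_id]
  refine ⟨LinearMap.toMatrix' f, LinearMap.toMatrix' l, hLR, ?_, ?_⟩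
  · have h1 : M.mulVecLin ∘ₗ f = 0 := LinearMap.ext fun x => (b.equivFun.symm x).2
    have h2 := congrArg LinearMap.toMatrix' h1
    rwa [LinearMap.toMatrix'_comp, ← Matrix.toLin'_apply', LinearMap.toMatrix'_toLin',
      map_zero] at h2
  · intro x hx
    have hx' : f (b.equivFun ⟨x, hx⟩) = x := by simp [f]
    rw [← hx', ← LinearMap.toMatrix'_mulVec f, Matrix.mulVec_mulVec, Matrix.mul_assoc, hLR,
      Matrix.mul_one]

/-- The determinant of `M + X N` as a polynomial. -/
def detLine (M N : Matrix ι ι ℂ) : Polynomial ℂ :=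
  (M.map Polynomial.C + (Polynomial.X : Polynomial ℂ) • N.map Polynomial.C).det

theorem eval_detLine (M N : Matrix ι ι ℂ) (t : ℂ) :
    (detLine M N).eval t = (M + t • N).det := by
  rw [detLine, ← Polynomial.coe_evalRingHom, RingHom.map_det]
  congr 1
  ext i j
  simp
  ring

/-- Each dimension of the kernel contributes a factor X. The cofactor at 0 is det(M + N K), K being
the projection onto the kernel, and it vanishes exactly when N sends a nonzero kernel vector into
the range of M. -/
theorem detLine_factor (M N : Matrix ι ι ℂ) :
    ∃ q : Polynomial ℂ,
      detLine M N = Polynomial.X ^ Module.finrank ℂ (LinearMap.ker M.mulVecLin) * q ∧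
      (q.eval 0 = 0 ↔ ∃ x e : ι → ℂ, e ≠ 0 ∧ M.mulVec e = 0 ∧ M.mulVec x + N.mulVec e = 0) := by
  obtain ⟨R, L, hLR, hMR, hfix⟩ := exists_kernel_projection M
  generalize Module.finrank ℂ (LinearMap.ker M.mulVecLin) = d at *
  have hMP : M * (R * L) = 0 := by rw [← Matrix.mul_assoc, hMR, Matrix.zero_mul]
  have hPP : R * L * (R * L) = R * L := by
    rw [Matrix.mul_assoc, ← Matrix.mul_assoc L, hLR, Matrix.one_mul]
  have hfix' := hfix
  set K := R * L with hK
  -- On the kernel only X N is left. The second factor, which is X on the kernel and 1 on the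
  -- complement given by K, collects these powers of X.
  have hprod : M.map Polynomial.C + (Polynomial.X : Polynomial ℂ) • N.map Polynomial.C =
      ((M + N * K).map Polynomial.C + (Polynomial.X : Polynomial ℂ) •
        (N - N * K).map Polynomial.C) *
      (1 + ((Polynomial.X : Polynomial ℂ) - 1) • K.map Polynomial.C) := by
    have e1 : M.map Polynomial.C * K.map Polynomial.C = 0 := by
      rw [← Matrix.map_mul, hMP, Matrix.map_zero _ (by simp)]
    have e2 : K.map Polynomial.C * K.map Polynomial.C = K.map Polynomial.C := by
      rw [← Matrix.map_mul, hPP]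
    have e3 : (M + N * K).map Polynomial.C =
        M.map Polynomial.C + N.map Polynomial.C * K.map Polynomial.C := by
      rw [Matrix.map_add _ (by simp), Matrix.map_mul]
    have e4 : (N - N * K).map Polynomial.C =
        N.map Polynomial.C - N.map Polynomial.C * K.map Polynomial.C := by
      rw [Matrix.map_sub _ (by simp), Matrix.map_mul]
    rw [e3, e4]
    simp only [mul_add, add_mul, mul_one, mul_sub, Matrix.mul_sub, Matrix.mul_smul, Matrix.smul_mul, sub_mul, e1,
      Matrix.mul_assoc, e2, sub_self, smul_zero, zero_add, add_zero, sub_smul, one_smul, smul_sub]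
    abel
  -- With K = R L, the identity det(1 + UV) = det(1 + VU) moves this to size dim ker, where the
  -- matrix is X times the identity.
  have hdet : (1 + ((Polynomial.X : Polynomial ℂ) - 1) • K.map Polynomial.C).det =
      Polynomial.X ^ d := by
    have e1 : ((Polynomial.X : Polynomial ℂ) - 1) • K.map Polynomial.C =
        R.map Polynomial.C * (((Polynomial.X : Polynomial ℂ) - 1) • L.map Polynomial.C) := by
      rw [hK, Matrix.map_mul, Matrix.mul_smul]
    rw [e1, Matrix.det_one_add_mul_comm, Matrix.smul_mul, ← Matrix.map_mul, hLR,
      Matrix.map_one _ (by simp) (by simp)]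
    have e2 : (1 : Matrix (Fin d) (Fin d) (Polynomial ℂ)) +
        ((Polynomial.X : Polynomial ℂ) - 1) • 1 = (Polynomial.X : Polynomial ℂ) • 1 := by
      rw [sub_smul, one_smul]
      abel
    rw [e2, Matrix.det_smul, Matrix.det_one, mul_one, Fintype.card_fin]
  refine ⟨detLine (M + N * K) (N - N * K), ?_, ?_⟩
  · rw [detLine, hprod, Matrix.det_mul, hdet, mul_comm, detLine]
  · rw [eval_detLine, zero_smul, add_zero, ← Matrix.exists_mulVec_eq_zero_iff]
    constructor
    · rintro ⟨x, hx, h⟩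
      rw [Matrix.add_mulVec, ← Matrix.mulVec_mulVec] at h
      refine ⟨x, K.mulVec x, fun h0 => hx ?_, ?_, h⟩
      · rw [h0, Matrix.mulVec_zero, add_zero] at h
        rw [← hfix x h, h0]
      · rw [Matrix.mulVec_mulVec, hMP, Matrix.zero_mulVec]
    · rintro ⟨x, e, he, hMe, h⟩
      refine ⟨x - K.mulVec x + e, fun h0 => he ?_, ?_⟩
      · have h1 := congrArg K.mulVec h0
        rw [Matrix.mulVec_add, Matrix.mulVec_sub, Matrix.mulVec_mulVec, hPP, sub_self, zero_add,
          Matrix.mulVec_zero, hfix e hMe] at h1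
        exact h1
      · have h1 : M.mulVec (K.mulVec x) = 0 := by
          rw [Matrix.mulVec_mulVec, hMP, Matrix.zero_mulVec]
        have h2 : K.mulVec (x - K.mulVec x + e) = e := by
          rw [Matrix.mulVec_add, Matrix.mulVec_sub, Matrix.mulVec_mulVec, hPP, sub_self,
            zero_add, hfix e hMe]
        have h3 : (N * K).mulVec (x - K.mulVec x + e) = N.mulVec e := by
          rw [← h2, Matrix.mulVec_mulVec, h2]
        rw [Matrix.add_mulVec, h3, Matrix.mulVec_add, Matrix.mulVec_sub, h1, hMe, sub_zero,
          add_zero, h]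

/-- The pencil `M + X N` is degenerate to higher order than the kernel of `M` requires. -/
def IsTangent (M N : Matrix ι ι ℂ) : Prop :=
  ∃ x e : ι → ℂ, e ≠ 0 ∧ M.mulVec e = 0 ∧ M.mulVec x + N.mulVec e = 0

theorem pow_dvd_detLine (M N : Matrix ι ι ℂ) :
    Polynomial.X ^ Module.finrank ℂ (LinearMap.ker M.mulVecLin) ∣ detLine M N := by
  obtain ⟨q, hq, -⟩ := detLine_factor M N
  exact ⟨q, hq⟩

theorem isTangent_iff_coeff (M N : Matrix ι ι ℂ) : IsTangent M N ↔
    (detLine M N).coeff (Module.finrank ℂ (LinearMap.ker M.mulVecLin)) = 0 := by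
  obtain ⟨q, hq, h⟩ := detLine_factor M N
  rw [IsTangent, ← h, hq, Polynomial.coeff_X_pow_mul', if_pos le_rfl, Nat.sub_self,
    Polynomial.coeff_zero_eq_eval_zero]

end

/-! ### Restriction of polynomials to lines -/

/-- The restriction of `G` to the generic line through `y`. -/
def lineGen (y : Fin 3 → ℂ) (G : Poly) : Polynomial Poly :=
  MvPolynomial.aeval (fun l => Polynomial.C (MvPolynomial.C (y l)) +
    Polynomial.C (MvPolynomial.X l) * Polynomial.X) G

theorem lineGen_map (y v : Fin 3 → ℂ) (G : Poly) :
    (lineGen y G).map (MvPolynomial.eval v) = alongLine G y v := by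
  induction G using MvPolynomial.induction_on with
  | C a =>
    rw [lineGen, alongLine, MvPolynomial.algHom_C, MvPolynomial.algHom_C]
    change (Polynomial.C (MvPolynomial.C a)).map _ = Polynomial.C a
    rw [Polynomial.map_C, MvPolynomial.eval_C]
  | add p q hp hq =>
    rw [lineGen, map_add, Polynomial.map_add, alongLine_add, ← hp, ← hq]
    rfl
  | mul_X p l hp =>
    rw [lineGen, map_mul, Polynomial.map_mul, alongLine_mul, ← hp, lineGen, alongLine,
      MvPolynomial.aeval_X, MvPolynomial.aeval_X]
    simp

theorem coeff_alongLine (y v : Fin 3 → ℂ) (G : Poly) (i : ℕ) :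
    (alongLine G y v).coeff i = MvPolynomial.eval v ((lineGen y G).coeff i) := by
  rw [← lineGen_map, Polynomial.coeff_map]

theorem lineGen_coeff_isHomogeneous (y : Fin 3 → ℂ) (G : Poly) (i : ℕ) :
    ((lineGen y G).coeff i).IsHomogeneous i := by
  induction G using MvPolynomial.induction_on generalizing i with
  | C a =>
    rw [lineGen, MvPolynomial.algHom_C]
    change ((Polynomial.C (MvPolynomial.C a)).coeff i).IsHomogeneous i
    rw [Polynomial.coeff_C]
    split_ifs with h
    · rw [h]
      exact MvPolynomial.isHomogeneous_C _ _
    · exact MvPolynomial.isHomogeneous_zero _ _ _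
  | add p q hp hq =>
    rw [lineGen, map_add, Polynomial.coeff_add]
    exact (hp i).add (hq i)
  | mul_X p l hp =>
    have : lineGen y (p * MvPolynomial.X l) = lineGen y p * Polynomial.C (MvPolynomial.C (y l)) +
        lineGen y p * Polynomial.C (MvPolynomial.X l) * Polynomial.X := by
      rw [lineGen, map_mul, MvPolynomial.aeval_X, mul_add, mul_assoc]
      rfl
    rw [this, Polynomial.coeff_add, Polynomial.coeff_mul_C]
    refine MvPolynomial.IsHomogeneous.add ?_ ?_
    · have := (hp i).mul (MvPolynomial.isHomogeneous_C (Fin 3) (y l))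
      simpa using this
    · cases i with
      | zero =>
        rw [Polynomial.coeff_mul_X_zero]
        exact MvPolynomial.isHomogeneous_zero _ _ _
      | succ i =>
        rw [Polynomial.coeff_mul_X, Polynomial.coeff_mul_C]
        exact (hp i).mul (MvPolynomial.isHomogeneous_X _ _)

theorem eval_alongLine (G : Poly) (y v : Fin 3 → ℂ) (t : ℂ) :
    (alongLine G y v).eval t = MvPolynomial.eval (y + t • v) G := by
  induction G using MvPolynomial.induction_on with
  | C a =>
    rw [alongLine, MvPolynomial.algHom_C]
    simp
  | add p q hp hq => rw [alongLine_add, Polynomial.eval_add, hp, hq, map_add]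
  | mul_X p l hp =>
    rw [alongLine_mul, Polynomial.eval_mul, hp, map_mul, alongLine, MvPolynomial.aeval_X]
    rw [Polynomial.eval_add, Polynomial.eval_mul, Polynomial.eval_C, Polynomial.eval_C,
      Polynomial.eval_X, MvPolynomial.eval_X, Pi.add_apply, Pi.smul_apply, smul_eq_mul,
      mul_comm t]

theorem alongLine_X (l : Fin 3) (y v : Fin 3 → ℂ) : alongLine (MvPolynomial.X l) y v =
    Polynomial.C (y l) + Polynomial.C (v l) * Polynomial.X := MvPolynomial.aeval_X _ _

theorem alongLine_C (a : ℂ) (y v : Fin 3 → ℂ) :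
    alongLine (MvPolynomial.C a) y v = Polynomial.C a := MvPolynomial.algHom_C _ _

theorem alongLine_top {G : Poly} {d : ℕ} (hG : G.IsHomogeneous d) (y v : Fin 3 → ℂ) :
    (alongLine G y v).natDegree ≤ d ∧ (alongLine G y v).coeff d = MvPolynomial.eval v G := by
  refine hom_induction (p := fun d G => (alongLine G y v).natDegree ≤ d ∧
    (alongLine G y v).coeff d = MvPolynomial.eval v G) ?_ ?_ ?_ ?_ hG
  · intro n
    simp [alongLine]
  · rintro n f f' ⟨h1, h2⟩ ⟨h3, h4⟩
    rw [alongLine_add]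
    refine ⟨Polynomial.natDegree_add_le_of_degree_le h1 h3, ?_⟩
    rw [Polynomial.coeff_add, h2, h4, map_add]
  · intro c
    rw [alongLine_C]
    simp
  · rintro n k f ⟨h1, h2⟩
    have h3 : (alongLine (MvPolynomial.X k) y v).natDegree ≤ 1 := by
      rw [alongLine_X]
      compute_degree
    have h4 : (alongLine (MvPolynomial.X k) y v).coeff 1 = v k := by
      rw [alongLine_X]
      simp
    rw [mul_comm, alongLine_mul]
    refine ⟨Polynomial.natDegree_mul_le_of_le h1 h3, ?_⟩
    rw [Polynomial.coeff_mul_add_eq_of_natDegree_le h1 h3, h2, h4, map_mul, MvPolynomial.eval_X]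

theorem alongLine_coeff_zero (G : Poly) (y v : Fin 3 → ℂ) :
    (alongLine G y v).coeff 0 = MvPolynomial.eval y G := by
  rw [Polynomial.coeff_zero_eq_eval_zero, eval_alongLine]
  simp

/-- The directional derivative. -/
def dirDeriv (G : Poly) (y v : Fin 3 → ℂ) : ℂ :=
  ∑ l, MvPolynomial.eval y (MvPolynomial.pderiv l G) * v l

theorem dirDeriv_C (a : ℂ) (y v : Fin 3 → ℂ) : dirDeriv (MvPolynomial.C a) y v = 0 := by
  simp [dirDeriv]

theorem dirDeriv_X (k : Fin 3) (y v : Fin 3 → ℂ) : dirDeriv (MvPolynomial.X k) y v = v k := by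
  simp only [dirDeriv, MvPolynomial.pderiv_X]
  rw [Finset.sum_eq_single k]
  · simp
  · intro b _ hb
    rw [Pi.single_eq_of_ne hb.symm]
    simp
  · simp

theorem dirDeriv_add (G H : Poly) (y v : Fin 3 → ℂ) :
    dirDeriv (G + H) y v = dirDeriv G y v + dirDeriv H y v := by
  simp [dirDeriv, add_mul, Finset.sum_add_distrib]

theorem dirDeriv_mul (G H : Poly) (y v : Fin 3 → ℂ) :
    dirDeriv (G * H) y v = dirDeriv G y v * MvPolynomial.eval y H +
      MvPolynomial.eval y G * dirDeriv H y v := by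
  simp only [dirDeriv, Derivation.leibniz, smul_eq_mul, map_add, map_mul, add_mul,
    Finset.sum_add_distrib, Finset.sum_mul, Finset.mul_sum]
  rw [add_comm]
  congr 1 <;> exact Finset.sum_congr rfl fun l _ => by ring

theorem dirDeriv_add_dir (G : Poly) (y v w : Fin 3 → ℂ) :
    dirDeriv G y (v + w) = dirDeriv G y v + dirDeriv G y w := by
  simp [dirDeriv, mul_add, Finset.sum_add_distrib]

theorem dirDeriv_smul_dir (G : Poly) (y v : Fin 3 → ℂ) (c : ℂ) :
    dirDeriv G y (c • v) = c * dirDeriv G y v := by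
  simp only [dirDeriv, Finset.mul_sum, Pi.smul_apply, smul_eq_mul]
  exact Finset.sum_congr rfl fun l _ => by ring

theorem alongLine_coeff_one (G : Poly) (y v : Fin 3 → ℂ) :
    (alongLine G y v).coeff 1 = dirDeriv G y v := by
  induction G using MvPolynomial.induction_on with
  | C a =>
    rw [alongLine_C, dirDeriv_C]
    simp
  | add p q hp hq => rw [alongLine_add, Polynomial.coeff_add, hp, hq, dirDeriv_add]
  | mul_X p l hp =>
    rw [alongLine_mul, Polynomial.coeff_mul, Finset.Nat.antidiagonal_succ]
    simp only [Finset.Nat.antidiagonal_zero, Finset.map_singleton, Finset.sum_cons,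
      Finset.sum_singleton, Function.Embedding.prodMap, Function.Embedding.coeFn_mk, Prod.map]
    rw [dirDeriv_mul, dirDeriv_X, ← hp]
    simp [alongLine_coeff_zero, alongLine_X]
    ring

theorem dirDeriv_self {G : Poly} {n : ℕ} (hG : G.IsHomogeneous n) (y : Fin 3 → ℂ) :
    dirDeriv G y y = n * MvPolynomial.eval y G := by
  have := congrArg (MvPolynomial.eval y) hG.sum_X_mul_pderiv
  simp only [map_sum, map_mul, MvPolynomial.eval_X, nsmul_eq_mul, map_natCast] at this
  rw [← this, dirDeriv]
  exact Finset.sum_congr rfl fun l _ => mul_comm _ _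

theorem aeval_smul_of_hom {R : Type*} [CommRing R] [Algebra ℂ R] {G : Poly} {d : ℕ}
    (hG : G.IsHomogeneous d) (c : R) (q : Fin 3 → R) :
    MvPolynomial.aeval (fun k => c * q k) G = c ^ d * MvPolynomial.aeval q G := by
  refine hom_induction (p := fun d G => MvPolynomial.aeval (fun k => c * q k) G =
    c ^ d * MvPolynomial.aeval q G) ?_ ?_ ?_ ?_ hG
  · intro n
    simp
  · intro n f f' h1 h2
    rw [map_add, map_add, h1, h2, mul_add]
  · intro a
    rw [MvPolynomial.algHom_C, MvPolynomial.algHom_C, pow_zero, one_mul]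
  · intro n k f h
    rw [map_mul, map_mul, h, MvPolynomial.aeval_X, MvPolynomial.aeval_X, pow_succ]
    ring

theorem eval_smul_of_hom {G : Poly} {d : ℕ} (hG : G.IsHomogeneous d) (c : ℂ) (x : Fin 3 → ℂ) :
    MvPolynomial.eval (c • x) G = c ^ d * MvPolynomial.eval x G := by
  have := aeval_smul_of_hom hG c x
  rwa [MvPolynomial.aeval_eq_eval, MvPolynomial.aeval_eq_eval] at this

theorem alongLine_comp (p : Fin 3 → Poly) (G : Poly) (y v : Fin 3 → ℂ) :
    alongLine (MvPolynomial.aeval p G) y v =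
      MvPolynomial.aeval (fun k => alongLine (p k) y v) G := by
  rw [alongLine, MvPolynomial.comp_aeval_apply]
  rfl

/-- At a common zero `y` of the forms `p`, the leading part of `G ∘ p` at `y`. -/
theorem alongLine_comp_of_zero {p : Fin 3 → Poly} {G : Poly} {e : ℕ} (hG : G.IsHomogeneous e)
    {y : Fin 3 → ℂ} (hy : ∀ k, MvPolynomial.eval y (p k) = 0) (v : Fin 3 → ℂ) :
    (∀ i < e, (alongLine (MvPolynomial.aeval p G) y v).coeff i = 0) ∧
      (alongLine (MvPolynomial.aeval p G) y v).coeff e =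
        MvPolynomial.eval (fun k => dirDeriv (p k) y v) G := by
  have h1 : ∀ k, ∃ q : Polynomial ℂ, alongLine (p k) y v = Polynomial.X * q ∧
      q.eval 0 = dirDeriv (p k) y v := by
    intro k
    have h0 : (alongLine (p k) y v).coeff 0 = 0 := by rw [alongLine_coeff_zero, hy]
    obtain ⟨q, hq⟩ := Polynomial.X_dvd_iff.2 h0
    refine ⟨q, hq, ?_⟩
    rw [← alongLine_coeff_one, hq, Polynomial.coeff_X_mul, Polynomial.coeff_zero_eq_eval_zero]
  choose q hq hq0 using h1
  -- All p k vanish at y, so p = t q along the line, with q(0) the differential of p at v.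
  -- Homogeneity of G extracts t^e.
  have h2 : alongLine (MvPolynomial.aeval p G) y v =
      Polynomial.X ^ e * MvPolynomial.aeval q G := by
    rw [alongLine_comp, ← aeval_smul_of_hom hG]
    congr 2
    funext k
    exact hq k
  rw [h2]
  refine ⟨fun i hi => ?_, ?_⟩
  · rw [Polynomial.coeff_X_pow_mul', if_neg (by omega)]
  · rw [Polynomial.coeff_X_pow_mul', if_pos le_rfl, Nat.sub_self,
      Polynomial.coeff_zero_eq_eval_zero, ← Polynomial.coe_aeval_eq_eval,
      MvPolynomial.comp_aeval_apply, MvPolynomial.aeval_eq_eval]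
    congr 2
    funext k
    rw [← hq0]
    simp [Polynomial.coe_aeval_eq_eval]

/-- Images of tangent directions at a common zero of `p` satisfy every equation of the image. -/
theorem eval_dirDeriv_eq_zero {p : Fin 3 → Poly} {G Δ : Poly} {e d : ℕ} (hG : G.IsHomogeneous e)
    {y : Fin 3 → ℂ} (hy : ∀ k, MvPolynomial.eval y (p k) = 0)
    (hdvd : Δ ∣ MvPolynomial.aeval p G)
    (hd : ∀ v, ∀ i < d, (alongLine Δ y v).coeff i = 0)
    (hd' : ∃ v, (alongLine Δ y v).coeff d ≠ 0)
    {v : Fin 3 → ℂ} (hv : (alongLine Δ y v).coeff d = 0) :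
    MvPolynomial.eval (fun k => dirDeriv (p k) y v) G = 0 := by
  by_contra hne
  obtain ⟨H, hH⟩ := hdvd
  have hmul : lineGen y (MvPolynomial.aeval p G) = lineGen y Δ * lineGen y H := by
    rw [hH, lineGen, map_mul]
    rfl
  have h1 : ∀ i < e, (lineGen y (MvPolynomial.aeval p G)).coeff i = 0 := by
    intro i hi
    refine MvPolynomial.funext fun w => ?_
    rw [← coeff_alongLine, (alongLine_comp_of_zero hG hy w).1 i hi, map_zero]
  have h2 : (lineGen y (MvPolynomial.aeval p G)).coeff e ≠ 0 := by
    intro h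
    apply hne
    rw [← (alongLine_comp_of_zero hG hy v).2, coeff_alongLine, h, map_zero]
  have h3 : ∀ i < d, (lineGen y Δ).coeff i = 0 := by
    intro i hi
    refine MvPolynomial.funext fun w => ?_
    rw [← coeff_alongLine, hd w i hi, map_zero]
  have h4 : (lineGen y Δ).coeff d ≠ 0 := by
    obtain ⟨w, hw⟩ := hd'
    intro h
    apply hw
    rw [coeff_alongLine, h, map_zero]
  -- Along the generic line lowest coefficients multiply, the coefficient ring being a domain. If
  -- the claim failed, the lowest coefficient of G ∘ p would be nonzero at v, although its factor
  -- from Δ vanishes there.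
  have key : ∀ {f : Polynomial Poly} {k : ℕ}, (∀ i < k, f.coeff i = 0) → f.coeff k ≠ 0 →
      f.natTrailingDegree = k := by
    intro f k hlt hk
    refine le_antisymm (Polynomial.natTrailingDegree_le_of_ne_zero hk) ?_
    refine Polynomial.le_natTrailingDegree (fun h => hk (by rw [h, Polynomial.coeff_zero])) hlt
  have t1 := key h1 h2
  have t2 := key h3 h4
  have hc := congrArg Polynomial.trailingCoeff hmul
  rw [Polynomial.trailingCoeff_mul, Polynomial.trailingCoeff, t1, Polynomial.trailingCoeff, t2] at hc
  apply hne
  rw [← (alongLine_comp_of_zero hG hy v).2, coeff_alongLine, hc, map_mul, ← coeff_alongLine, hv,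
    zero_mul]

end CurveElim
end

noncomputable section
namespace CurveElim

/-! ### The determinant of a net of matrices -/

section

variable {m : ℕ} (A : Fin 3 → Matrix (Fin m) (Fin m) ℂ)

theorem comb_add (x y : Fin 3 → ℂ) : comb A (x + y) = comb A x + comb A y := by
  simp [comb, add_smul, Finset.sum_add_distrib]

theorem comb_smul (c : ℂ) (x : Fin 3 → ℂ) : comb A (c • x) = c • comb A x := by
  simp [comb, mul_smul, Finset.smul_sum]

/-- The determinant of the generic member of a net of matrices. -/
def netDet : Poly := (∑ k, (MvPolynomial.X k : Poly) • (A k).map MvPolynomial.C).det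

theorem eval_netDet (x : Fin 3 → ℂ) : MvPolynomial.eval x (netDet A) = (comb A x).det := by
  rw [netDet, RingHom.map_det]
  congr 1
  ext i j
  simp [comb, Matrix.sum_apply]

theorem alongLine_netDet (y v : Fin 3 → ℂ) :
    alongLine (netDet A) y v = detLine (comb A y) (comb A v) := by
  rw [netDet, alongLine, AlgHom.map_det, detLine]
  congr 1
  ext1 i j
  simp only [comb, Matrix.sum_apply, Matrix.smul_apply, AlgHom.mapMatrix_apply, Matrix.map_apply,
    smul_eq_mul, map_sum, map_mul, MvPolynomial.aeval_X, MvPolynomial.algHom_C, Matrix.add_apply,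
    Finset.mul_sum, ← Finset.sum_add_distrib]
  refine Finset.sum_congr rfl fun k _ => ?_
  change _ * Polynomial.C _ = _
  ring

theorem netDet_isHomogeneous : (netDet A).IsHomogeneous m := by
  rw [netDet, Matrix.det_apply]
  refine MvPolynomial.IsHomogeneous.sum _ _ _ fun σ _ => ?_
  have h : (∏ i, (∑ k, (MvPolynomial.X k : Poly) •
      ((A k).map MvPolynomial.C : Matrix (Fin m) (Fin m) Poly)) (σ i) i).IsHomogeneous
      (∑ _i : Fin m, 1) := by
    refine MvPolynomial.IsHomogeneous.prod _ _ _ fun i _ => ?_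
    rw [Matrix.sum_apply]
    refine MvPolynomial.IsHomogeneous.sum _ _ _ fun k _ => ?_
    exact (MvPolynomial.isHomogeneous_X ℂ k).mul (MvPolynomial.isHomogeneous_C _ _)
  rw [Finset.sum_const, Finset.card_univ, Fintype.card_fin, smul_eq_mul, mul_one] at h
  rcases Int.units_eq_one_or (Equiv.Perm.sign σ) with hs | hs
  · rw [hs, one_smul]; exact h
  · rw [hs, Units.neg_smul, one_smul]; exact h.neg

end

/-! ### Tangent directions -/

section

variable {m : ℕ} {A : Fin 3 → Matrix (Fin m) (Fin m) ℂ} {y : Fin 3 → ℂ}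

/-- The equation of the tangent cone of `netDet A` at `y`. -/
def tangentCone (A : Fin 3 → Matrix (Fin m) (Fin m) ℂ) (y : Fin 3 → ℂ) : Poly :=
  (lineGen y (netDet A)).coeff (Module.finrank ℂ (LinearMap.ker (comb A y).mulVecLin))

/-- By `detLine_factor` tangency is governed by a form of degree dim ker in the direction. If this
form is zero, every direction is tangent, so a single non-tangent direction certifies that dim ker
is the multiplicity of the curve at y. -/
theorem isTangent_iff_eval_tangentCone (v : Fin 3 → ℂ) :
    IsTangent (comb A y) (comb A v) ↔ MvPolynomial.eval v (tangentCone A y) = 0 := by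
  rw [isTangent_iff_coeff, ← alongLine_netDet, coeff_alongLine, tangentCone]

theorem isTangent_self (hker : ∃ e, e ≠ 0 ∧ (comb A y).mulVec e = 0) (c : ℂ) :
    IsTangent (comb A y) (comb A (c • y)) := by
  obtain ⟨e, he, h⟩ := hker
  exact ⟨0, e, he, h, by simp [comb_smul, Matrix.smul_mulVec, h]⟩

theorem isTangent_add_self (c : ℂ) (v : Fin 3 → ℂ) :
    IsTangent (comb A y) (comb A (c • y + v)) ↔ IsTangent (comb A y) (comb A v) := by
  constructor <;> rintro ⟨x, e, he, h, h'⟩ <;> refine ⟨x, e, he, h, ?_⟩ <;>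
    simpa [comb_add, comb_smul, Matrix.add_mulVec, Matrix.smul_mulVec, h] using h'

theorem isTangent_smul {c : ℂ} (hc : c ≠ 0) (v : Fin 3 → ℂ) :
    IsTangent (comb A y) (comb A (c • v)) ↔ IsTangent (comb A y) (comb A v) := by
  rw [isTangent_iff_eval_tangentCone, isTangent_iff_eval_tangentCone, tangentCone,
    eval_smul_of_hom (lineGen_coeff_isHomogeneous _ _ _)]
  simp [hc]

theorem finrank_ker_pos (hker : ∃ e, e ≠ 0 ∧ (comb A y).mulVec e = 0) :
    0 < Module.finrank ℂ (LinearMap.ker (comb A y).mulVecLin) := by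
  obtain ⟨e, he, h⟩ := hker
  rw [Module.finrank_pos_iff_exists_ne_zero]
  exact ⟨⟨e, h⟩, fun h0 => he (congrArg Subtype.val h0)⟩

/-- The polynomial whose roots are the tangent directions on the line `w + u v`. -/
theorem tangentCone_line {v : Fin 3 → ℂ} (hv : ¬ IsTangent (comb A y) (comb A v))
    (w : Fin 3 → ℂ) :
    (alongLine (tangentCone A y) w v).natDegree =
      Module.finrank ℂ (LinearMap.ker (comb A y).mulVecLin) ∧
    alongLine (tangentCone A y) w v ≠ 0 ∧
    ∀ u, (alongLine (tangentCone A y) w v).IsRoot u ↔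
      IsTangent (comb A y) (comb A (w + u • v)) := by
  rw [isTangent_iff_eval_tangentCone] at hv
  have h := alongLine_top (lineGen_coeff_isHomogeneous y (netDet A)
    (Module.finrank ℂ (LinearMap.ker (comb A y).mulVecLin))) w v
  change _ ∧ _ = MvPolynomial.eval v (tangentCone A y) at h
  refine ⟨le_antisymm h.1 (Polynomial.le_natDegree_of_ne_zero (by
    change (alongLine (tangentCone A y) w v).coeff _ ≠ 0
    rw [tangentCone, h.2]; exact hv)), ?_, ?_⟩
  · intro h0
    apply hv
    rw [← h.2, ← tangentCone, h0, Polynomial.coeff_zero]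
  · intro u
    rw [Polynomial.IsRoot, eval_alongLine, isTangent_iff_eval_tangentCone]

/-- Every line in a direction that is not tangent contains a tangent direction. -/
theorem exists_isTangent_add (hker : ∃ e, e ≠ 0 ∧ (comb A y).mulVec e = 0) {v : Fin 3 → ℂ}
    (hv : ¬ IsTangent (comb A y) (comb A v)) (w : Fin 3 → ℂ) :
    ∃ u : ℂ, IsTangent (comb A y) (comb A (w + u • v)) := by
  obtain ⟨h1, h2, h3⟩ := tangentCone_line hv w
  obtain ⟨u, hu⟩ := IsAlgClosed.exists_root (alongLine (tangentCone A y) w v) (by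
    rw [Polynomial.degree_eq_natDegree h2, h1]
    exact_mod_cast (finrank_ker_pos hker).ne')
  exact ⟨u, (h3 u).1 hu⟩

/-- The differential of a map given by three polynomials. -/
def jac (p : Fin 3 → Poly) (y : Fin 3 → ℂ) : (Fin 3 → ℂ) →ₗ[ℂ] (Fin 3 → ℂ) where
  toFun v k := dirDeriv (p k) y v
  map_add' v w := funext fun k => dirDeriv_add_dir _ _ _ _
  map_smul' c v := funext fun k => dirDeriv_smul_dir _ _ _ _

theorem jac_apply (p : Fin 3 → Poly) (y v : Fin 3 → ℂ) (k : Fin 3) :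
    jac p y v k = dirDeriv (p k) y v := rfl

/-- The curve `a · p = 0` is smooth at `y`, with a tangent direction `v` that is not a
tangent direction of `netDet A`. -/
structure IsSimpleAt (A : Fin 3 → Matrix (Fin m) (Fin m) ℂ) (p : Fin 3 → Poly)
    (y a v : Fin 3 → ℂ) : Prop where
  smooth : ∃ u, a ⬝ᵥ jac p y u ≠ 0
  tangent : a ⬝ᵥ jac p y v = 0
  transversal : ¬ IsTangent (comb A y) (comb A v)

theorem exists_dotProduct_eq_one {x : Fin 3 → ℂ} (hx : x ≠ 0) : ∃ c : Fin 3 → ℂ, c ⬝ᵥ x = 1 := by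
  obtain ⟨k, hk⟩ := Function.ne_iff.1 hx
  exact ⟨Pi.single k (x k)⁻¹, by rw [single_dotProduct, inv_mul_cancel₀ hk]⟩

theorem eq_smul_cross {a b w c : Fin 3 → ℂ} (ha : a ⬝ᵥ w = 0) (hb : b ⬝ᵥ w = 0)
    (hc : c ⬝ᵥ crossProduct a b = 1) : w = (c ⬝ᵥ w) • crossProduct a b := by
  simp only [dotProduct, Fin.sum_univ_three, cross_apply] at *
  simp at hc
  ext k
  fin_cases k <;> simp
  · linear_combination (c 2 * b 1 - c 1 * b 2) * ha + (c 1 * a 2 - c 2 * a 1) * hb - w 0 * hc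
  · linear_combination (c 0 * b 2 - c 2 * b 0) * ha + (c 2 * a 0 - c 0 * a 2) * hb - w 1 * hc
  · linear_combination (c 1 * b 0 - c 0 * b 1) * ha + (c 0 * a 1 - c 1 * a 0) * hb - w 2 * hc

theorem cross_expand (y v c w : Fin 3 → ℂ) : (c ⬝ᵥ crossProduct y v) • w =
    (crossProduct v c ⬝ᵥ w) • y + (crossProduct c y ⬝ᵥ w) • v + (crossProduct y v ⬝ᵥ w) • c := by
  simp only [dotProduct, Fin.sum_univ_three, cross_apply]
  ext k
  fin_cases k <;> simp <;> ring

/-- y and v span the plane orthogonal to l, and `cross_expand` supplies the coordinates in that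
plane as explicit linear functionals. -/
theorem exists_coords {l y v : Fin 3 → ℂ} (hl : l ≠ 0) (hy : l ⬝ᵥ y = 0) (hv : l ⬝ᵥ v = 0)
    (hyv : crossProduct y v ≠ 0) :
    ∃ α β : Fin 3 → ℂ, ∀ w, l ⬝ᵥ w = 0 → w = (α ⬝ᵥ w) • y + (β ⬝ᵥ w) • v := by
  obtain ⟨c, hc⟩ := exists_dotProduct_eq_one hyv
  have h1 := eq_smul_cross (by rwa [dotProduct_comm]) (by rwa [dotProduct_comm]) hc
  refine ⟨crossProduct v c, crossProduct c y, fun w hw => ?_⟩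
  have h2 : crossProduct y v ⬝ᵥ w = 0 := by
    rw [h1, smul_dotProduct, smul_eq_mul, mul_eq_zero] at hw
    refine hw.resolve_left fun h0 => hl ?_
    rw [h1, h0, zero_smul]
  have h3 := cross_expand y v c w
  rwa [hc, one_smul, h2, zero_smul, add_zero] at h3

theorem IsSimpleAt.cross_ne_zero {p : Fin 3 → Poly} {a v : Fin 3 → ℂ} (h : IsSimpleAt A p y a v)
    (hker : ∃ e, e ≠ 0 ∧ (comb A y).mulVec e = 0) (hy : y ≠ 0) : crossProduct y v ≠ 0 := by
  intro h0
  have h1 : ¬ LinearIndependent ℂ ![y, v] := fun h2 =>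
    crossProduct_ne_zero_iff_linearIndependent.2 h2 h0
  rw [LinearIndependent.pair_iff' hy] at h1
  push Not at h1
  obtain ⟨c, rfl⟩ := h1
  exact h.transversal (isTangent_self hker c)

theorem exists_gradient (p : Fin 3 → Poly) (y a : Fin 3 → ℂ) :
    ∃ l : Fin 3 → ℂ, ∀ v, a ⬝ᵥ jac p y v = l ⬝ᵥ v := by
  refine ⟨fun i => ∑ k, a k * MvPolynomial.eval y (MvPolynomial.pderiv i (p k)), fun v => ?_⟩
  simp only [dotProduct, jac_apply, dirDeriv, Finset.mul_sum, Finset.sum_mul]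
  rw [Finset.sum_comm]
  simp only [mul_assoc]

theorem IsSimpleAt.exists_coords {p : Fin 3 → Poly} {a v : Fin 3 → ℂ} (h : IsSimpleAt A p y a v)
    (hker : ∃ e, e ≠ 0 ∧ (comb A y).mulVec e = 0) (hy : y ≠ 0) (hyj : jac p y y = 0) :
    ∃ α β : Fin 3 → ℂ, ∀ w, a ⬝ᵥ jac p y w = 0 → w = (α ⬝ᵥ w) • y + (β ⬝ᵥ w) • v := by
  obtain ⟨l, hl⟩ := exists_gradient p y a
  simp only [hl]
  refine CurveElim.exists_coords ?_ ?_ ?_ (h.cross_ne_zero hker hy)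
  · rintro rfl
    obtain ⟨u, hu⟩ := h.smooth
    exact hu (by rw [hl, zero_dotProduct])
  · rw [← hl, hyj, dotProduct_zero]
  · rw [← hl, h.tangent]

/-- A second order solution of the pencil at a simple point along two combinations of `p`
comes from a tangent direction. -/
theorem IsSimpleAt.exists_isTangent {p : Fin 3 → Poly} {a v : Fin 3 → ℂ}
    (h : IsSimpleAt A p y a v) (hker : ∃ e, e ≠ 0 ∧ (comb A y).mulVec e = 0) (hy : y ≠ 0)
    (hyj : jac p y y = 0) {b b' : Fin 3 → ℂ} (hb : crossProduct b b' ≠ 0)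
    {ε : Fin m → ℂ} {e : Fin 3 → Fin m → ℂ} (hε : (comb A y).mulVec ε + ∑ k, (A k).mulVec (e k) = 0)
    (he : ∀ k, (comb A y).mulVec (e k) = 0)
    {z : Fin 3 → ℂ} (hz : z ⬝ᵥ y ≠ 0) (hze : ∑ k, z k • e k = 0)
    (h1 : ∀ i, b ⬝ᵥ jac p y (fun k => e k i) = 0) (h2 : ∀ i, b' ⬝ᵥ jac p y (fun k => e k i) = 0) :
    (∀ k, e k = 0) ∨ ∃ τ, jac p y τ = crossProduct b b' ∧ IsTangent (comb A y) (comb A τ) := by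
  obtain ⟨c, hc⟩ := exists_dotProduct_eq_one hb
  obtain ⟨α, β, hαβ⟩ := h.exists_coords hker hy hyj
  set ξ := crossProduct b b' with hξ
  have hze' : ∀ i, z ⬝ᵥ (fun k => e k i) = 0 := fun i => by
    have := congrFun hze i
    simpa [dotProduct] using this
  have hJ : ∀ i, jac p y (fun k => e k i) = (c ⬝ᵥ jac p y (fun k => e k i)) • ξ :=
    fun i => eq_smul_cross (h1 i) (h2 i) hc
  by_cases hall : ∀ i, c ⬝ᵥ jac p y (fun k => e k i) = 0
  · left
    -- All components of e lie in the tangent plane of the smooth curve a·p = 0, which is spanned by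
    -- y and v. Transversality kills the part along v, and the normalization by z kills the part
    -- along y.
    have hJ0 : ∀ i, jac p y (fun k => e k i) = 0 := fun i => by rw [hJ, hall, zero_smul]
    have hdec : ∀ i, (fun k => e k i) = (α ⬝ᵥ fun k => e k i) • y + (β ⬝ᵥ fun k => e k i) • v :=
      fun i => hαβ _ (by rw [hJ0, dotProduct_zero])
    set f₁ : Fin m → ℂ := ∑ k, α k • e k with hf₁
    set f₂ : Fin m → ℂ := ∑ k, β k • e k with hf₂
    have hek : ∀ k, e k = y k • f₁ + v k • f₂ := by
      intro k
      ext i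
      have := congrFun (hdec i) k
      simp only [dotProduct, Pi.add_apply, Pi.smul_apply, smul_eq_mul] at this
      rw [this]
      simp [f₁, f₂, mul_comm]
    have hk₁ : (comb A y).mulVec f₁ = 0 := by
      simp [f₁, Matrix.mulVec_sum, Matrix.mulVec_smul, he]
    have hk₂ : (comb A y).mulVec f₂ = 0 := by
      simp [f₂, Matrix.mulVec_sum, Matrix.mulVec_smul, he]
    have hsum : ∑ k, (A k).mulVec (e k) = (comb A v).mulVec f₂ := by
      have : ∑ k, (A k).mulVec (e k) = (comb A y).mulVec f₁ + (comb A v).mulVec f₂ := by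
        simp [hek, comb, Matrix.mulVec_add, Matrix.mulVec_smul, Matrix.sum_mulVec,
          Matrix.smul_mulVec, Finset.sum_add_distrib]
      rw [this, hk₁, zero_add]
    have hf₂0 : f₂ = 0 := by
      by_contra hne
      exact h.transversal ⟨ε, f₂, hne, hk₂, by rw [← hsum, hε]⟩
    have hf₁0 : f₁ = 0 := by
      have h3 : (z ⬝ᵥ y) • f₁ = 0 := by
        rw [← hze, dotProduct, Finset.sum_smul]
        simp only [hek, hf₂0, smul_zero, add_zero, smul_smul]
      exact (smul_eq_zero.1 h3).resolve_left hz
    intro k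
    rw [hek, hf₁0, hf₂0, smul_zero, smul_zero, add_zero]
  · right
    push Not at hall
    obtain ⟨i₀, hi₀⟩ := hall
    set s : Fin m → ℂ := fun i => c ⬝ᵥ jac p y (fun k => e k i) with hs
    set τ₀ : Fin 3 → ℂ := (s i₀)⁻¹ • fun k => e k i₀ with hτ₀
    have hJτ₀ : jac p y τ₀ = ξ := by
      rw [hτ₀, map_smul, hJ, smul_smul, inv_mul_cancel₀ hi₀, one_smul]
    -- If the differential kills v, then τ₀ can be moved along v, with the same image, until it is
    -- tangent. Otherwise vectors with zero differential are multiples of y, so e k = τ₀ k • s + y k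
    -- • f with s and f in the kernel, and s certifies that τ₀ is tangent.
    by_cases hJv : jac p y v = 0
    · obtain ⟨u, hu⟩ := exists_isTangent_add hker h.transversal τ₀
      exact ⟨τ₀ + u • v, by rw [map_add, map_smul (jac p y) u, hJv, smul_zero, add_zero, hJτ₀], hu⟩
    · refine ⟨τ₀, hJτ₀, ?_⟩
      have hdec : ∀ i, (fun k => e k i) - s i • τ₀ =
          (α ⬝ᵥ ((fun k => e k i) - s i • τ₀)) • y := by
        intro i
        have h0 : jac p y ((fun k => e k i) - s i • τ₀) = 0 := by
          rw [map_sub, map_smul, hJτ₀, hJ i, sub_self]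
        have h3 := hαβ ((fun k => e k i) - s i • τ₀) (by rw [h0, dotProduct_zero])
        have h4 := congrArg (jac p y) h3
        rw [h0, map_add, map_smul, map_smul, hyj, smul_zero, zero_add, eq_comm, smul_eq_zero] at h4
        have h5 := h4.resolve_right hJv
        rwa [h5, zero_smul, add_zero] at h3
      set f : Fin m → ℂ := fun i => α ⬝ᵥ ((fun k => e k i) - s i • τ₀) with hf
      have hek : ∀ k, e k = τ₀ k • s + y k • f := by
        intro k
        ext i
        have := congrFun (hdec i) k
        simp only [Pi.sub_apply, Pi.smul_apply, smul_eq_mul, Pi.add_apply] at this ⊢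
        linear_combination this
      have hks : (comb A y).mulVec s = 0 := by
        have : s = ∑ k, (Matrix.vecMul c (LinearMap.toMatrix' (jac p y))) k • e k := by
          ext i
          rw [hs]
          simp only [Finset.sum_apply, Pi.smul_apply, smul_eq_mul]
          rw [← LinearMap.toMatrix'_mulVec, Matrix.dotProduct_mulVec]
          rfl
        simp [this, Matrix.mulVec_sum, Matrix.mulVec_smul, he]
      have hkf : (comb A y).mulVec f = 0 := by
        obtain ⟨k, hk⟩ := Function.ne_iff.1 hy
        have := he k
        rw [hek, Matrix.mulVec_add, Matrix.mulVec_smul, Matrix.mulVec_smul, hks, smul_zero,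
          zero_add] at this
        exact (smul_eq_zero.1 this).resolve_left hk
      have hsum : ∑ k, (A k).mulVec (e k) = (comb A τ₀).mulVec s := by
        have : ∑ k, (A k).mulVec (e k) = (comb A τ₀).mulVec s + (comb A y).mulVec f := by
          simp [hek, comb, Matrix.mulVec_add, Matrix.mulVec_smul, Matrix.sum_mulVec,
            Matrix.smul_mulVec, Finset.sum_add_distrib]
        rw [this, hkf, add_zero]
      exact ⟨ε, s, fun h0 => hi₀ (congrFun h0 i₀), hks, by rw [← hsum, hε]⟩

/-- At a simple point only finitely many directions are images of tangent directions. -/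
theorem IsSimpleAt.finite_tangents {p : Fin 3 → Poly} {a v : Fin 3 → ℂ}
    (h : IsSimpleAt A p y a v) (hker : ∃ e, e ≠ 0 ∧ (comb A y).mulVec e = 0) (hy : y ≠ 0)
    (hyj : jac p y y = 0) :
    ∃ R : Set (Fin 3 → ℂ), R.Finite ∧ ∀ τ, IsTangent (comb A y) (comb A τ) → jac p y τ ≠ 0 →
      ∃ c : ℂ, c ≠ 0 ∧ ∃ ζ ∈ R, jac p y τ = c • ζ := by
  -- w completes y and v to a basis. A tangent direction with nonzero image has a nonzero coordinate
  -- along w, so up to scaling and multiples of y it is w + u v with u a root of a nonzero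
  -- polynomial.
  obtain ⟨w, hw⟩ := exists_dotProduct_eq_one (h.cross_ne_zero hker hy)
  obtain ⟨-, hne, hroot⟩ := tangentCone_line h.transversal w
  refine ⟨(fun u : ℂ => jac p y (w + u • v)) '' {u | (alongLine (tangentCone A y) w v).IsRoot u},
    (Polynomial.finite_setOfPred_isRoot hne).image _, fun τ hτ hJ => ?_⟩
  have hexp := cross_expand y v w τ
  rw [hw, one_smul] at hexp
  set α := crossProduct v w ⬝ᵥ τ
  set β := crossProduct w y ⬝ᵥ τ
  set γ := crossProduct y v ⬝ᵥ τ
  have hγ : γ ≠ 0 := by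
    intro h0
    rw [h0, zero_smul, add_zero] at hexp
    rw [hexp, isTangent_add_self] at hτ
    have hβ : β = 0 := by
      by_contra hβ
      exact h.transversal ((isTangent_smul hβ v).1 hτ)
    apply hJ
    rw [hexp, hβ, zero_smul, add_zero, map_smul, hyj, smul_zero]
  have hexp' : τ = α • y + γ • (w + (γ⁻¹ * β) • v) := by
    rw [smul_add, smul_smul, mul_inv_cancel_left₀ hγ, hexp]
    abel
  rw [hexp', isTangent_add_self, isTangent_smul hγ, ← hroot] at hτ
  refine ⟨γ, hγ, _, ⟨_, hτ, rfl⟩, ?_⟩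
  rw [hexp', map_add, map_smul, hyj, smul_zero, zero_add, map_smul]

end

end CurveElim
end

noncomputable section
namespace CurveElim

/-! ### Elimination along the lines through a point -/

/-- The Nullstellensatz for the prime ideal generated by Δ. -/
theorem dvd_of_forall_eval_eq_zero {Δ G : Poly} (hΔ : Irreducible Δ)
    (h : ∀ x, MvPolynomial.eval x Δ = 0 → MvPolynomial.eval x G = 0) : Δ ∣ G := by
  have hprime : (Ideal.span {Δ}).IsPrime := (Ideal.span_singleton_prime hΔ.ne_zero).2 hΔ.prime
  rw [← Ideal.mem_span_singleton, ← MvPolynomial.IsPrime.vanishingIdeal_zeroLocus (K := ℂ)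
    (Ideal.span {Δ}), MvPolynomial.mem_vanishingIdeal_iff]
  intro x hx
  rw [MvPolynomial.mem_zeroLocus_iff] at hx
  have := hx Δ (Ideal.mem_span_singleton_self Δ)
  rw [MvPolynomial.aeval_eq_eval] at this ⊢
  exact h x this

/-- The restriction of a polynomial to the generic line with direction `o`. -/
def slice (o : Fin 3 → ℂ) : Poly →+* Polynomial Poly :=
  (MvPolynomial.aeval (fun l => Polynomial.C (MvPolynomial.X l) +
    Polynomial.C (MvPolynomial.C (o l)) * Polynomial.X) : Poly →ₐ[ℂ] Polynomial Poly)

theorem slice_C (o : Fin 3 → ℂ) (c : ℂ) :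
    slice o (MvPolynomial.C c) = Polynomial.C (MvPolynomial.C c) := by
  change MvPolynomial.aeval _ (MvPolynomial.C c) = _
  rw [MvPolynomial.algHom_C]
  rfl

theorem slice_X (o : Fin 3 → ℂ) (l : Fin 3) : slice o (MvPolynomial.X l) =
    Polynomial.C (MvPolynomial.X l) + Polynomial.C (MvPolynomial.C (o l)) * Polynomial.X :=
  MvPolynomial.aeval_X _ _

theorem slice_map (o u : Fin 3 → ℂ) (G : Poly) :
    (slice o G).map (MvPolynomial.eval u) = alongLine G u o := by
  induction G using MvPolynomial.induction_on with
  | C a => rw [slice_C, alongLine_C, Polynomial.map_C, MvPolynomial.eval_C]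
  | add p q hp hq => rw [map_add, Polynomial.map_add, alongLine_add, hp, hq]
  | mul_X p l hp =>
    rw [map_mul, Polynomial.map_mul, alongLine_mul, hp, slice_X, alongLine_X]
    simp

theorem slice_eval_zero (o : Fin 3 → ℂ) (G : Poly) : (slice o G).eval 0 = G := by
  induction G using MvPolynomial.induction_on with
  | C a => rw [slice_C, Polynomial.eval_C]
  | add p q hp hq => rw [map_add, Polynomial.eval_add, hp, hq]
  | mul_X p l hp =>
    rw [map_mul, Polynomial.eval_mul, hp, slice_X]
    simp

/-- The shear `X l ↦ X l + o l t` of the polynomial ring in one more variable `t`. -/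
def shear (o : Fin 3 → ℂ) : Polynomial Poly →+* Polynomial Poly :=
  Polynomial.eval₂RingHom (slice o) Polynomial.X

theorem shear_C (o : Fin 3 → ℂ) (G : Poly) : shear o (Polynomial.C G) = slice o G :=
  Polynomial.eval₂_C _ _

theorem shear_X (o : Fin 3 → ℂ) : shear o Polynomial.X = Polynomial.X :=
  Polynomial.eval₂_X _ _

theorem shear_comp_neg (o : Fin 3 → ℂ) : (shear o).comp (shear (-o)) = RingHom.id _ := by
  refine Polynomial.ringHom_ext' (MvPolynomial.ringHom_ext ?_ ?_) ?_
  · intro c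
    simp only [RingHom.comp_apply, shear_C, slice_C, RingHom.id_apply]
  · intro l
    simp only [RingHom.comp_apply, shear_C, slice_X, RingHom.id_apply, map_add, map_mul, shear_X,
      slice_C, Pi.neg_apply, map_neg]
    ring
  · simp only [RingHom.comp_apply, shear_X, RingHom.id_apply]

def shearEquiv (o : Fin 3 → ℂ) : Polynomial Poly ≃+* Polynomial Poly :=
  RingEquiv.ofRingHom (shear o) (shear (-o)) (shear_comp_neg o)
    (by simpa using shear_comp_neg (-o))

/-- The shear is an automorphism of the polynomial ring in one more variable, and it carries the
constant Δ, which stays prime there, to its slice. -/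
theorem slice_irreducible (o : Fin 3 → ℂ) {Δ : Poly} (hΔ : Irreducible Δ) :
    Irreducible (slice o Δ) := by
  rw [← shear_C]
  change Irreducible (shearEquiv o (Polynomial.C Δ))
  rw [MulEquiv.irreducible_iff]
  exact (Polynomial.prime_C_iff.2 hΔ.prime).irreducible

theorem slice_natDegree_le (o : Fin 3 → ℂ) {G : Poly} {d : ℕ} (hG : G.IsHomogeneous d) :
    (slice o G).natDegree ≤ d ∧
      (slice o G).coeff d = MvPolynomial.C (MvPolynomial.eval o G) := by
  constructor
  · rw [Polynomial.natDegree_le_iff_coeff_eq_zero]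
    intro N hN
    refine MvPolynomial.funext fun u => ?_
    rw [← Polynomial.coeff_map, slice_map, map_zero]
    exact Polynomial.coeff_eq_zero_of_natDegree_lt ((alongLine_top hG u o).1.trans_lt hN)
  · refine MvPolynomial.funext fun u => ?_
    rw [← Polynomial.coeff_map, slice_map, MvPolynomial.eval_C]
    exact (alongLine_top hG u o).2

/-- Elimination of the coordinate in direction `o` from an irreducible form and a form that
is not a multiple of it. -/
theorem exists_eliminant {Δ P : Poly} {d : ℕ} (hΔ : Irreducible Δ) (hd : Δ.IsHomogeneous d)
    (hP : ¬ Δ ∣ P) {o : Fin 3 → ℂ} (ho : MvPolynomial.eval o Δ ≠ 0) :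
    ∃ (c : Poly) (a b : Polynomial Poly), c ≠ 0 ∧
      a * slice o Δ + b * slice o P = Polynomial.C c := by
  set K := FractionRing Poly
  set i := algebraMap Poly K
  have hi : Function.Injective i := IsFractionRing.injective Poly K
  set u : Poly := MvPolynomial.C (MvPolynomial.eval o Δ)⁻¹ with hu
  have huΔ : u * MvPolynomial.C (MvPolynomial.eval o Δ) = 1 := by
    rw [hu, ← map_mul, inv_mul_cancel₀ ho, map_one]
  obtain ⟨h1, h2⟩ := slice_natDegree_le o hd
  set f := Polynomial.C u * slice o Δ with hf
  -- The leading coefficient in t is the nonzero constant Δ(o). Monicity is what transfers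
  -- irreducibility and non-divisibility to the fraction field by Gauss's lemma; clearing
  -- denominators in the resulting Bezout identity then gives c.
  have hmonic : f.Monic := by
    refine Polynomial.monic_of_natDegree_le_of_coeff_eq_one d ?_ ?_
    · exact (Polynomial.natDegree_C_mul_le _ _).trans h1
    · rw [hf, Polynomial.coeff_C_mul, h2, huΔ]
  have hunit : IsUnit (Polynomial.C u) :=
    Polynomial.isUnit_C.2 (IsUnit.of_mul_eq_one _ huΔ)
  have hirr : Irreducible f := by
    rw [hf, irreducible_isUnit_mul hunit]
    exact slice_irreducible o hΔ
  have hndvd : ¬ f ∣ slice o P := by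
    rintro ⟨q, hq⟩
    apply hP
    have := congrArg (Polynomial.eval 0) hq
    rw [slice_eval_zero, hf, Polynomial.eval_mul, Polynomial.eval_mul, slice_eval_zero,
      Polynomial.eval_C] at this
    exact ⟨u * q.eval 0, by rw [this]; ring⟩
  have hcop : IsCoprime (f.map i) ((slice o P).map i) := by
    rw [((hmonic.irreducible_iff_irreducible_map_fraction_map (K := K)).1 hirr).coprime_iff_not_dvd,
      Polynomial.map_dvd_map i hi hmonic]
    exact hndvd
  obtain ⟨a, b, hab⟩ := hcop
  obtain ⟨ca, hca, ha⟩ := IsLocalization.integerNormalization_spec (nonZeroDivisors Poly) a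
  obtain ⟨cb, hcb, hb⟩ := IsLocalization.integerNormalization_spec (nonZeroDivisors Poly) b
  refine ⟨ca * cb, Polynomial.C (cb * u) *
    IsLocalization.integerNormalization (nonZeroDivisors Poly) a,
    Polynomial.C ca * IsLocalization.integerNormalization (nonZeroDivisors Poly) b,
    mul_ne_zero (nonZeroDivisors.ne_zero hca) (nonZeroDivisors.ne_zero hcb), ?_⟩
  apply Polynomial.map_injective i hi
  simp only [Polynomial.map_add, Polynomial.map_mul, Polynomial.map_C, hf, map_mul] at hab ⊢
  rw [ha, hb, Algebra.smul_def, Algebra.smul_def]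
  change _ * (Polynomial.C (i ca) * a) * _ + _ * (Polynomial.C (i cb) * b) * _ = _
  linear_combination (Polynomial.C (i ca) * Polynomial.C (i cb)) * hab

theorem exists_frame_of_cross {o u : Fin 3 → ℂ} (h : crossProduct o u ≠ 0) :
    ∃ g : Frame, g.pt 0 = o ∧ g.pt 1 = u := by
  obtain ⟨w, hw⟩ := exists_dotProduct_eq_one h
  set M : Matrix (Fin 3) (Fin 3) ℂ := (Matrix.of ![o, u, w]).transpose with hM
  have hdet : M.det = 1 := by
    rw [hM, Matrix.det_transpose, ← hw]
    simp only [Matrix.det_fin_three, dotProduct, Fin.sum_univ_three, cross_apply]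
    simp
    ring
  have hinv : M * M⁻¹ = 1 := Matrix.mul_nonsing_inv _ (by rw [hdet]; exact isUnit_one)
  refine ⟨⟨M, (M⁻¹ : Matrix (Fin 3) (Fin 3) ℂ), fun i k => ?_⟩, ?_, ?_⟩
  · have := congrFun (congrFun hinv i) k
    rw [Matrix.mul_apply, Matrix.one_apply] at this
    exact this
  · funext k
    simp [Frame.pt, hM]
  · funext k
    simp [Frame.pt, hM]

theorem netDet_transpose {m : ℕ} (A : Fin 3 → Matrix (Fin m) (Fin m) ℂ) :
    netDet (fun k => (A k).transpose) = netDet A := by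
  refine MvPolynomial.funext fun x => ?_
  rw [eval_netDet, eval_netDet, ← Matrix.det_transpose]
  simp [comb, Matrix.transpose_sum]

/-- On this line the pencil is A(pt 0) (t - `stepA`). -/
theorem alongLine_netDet_frame {m : ℕ} {A : Fin 3 → Matrix (Fin m) (Fin m) ℂ} (g : Frame)
    (h0 : IsUnit (comb A (g.pt 0)).det) : alongLine (netDet A) (g.pt 1) (g.pt 0) =
      Polynomial.C (comb A (g.pt 0)).det * (stepA A g).charpoly := by
  rw [alongLine_netDet, detLine, Matrix.charpoly, RingHom.map_det, ← Matrix.det_mul]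
  congr 1
  have h1 : comb A (g.pt 1) = -(comb A (g.pt 0) * stepA A g) := by
    rw [stepA, Matrix.mul_neg, neg_neg, Matrix.mul_nonsing_inv_cancel_left _ _ h0]
  rw [h1, Matrix.charmatrix, Matrix.mul_sub, RingHom.mapMatrix_apply, RingHom.mapMatrix_apply,
    ← Matrix.map_mul, sub_eq_neg_add, Matrix.scalar_apply, ← Matrix.smul_one_eq_diagonal,
    Matrix.mul_smul, Matrix.mul_one, Matrix.map_neg _ (by simp)]

/-- Substitute t = `stepA` in the Bezout identity: Cayley–Hamilton removes the determinant, and what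
remains exhibits an inverse of the leading matrix up to the scalar c. -/
theorem isUnit_leadMatrix {m : ℕ} {A : Fin 3 → Matrix (Fin m) (Fin m) ℂ} {g : Frame}
    (h0 : IsUnit (comb A (g.pt 0)).det) {P : Poly} {a b : Polynomial ℂ} {c : ℂ} (hc : c ≠ 0)
    (h : a * alongLine (netDet A) (g.pt 1) (g.pt 0) + b * alongLine P (g.pt 1) (g.pt 0) =
      Polynomial.C c) : IsUnit (leadMatrix A g P).det := by
  have := congrArg (Polynomial.aeval (stepA A g)) h
  rw [alongLine_netDet_frame g h0, map_add, map_mul, map_mul, map_mul, Matrix.aeval_self_charpoly,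
    mul_zero, mul_zero, zero_add, Polynomial.aeval_C] at this
  rw [← Matrix.isUnit_iff_isUnit_det]
  have h2 : (c⁻¹ • Polynomial.aeval (stepA A g) b) * leadMatrix A g P = 1 := by
    rw [leadMatrix, smul_mul_assoc, this, Algebra.algebraMap_eq_smul_one, smul_smul,
      inv_mul_cancel₀ hc, one_smul]
  exact IsUnit.of_mul_eq_one_right _ h2

/-- A frame that is adapted to a curve and a form without common component. -/
structure IsAdapted {m : ℕ} (A : Fin 3 → Matrix (Fin m) (Fin m) ℂ) (P : Poly) (g : Frame) :
    Prop where
  unit : IsUnit (comb A (g.pt 0)).det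
  lead : IsUnit (leadMatrix A g P).det
  lead_transpose : IsUnit (leadMatrix (fun k => (A k).transpose) g P).det
  ne_zero : ∀ y, y ≠ 0 → MvPolynomial.eval y (netDet A) = 0 → MvPolynomial.eval y P = 0 →
    MvPolynomial.eval y (g.form 2) ≠ 0

/-- Project from a point o off the curve. If the eliminant is nonzero at u, the line through o and u
contains no common zero and serves as the line at infinity z = 0. The same restricted identity
inverts the leading matrices of the pencil and of its transpose. -/
theorem exists_isAdapted {m : ℕ} {A : Fin 3 → Matrix (Fin m) (Fin m) ℂ}
    (hΔ : Irreducible (netDet A)) {P : Poly} (hP : ¬ netDet A ∣ P) {n : ℕ}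
    (hPn : P.IsHomogeneous n) : ∃ g, IsAdapted A P g := by
  obtain ⟨o, ho⟩ : ∃ o, MvPolynomial.eval o (netDet A) ≠ 0 := by
    by_contra! h
    exact hΔ.ne_zero (MvPolynomial.funext fun x => by rw [h, map_zero])
  have ho0 : o ≠ 0 := by
    rintro rfl
    have h1 := eval_smul_of_hom (netDet_isHomogeneous A) 0 0
    have hm : m ≠ 0 := by
      rintro rfl
      exact hΔ.not_isUnit (by rw [netDet, Matrix.det_isEmpty]; exact isUnit_one)
    rw [zero_smul, zero_pow hm, zero_mul] at h1
    exact ho h1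
  obtain ⟨c, a, b, hc, hab⟩ := exists_eliminant hΔ (netDet_isHomogeneous A) hP ho
  obtain ⟨u, hu, hcu⟩ : ∃ u, crossProduct o u ≠ 0 ∧ MvPolynomial.eval u c ≠ 0 := by
    obtain ⟨w, hw⟩ : ∃ w, crossProduct o w ≠ 0 := by
      by_contra! h
      apply ho0
      have e0 := h ![1, 0, 0]
      have e1 := h ![0, 1, 0]
      rw [cross_apply] at e0 e1
      simp at e0 e1
      ext k
      fin_cases k
      · simp [e1.2]
      · simp [e0.2]
      · simp [e0.1]
    obtain ⟨k, hk⟩ := Function.ne_iff.1 hw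
    -- ℓ is one coordinate of o × x. A point where ℓ c does not vanish is independent of o and off
    -- the zeros of the eliminant.
    set ℓ : Poly := ∑ j, MvPolynomial.C (crossProduct o (Pi.single j 1) k) * MvPolynomial.X j
      with hℓ
    have hev : ∀ x, MvPolynomial.eval x ℓ = crossProduct o x k := by
      intro x
      rw [hℓ, pi_eq_sum_univ' x]
      simp only [map_sum, map_mul, MvPolynomial.eval_C, MvPolynomial.eval_X, Finset.sum_apply,
        map_smul, Pi.smul_apply, smul_eq_mul]
      refine Finset.sum_congr rfl fun j _ => ?_
      have : ∀ f : Fin 3 → ℂ, (∑ i, x i * f i) = ∑ i, x i * f i := fun _ => rfl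
      simp [Pi.single_apply, mul_comm]
    have hℓ0 : ℓ ≠ 0 := by
      intro h
      apply hk
      rw [← hev, h, map_zero]
      rfl
    obtain ⟨u, hu⟩ : ∃ u, MvPolynomial.eval u (ℓ * c) ≠ 0 := by
      by_contra! h
      exact mul_ne_zero hℓ0 hc (MvPolynomial.funext fun x => by rw [h, map_zero])
    rw [map_mul] at hu
    refine ⟨u, fun h => left_ne_zero_of_mul hu ?_, right_ne_zero_of_mul hu⟩
    rw [hev, h]
    rfl
  obtain ⟨g, rfl, rfl⟩ := exists_frame_of_cross hu
  have hmap := congrArg (Polynomial.map (MvPolynomial.eval (g.pt 1))) hab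
  rw [Polynomial.map_add, Polynomial.map_mul, Polynomial.map_mul, slice_map, slice_map,
    Polynomial.map_C] at hmap
  have h0 : IsUnit (comb A (g.pt 0)).det := by
    rw [← eval_netDet]
    exact ho.isUnit
  refine ⟨g, h0, isUnit_leadMatrix h0 hcu hmap, ?_, ?_⟩
  · refine isUnit_leadMatrix (isUnit_transpose_comb g h0) hcu (a := a.map (MvPolynomial.eval (g.pt 1)))
      (b := b.map (MvPolynomial.eval (g.pt 1))) ?_
    rw [netDet_transpose, hmap]
  · intro y hy hyΔ hyP hz
    have hexp := g.expand y
    rw [Fin.sum_univ_three, hz, zero_smul, add_zero] at hexp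
    set α := MvPolynomial.eval y (g.form 0)
    set β := MvPolynomial.eval y (g.form 1)
    -- A point at infinity is either o, which is off the curve, or a multiple of some u + t o, where
    -- the restricted Bezout identity forbids a common zero.
    by_cases hβ : β = 0
    · rw [hβ, zero_smul, add_zero] at hexp
      have hα : α ≠ 0 := by
        intro h
        exact hy (by rw [hexp, h, zero_smul])
      rw [hexp, eval_smul_of_hom (netDet_isHomogeneous A)] at hyΔ
      exact mul_ne_zero (pow_ne_zero _ hα) ho hyΔ
    · have hexp' : y = β • (g.pt 1 + (β⁻¹ * α) • g.pt 0) := by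
        rw [smul_add, smul_smul, mul_inv_cancel_left₀ hβ, add_comm]
        exact hexp
      rw [hexp', eval_smul_of_hom (netDet_isHomogeneous A), ← eval_alongLine] at hyΔ
      rw [hexp', eval_smul_of_hom hPn, ← eval_alongLine] at hyP
      have e1 := (mul_eq_zero.1 hyΔ).resolve_left (pow_ne_zero _ hβ)
      have e2 := (mul_eq_zero.1 hyP).resolve_left (pow_ne_zero _ hβ)
      have := congrArg (Polynomial.eval (β⁻¹ * α)) hmap
      rw [Polynomial.eval_add, Polynomial.eval_mul, Polynomial.eval_mul, e1, e2, mul_zero, mul_zero,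
        add_zero, Polynomial.eval_C] at this
      exact hcu this.symm

end CurveElim
end

noncomputable section
namespace CurveElim

/-! ### The blown up space as a space of functionals -/

section

variable {m n : ℕ}

/-- The matrices `D₀, D₁, -D₂` of the pencil. -/
def signed (D : Fin 3 → Matrix (Fin m) (Fin m) ℂ) : Fin 3 → Matrix (Fin m) (Fin m) ℂ :=
  ![D 0, D 1, -D 2]

theorem comb_signed (D : Fin 3 → Matrix (Fin m) (Fin m) ℂ) (x : Fin 3 → ℂ) :
    comb (signed D) x = pencil D x := by
  simp [comb, signed, pencil, Fin.sum_univ_three, sub_eq_add_neg]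

theorem netDet_signed (D : Fin 3 → Matrix (Fin m) (Fin m) ℂ) :
    netDet (signed D) = detForm (D 0) (D 1) (D 2) := by
  simp only [netDet, signed, detForm, Fin.sum_univ_three]
  congr 1
  ext1 i j
  simp [sub_eq_add_neg]

/-- The values of a functional on the monomials of degree `n - 1`. -/
def toBlown (n : ℕ) : Functional m →ₗ[ℂ] BlownUp m n where
  toFun E := WithLp.toLp 2 fun is => E (mon is.1.1) is.2
  map_add' _ _ := rfl
  map_smul' _ _ := rfl

theorem toBlown_apply (E : Functional m) (is : Expo n × Fin m) :
    toBlown n E is = E (mon is.1.1) is.2 := rfl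

theorem component_toBlown (E : Functional m) (i : Expo n) :
    component (toBlown n E) i = E (mon i.1) := rfl

theorem toBlown_evalFun (y : Fin 3 → ℂ) (e : Fin m → ℂ) :
    toBlown n (evalFun y e) = vandermonde n y e := by
  ext is
  rw [toBlown_apply, evalFun_apply, eval_mon]
  rfl

theorem mon_eq_monomial (i : Fin 3 → ℕ) :
    mon i = MvPolynomial.monomial (Finsupp.equivFunOnFinite.symm i) 1 := by
  rw [MvPolynomial.monomial_eq, map_one, one_mul, Finsupp.prod_fintype _ _ (by simp)]
  rfl

theorem X_mul_mon (k : Fin 3) (i : Fin 3 → ℕ) :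
    MvPolynomial.X k * mon i = mon (i + Pi.single k 1) := by
  rw [mon, mon]
  simp only [Pi.add_apply, pow_add, Finset.prod_mul_distrib]
  rw [mul_comm]
  congr 1
  rw [Finset.prod_eq_single k]
  · simp
  · intro b _ hb
    simp [hb]
  · simp

theorem toBlown_mem_principal {D : Fin 3 → Matrix (Fin m) (Fin m) ℂ} {E : Functional m}
    (hE : E ∈ kerFunctionals (signed D)) : toBlown n E ∈ principal n D := by
  intro j i hi
  have h := mem_kerFunctionals.1 hE (mon j)
  rw [Fin.sum_univ_three] at h
  simp only [X_mul_mon, ← hi, ← component_toBlown] at h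
  simpa [signed, sub_eq_add_neg, Matrix.neg_mulVec] using h

/-- The functional with given values on the monomials of degree `n - 1` that vanishes on all
other monomials. -/
def ofBlown (w : BlownUp m n) : Functional m :=
  ∑ i : Expo n, (MvPolynomial.lcoeff ℂ (Finsupp.equivFunOnFinite.symm i.1)).smulRight
    (component w i)

theorem ofBlown_mon (w : BlownUp m n) (i : Expo n) : ofBlown w (mon i.1) = component w i := by
  rw [ofBlown, LinearMap.sum_apply, Finset.sum_eq_single i]
  · simp [mon_eq_monomial]
  · intro j _ hj
    have : Finsupp.equivFunOnFinite.symm i.1 ≠ Finsupp.equivFunOnFinite.symm j.1 := fun h =>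
      hj (Subtype.ext (Finsupp.equivFunOnFinite.symm.injective h)).symm
    simp [mon_eq_monomial, MvPolynomial.coeff_monomial, this]
  · simp

theorem ofBlown_mon_of_ne (w : BlownUp m n) {i : Fin 3 → ℕ} (hi : ∑ l, i l ≠ n - 1) :
    ofBlown w (mon i) = 0 := by
  rw [ofBlown, LinearMap.sum_apply]
  refine Finset.sum_eq_zero fun j _ => ?_
  have : Finsupp.equivFunOnFinite.symm i ≠ Finsupp.equivFunOnFinite.symm j.1 := fun h => by
    have h2 := Finsupp.equivFunOnFinite.symm.injective h
    exact hi (by rw [h2]; exact expo_sum j)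
  simp [mon_eq_monomial, MvPolynomial.coeff_monomial, this]

theorem toBlown_ofBlown (w : BlownUp m n) : toBlown n (ofBlown w) = w := by
  ext is
  rw [toBlown_apply, ofBlown_mon]
  rfl

/-- Extension by zero is harmless: each relation involves a single degree, and outside degree n - 1
it is trivial. -/
theorem ofBlown_mem {D : Fin 3 → Matrix (Fin m) (Fin m) ℂ} {w : BlownUp m n}
    (hw : w ∈ principal n D) : ofBlown w ∈ kerFunctionals (signed D) := by
  rw [mem_kerFunctionals]
  intro h
  induction h using MvPolynomial.induction_on' with
  | monomial d c =>
    have hd : MvPolynomial.monomial d c = MvPolynomial.C c * mon (Finsupp.equivFunOnFinite d) := by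
      rw [mon_eq_monomial, Equiv.symm_apply_apply, MvPolynomial.C_mul_monomial, mul_one]
    generalize Finsupp.equivFunOnFinite d = j at hd
    have hk : ∀ k, MvPolynomial.X k * MvPolynomial.monomial d c =
        MvPolynomial.C c * mon (j + Pi.single k 1) := by
      intro k
      rw [hd, ← X_mul_mon]
      ring
    simp only [hk, act_C_mul, Matrix.mulVec_smul]
    rw [← Finset.smul_sum]
    have hsum : ∀ k, ∑ l, (j + Pi.single k 1 : Fin 3 → ℕ) l = ∑ l, j l + 1 := by
      intro k
      simp [Finset.sum_add_distrib]
    by_cases hj : ∑ l, j l + 1 = n - 1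
    · have h1 := hw j (fun k => ⟨j + Pi.single k 1, by
        simp only [Finset.mem_piAntidiag, hsum]
        simp [hj]⟩) (fun k => rfl)
      simp only [← ofBlown_mon] at h1
      have : ∑ k, (signed D k).mulVec (ofBlown w (mon (j + Pi.single k 1))) = 0 := by
        rw [Fin.sum_univ_three]
        simpa [signed, sub_eq_add_neg, Matrix.neg_mulVec] using h1
      rw [this, smul_zero]
    · rw [Finset.sum_eq_zero, smul_zero]
      intro k _
      rw [ofBlown_mon_of_ne w (by rw [hsum]; exact hj), Matrix.mulVec_zero]
  | add f f' hf hf' =>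
    simp only [mul_add, map_add, Matrix.mulVec_add, Finset.sum_add_distrib, hf, hf', add_zero]

theorem toBlown_eq_zero_iff {E : Functional m} :
    toBlown n E = 0 ↔ ∀ h : Poly, h.IsHomogeneous (n - 1) → E h = 0 := by
  constructor
  · intro hE h hh
    rw [h.as_sum, map_sum]
    refine Finset.sum_eq_zero fun d hd => ?_
    have hd' : MvPolynomial.monomial d (MvPolynomial.coeff d h) =
        MvPolynomial.C (MvPolynomial.coeff d h) * mon (Finsupp.equivFunOnFinite d) := by
      rw [mon_eq_monomial, Equiv.symm_apply_apply, MvPolynomial.C_mul_monomial, mul_one]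
    have hdeg := hh (MvPolynomial.mem_support_iff.1 hd)
    rw [Finsupp.weight_apply, Finsupp.sum_fintype _ _ (by simp)] at hdeg
    have hmem : (Finsupp.equivFunOnFinite d : Fin 3 → ℕ) ∈
        Finset.piAntidiag (Finset.univ : Finset (Fin 3)) (n - 1) := by
      simp only [Finset.mem_piAntidiag]
      simpa using hdeg
    rw [hd', act_C_mul]
    have : E (mon (⟨_, hmem⟩ : Expo n).1) = 0 := by
      rw [← component_toBlown, hE]
      rfl
    rw [this, smul_zero]
  · intro h
    ext is
    have hm := mon_isHomogeneous is.1.1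
    rw [expo_sum is.1] at hm
    rw [toBlown_apply, h _ hm]
    rfl

theorem toBlown_eq_of_seqOf {D : Fin 3 → Matrix (Fin m) (Fin m) ℂ} {g : Frame}
    (h0 : IsUnit (comb (signed D) (g.pt 0)).det) (hn : 0 < n) {E E' : Functional m}
    (hE : E ∈ affineFunctionals (signed D) g) (hE' : E' ∈ affineFunctionals (signed D) g)
    (h : ∀ j < n, seqOf g E j = seqOf g E' j) : toBlown n E = toBlown n E' := by
  rw [← sub_eq_zero, ← map_sub, toBlown_eq_zero_iff]
  intro f hf
  refine affine_eq_zero_of_hom g h0 (Submodule.sub_mem _ hE hE') (N := n - 1) ?_ hf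
  intro k hk
  have := h k (by omega)
  rw [seqOf] at this ⊢
  rw [LinearMap.sub_apply, this, seqOf, sub_self]

theorem seqOf_eq_of_toBlown {D : Fin 3 → Matrix (Fin m) (Fin m) ℂ} {g : Frame}
    {E : Functional m} (hE : E ∈ affineFunctionals (signed D) g)
    (h : toBlown n E = 0) : ∀ j < n, seqOf g E j = 0 := by
  intro j hj
  rw [seqOf, ← affine_pow g hE (n - 1 - j)]
  refine toBlown_eq_zero_iff.1 h _ ?_
  have := ((g.form_isHomogeneous 1).pow j).mul ((g.form_isHomogeneous 2).pow (n - 1 - j))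
  convert this using 1
  omega

/-- Every vector of the principal subspace comes from a functional on the affine part. -/
theorem exists_affine_toBlown {D : Fin 3 → Matrix (Fin m) (Fin m) ℂ} {g : Frame}
    (h0 : IsUnit (comb (signed D) (g.pt 0)).det) (hn : 0 < n) {w : BlownUp m n}
    (hw : w ∈ principal n D) :
    ∃ E ∈ affineFunctionals (signed D) g, toBlown n E = w := by
  -- Dehomogenization: the values on u^k z^(n-1-k) become the terms of the sequence. The terms
  -- beyond n - 1 do not affect degree n - 1.
  set E := ofSeq (signed D) g (fun k => ofBlown w (g.form 1 ^ k * g.form 2 ^ (n - 1 - k)))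
  have hE := ofSeq_mem (A := signed D) g h0
    (fun k => ofBlown w (g.form 1 ^ k * g.form 2 ^ (n - 1 - k)))
  refine ⟨E, hE, ?_⟩
  rw [← toBlown_ofBlown w, ← sub_eq_zero, ← map_sub, toBlown_eq_zero_iff]
  intro f hf
  refine eq_zero_of_two_var g h0 (Submodule.sub_mem _ hE.1 (ofBlown_mem hw)) (N := n - 1) ?_ hf
  intro a b hab
  rw [LinearMap.sub_apply, affine_pow g hE]
  have h1 : E (g.form 1 ^ a) = ofBlown w (g.form 1 ^ a * g.form 2 ^ (n - 1 - a)) :=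
    congrFun (seqOf_ofSeq (A := signed D) g _) a
  have h2 : n - 1 - a = b := by omega
  rw [← h2]
  exact sub_eq_zero.2 h1

/-- The components of the conjugate vector. -/
def conjBlown (w : BlownUp m n) : BlownUp m n := WithLp.toLp 2 fun is => star (w is)

theorem conjBlown_conjBlown (w : BlownUp m n) : conjBlown (conjBlown w) = w := by
  ext is
  simp [conjBlown]

/-- The conjugate of a hermitian matrix is its transpose. Hence the left arguments of the
sesquilinear form become functionals for the transposed pencil, as `bez_key` requires. -/
theorem conjBlown_mem {D : Fin 3 → Matrix (Fin m) (Fin m) ℂ} (hD : ∀ k, (D k).IsHermitian)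
    {w : BlownUp m n} (hw : w ∈ principal n D) :
    conjBlown w ∈ principal n (fun k => (D k).transpose) := by
  intro j i hi
  have h := congrArg star (hw j i hi)
  have hc : ∀ k, (D k).transpose.mulVec (component (conjBlown w) (i k)) =
      star ((D k).mulVec (component w (i k))) := by
    intro k
    have : (D k).transpose = (D k).map star := by
      conv_lhs => rw [← (hD k).eq]
      ext a b
      simp [Matrix.conjTranspose]
    rw [this]
    ext a
    simp [Matrix.mulVec, dotProduct, component, conjBlown]
  rw [hc, hc, hc]
  rw [star_sub, star_add, star_zero] at h
  exact h

theorem signed_transpose (D : Fin 3 → Matrix (Fin m) (Fin m) ℂ) :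
    signed (fun k => (D k).transpose) = fun k => (signed D k).transpose := by
  funext k
  fin_cases k <;> simp [signed]

/-! ### Bezout matrices as pairings of functionals -/

/-- The coefficients of a Bezout decomposition, with uniform signs. -/
def bezCoef {p q : MvPolynomial (Fin 3) ℝ} (b : BezoutCoeffs n p q) :
    Fin 3 → Expo n → Expo n → ℂ :=
  ![b.b12, b.b20, -b.b10]

/-- The complex polynomial with the same real coefficients. -/
def toPoly (p : MvPolynomial (Fin 3) ℝ) : Poly := MvPolynomial.map (algebraMap ℝ ℂ) p

theorem eval_toPoly (p : MvPolynomial (Fin 3) ℝ) (x : Fin 3 → ℂ) :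
    MvPolynomial.eval x (toPoly p) = MvPolynomial.aeval x p := by
  rw [toPoly, MvPolynomial.eval_map]
  rfl

theorem bezCoef_isBezout {p q : MvPolynomial (Fin 3) ℝ} (b : BezoutCoeffs n p q) :
    IsBezout (bezCoef b) (toPoly p) (toPoly q) := by
  intro x y
  rw [eval_toPoly, eval_toPoly, eval_toPoly, eval_toPoly, b.decomp x y]
  refine Finset.sum_congr rfl fun i _ => Finset.sum_congr rfl fun j _ => ?_
  change _ = b.b12 i j * _ + b.b20 i j * _ + -b.b10 i j * _
  ring

/-- The matrix `∑ γ k ⊗ A k`. -/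
def tensorMat (γ : Fin 3 → Expo n → Expo n → ℂ) (A : Fin 3 → Matrix (Fin m) (Fin m) ℂ) :
    Matrix (Expo n × Fin m) (Expo n × Fin m) ℂ :=
  Matrix.of fun is jt => ∑ k, γ k is.1 jt.1 * A k is.2 jt.2

theorem bezout_eq_tensorMat {p q : MvPolynomial (Fin 3) ℝ}
    (D : Fin 3 → Matrix (Fin m) (Fin m) ℂ) (b : BezoutCoeffs n p q) :
    bezout D b = tensorMat (bezCoef b) (signed D) := by
  ext ⟨i, s⟩ ⟨j, t⟩
  rw [tensorMat, Matrix.of_apply, Fin.sum_univ_three]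
  change _ = b.b12 i j * D 0 s t + b.b20 i j * D 1 s t + -b.b10 i j * -D 2 s t
  simp [bezout]

theorem inner_tensorMat (γ : Fin 3 → Expo n → Expo n → ℂ)
    (A : Fin 3 → Matrix (Fin m) (Fin m) ℂ) {F E : Functional m} {w' w : BlownUp m n}
    (hF : toBlown n F = conjBlown w') (hE : toBlown n E = w) :
    inner ℂ w' (Matrix.toEuclideanLin (tensorMat γ A) w) = bez γ A F E := by
  have hF' : ∀ is, star (w' is) = F (mon is.1.1) is.2 := fun is => by
    rw [← toBlown_apply, hF]
    rfl
  have hE' : ∀ is, w is = E (mon is.1.1) is.2 := fun is => by rw [← toBlown_apply, hE]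
  have h1 : inner ℂ w' (Matrix.toEuclideanLin (tensorMat γ A) w) =
      ∑ is, star (w' is) * ∑ jt, tensorMat γ A is jt * w jt := by
    simp [PiLp.inner_apply, Matrix.mulVec, dotProduct, mul_comm]
  rw [h1]
  simp only [hF', hE', bez, pair, tensorMat, Matrix.of_apply, Fintype.sum_prod_type, Finset.mul_sum,
    Finset.sum_mul, dotProduct, Matrix.mulVec]
  refine Finset.sum_congr rfl fun i _ => ?_
  rw [Finset.sum_comm]
  refine Finset.sum_congr rfl fun j _ => ?_
  have : ∀ f : Fin m → Fin m → Fin 3 → ℂ,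
      ∑ s, ∑ t, ∑ k, f s t k = ∑ k, ∑ s, ∑ t, f s t k := by
    intro f
    rw [Finset.sum_comm (s := (Finset.univ : Finset (Fin 3)))]
    exact Finset.sum_congr rfl fun s _ => Finset.sum_comm
  rw [this]
  refine Finset.sum_congr rfl fun k _ => Finset.sum_congr rfl fun s _ =>
    Finset.sum_congr rfl fun t _ => ?_
  ring

end

end CurveElim
end

noncomputable section
namespace CurveElim

/-! ### Linear combinations of three polynomials -/

/-- The linear combination `a · q`. -/
def lin (a : Fin 3 → ℂ) (q : Fin 3 → Poly) : Poly := ∑ k, MvPolynomial.C (a k) * q k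

theorem eval_lin (a : Fin 3 → ℂ) (q : Fin 3 → Poly) (x : Fin 3 → ℂ) :
    MvPolynomial.eval x (lin a q) = a ⬝ᵥ fun k => MvPolynomial.eval x (q k) := by
  simp [lin, dotProduct]

theorem lin_isHomogeneous {n : ℕ} (a : Fin 3 → ℂ) {q : Fin 3 → Poly}
    (hq : ∀ k, (q k).IsHomogeneous n) : (lin a q).IsHomogeneous n := by
  refine MvPolynomial.IsHomogeneous.sum _ _ _ fun k _ => ?_
  simpa using (MvPolynomial.isHomogeneous_C (Fin 3) (a k)).mul (hq k)

theorem dirDeriv_lin (a : Fin 3 → ℂ) (q : Fin 3 → Poly) (y v : Fin 3 → ℂ) :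
    dirDeriv (lin a q) y v = a ⬝ᵥ jac q y v := by
  rw [lin, Fin.sum_univ_three, dirDeriv_add, dirDeriv_add, dirDeriv_mul, dirDeriv_mul, dirDeriv_mul]
  simp [dirDeriv_C, dotProduct, Fin.sum_univ_three, jac_apply]

theorem jac_self {n : ℕ} {q : Fin 3 → Poly} (hq : ∀ k, (q k).IsHomogeneous n) (y : Fin 3 → ℂ) :
    jac q y y = (n : ℂ) • fun k => MvPolynomial.eval y (q k) := by
  funext k
  rw [jac_apply, dirDeriv_self (hq k)]
  rfl

theorem exists_cross_eq {a ξ : Fin 3 → ℂ} (ha : a ≠ 0) (h : a ⬝ᵥ ξ = 0) :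
    ∃ b, crossProduct a b = ξ := by
  obtain ⟨c, hc⟩ := exists_dotProduct_eq_one ha
  refine ⟨crossProduct ξ c, ?_⟩
  simp only [dotProduct, Fin.sum_univ_three, cross_apply] at *
  ext k
  fin_cases k <;> simp
  · linear_combination ξ 0 * hc - c 0 * h
  · linear_combination ξ 1 * hc - c 1 * h
  · linear_combination ξ 2 * hc - c 2 * h

theorem exists_smul_of_cross_eq_zero {x y : Fin 3 → ℂ} (hx : x ≠ 0)
    (h : crossProduct x y = 0) : ∃ c : ℂ, y = c • x := by
  have h1 : ¬ LinearIndependent ℂ ![x, y] := fun h2 =>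
    crossProduct_ne_zero_iff_linearIndependent.2 h2 h
  rw [LinearIndependent.pair_iff' hx] at h1
  push Not at h1
  obtain ⟨c, rfl⟩ := h1
  exact ⟨c, rfl⟩

theorem det_eq_zero_of_mulVec {m : ℕ} {M : Matrix (Fin m) (Fin m) ℂ} {e : Fin m → ℂ}
    (he : e ≠ 0) (h : M.mulVec e = 0) : M.det = 0 :=
  Matrix.exists_mulVec_eq_zero_iff.1 ⟨e, he, h⟩

section

variable {m n : ℕ} {D : Fin 3 → Matrix (Fin m) (Fin m) ℂ} {p : Fin 3 → MvPolynomial (Fin 3) ℝ}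

/-- The complex polynomials of a real map. -/
def cmap (p : Fin 3 → MvPolynomial (Fin 3) ℝ) : Fin 3 → Poly := fun k => toPoly (p k)

theorem eval_cmap (p : Fin 3 → MvPolynomial (Fin 3) ℝ) (x : Fin 3 → ℂ) :
    (fun k => MvPolynomial.eval x (cmap p k)) = values p x :=
  funext fun _ => eval_toPoly _ _

theorem cmap_isHomogeneous (hp : ∀ k, (p k).IsHomogeneous n) (k : Fin 3) :
    (cmap p k).IsHomogeneous n := (hp k).map _

theorem eval_lin_cmap (a x : Fin 3 → ℂ) :
    MvPolynomial.eval x (lin a (cmap p)) = a ⬝ᵥ values p x := by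
  rw [eval_lin, eval_cmap]

theorem values_smul (hp : ∀ k, (p k).IsHomogeneous n) (c : ℂ) (x : Fin 3 → ℂ) :
    values p (c • x) = c ^ n • values p x := by
  rw [← eval_cmap, ← eval_cmap]
  funext k
  rw [eval_smul_of_hom (cmap_isHomogeneous hp k)]
  rfl

theorem vandermonde_smul (c : ℂ) (y : Fin 3 → ℂ) (e : Fin m → ℂ) :
    vandermonde n (c • y) e = c ^ (n - 1) • vandermonde n y e := by
  ext is
  have hm := mon_isHomogeneous is.1.1
  rw [expo_sum is.1] at hm
  have := eval_smul_of_hom hm c y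
  rw [eval_mon, eval_mon] at this
  change monom is.1.1 (c • y) * e is.2 = c ^ (n - 1) * (monom is.1.1 y * e is.2)
  rw [this, mul_assoc]

theorem vandermonde_mem_principal {y : Fin 3 → ℂ} {e : Fin m → ℂ}
    (he : (comb (signed D) y).mulVec e = 0) : vandermonde n y e ∈ principal n D := by
  rw [← toBlown_evalFun]
  exact toBlown_mem_principal (evalFun_mem_ker_iff.2 he)

theorem exists_frame (hirr : Irreducible (netDet (signed D))) :
    ∃ g : Frame, IsUnit (comb (signed D) (g.pt 0)).det := by
  obtain ⟨g, hg⟩ := exists_isAdapted hirr (P := 1)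
    (fun h => hirr.not_isUnit (isUnit_of_dvd_one h)) (MvPolynomial.isHomogeneous_one _ _)
  exact ⟨g, hg.unit⟩

/-! ### The hermitian forms -/

/-- Conjugating the identity at the conjugate points returns the same left hand side, because f and
g are real. -/
theorem isBezout_sub_conj {f g : MvPolynomial (Fin 3) ℝ} (b : BezoutCoeffs n f g) :
    IsBezout (fun k i j => bezCoef b k i j - star (bezCoef b k i j)) 0 0 := by
  intro x y
  have h1 := bezCoef_isBezout b x y
  have h2 := congrArg star (bezCoef_isBezout b (star x) (star y))
  have hev : ∀ (f : MvPolynomial (Fin 3) ℝ) (x : Fin 3 → ℂ),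
      star (MvPolynomial.eval (star x) (toPoly f)) = MvPolynomial.eval x (toPoly f) := by
    intro f x
    rw [eval_toPoly, eval_toPoly, MvPolynomial.aeval_def, MvPolynomial.aeval_def,
      MvPolynomial.eval₂_eq', MvPolynomial.eval₂_eq']
    simp
  have hmon : ∀ (i : Fin 3 → ℕ) (x : Fin 3 → ℂ), star (monom i (star x)) = monom i x := by
    intro i x
    simp [monom]
  simp only [star_sub, star_mul', hev, star_sum, star_add, hmon, Pi.star_apply, star_star] at h2
  simp only [map_zero, mul_zero, sub_zero, sub_mul]
  have h3 := sub_eq_zero.2 (h1.symm.trans h2)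
  rw [← h3]
  simp only [← Finset.sum_sub_distrib]
  refine Finset.sum_congr rfl fun i _ => Finset.sum_congr rfl fun j _ => ?_
  ring

theorem conjTranspose_bezout (hD : ∀ k, (D k).IsHermitian) {f g : MvPolynomial (Fin 3) ℝ}
    (b : BezoutCoeffs n f g) : (bezout D b).conjTranspose =
      tensorMat (fun k i j => star (bezCoef b k i j)) (signed D) := by
  have hsym : ∀ k i j, bezCoef b k i j = bezCoef b k j i := by
    intro k i j
    fin_cases k
    · exact b.symm12.apply j i
    · exact b.symm20.apply j i
    · exact congrArg Neg.neg (b.symm10.apply j i)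
  have hherm : ∀ k s t, star (signed D k s t) = signed D k t s := by
    intro k s t
    fin_cases k
    · exact (hD 0).apply t s
    · exact (hD 1).apply t s
    · exact (star_neg _).trans (congrArg Neg.neg ((hD 2).apply t s))
  rw [bezout_eq_tensorMat]
  ext ⟨i, s⟩ ⟨j, t⟩
  simp only [Matrix.conjTranspose_apply, tensorMat, Matrix.of_apply, star_sum, star_mul', hherm]
  exact Finset.sum_congr rfl fun k _ => by rw [hsym k j i]

/-- The Bezout matrices are hermitian on the principal subspace. -/
theorem inner_bezout_comm (hD : ∀ k, (D k).IsHermitian) (hirr : Irreducible (netDet (signed D)))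
    (hn : 0 < n) {f g : MvPolynomial (Fin 3) ℝ} (b : BezoutCoeffs n f g) {w' w : BlownUp m n}
    (hw' : w' ∈ principal n D) (hw : w ∈ principal n D) :
    inner ℂ w' (Matrix.toEuclideanLin (bezout D b) w) =
      inner ℂ (Matrix.toEuclideanLin (bezout D b) w') w := by
  obtain ⟨g, h0⟩ := exists_frame hirr
  obtain ⟨E, hE, rfl⟩ := exists_affine_toBlown h0 hn hw
  have h0t := isUnit_transpose_comb g h0
  rw [← signed_transpose] at h0t
  obtain ⟨F, hF, hFw⟩ := exists_affine_toBlown h0t hn (conjBlown_mem hD hw')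
  rw [signed_transpose] at hF
  rw [← LinearMap.adjoint_inner_right, ← Matrix.toEuclideanLin_conjTranspose_eq_adjoint,
    conjTranspose_bezout hD, bezout_eq_tensorMat, inner_tensorMat _ _ hFw rfl,
    inner_tensorMat _ _ hFw rfl, ← sub_eq_zero]
  have := bez_eq_zero_of_trivial g h0 hn (isBezout_sub_conj b) hF hE
  rw [← this]
  simp only [bez, sub_mul, Finset.sum_sub_distrib]

variable (D) in
/-- The matrix `ξ₀ B(p₁, p₂) - ξ₁ B(p₀, p₂) + ξ₂ B(p₀, p₁)`. -/
def bezoutNet (b12 : BezoutCoeffs n (p 1) (p 2)) (b02 : BezoutCoeffs n (p 0) (p 2))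
    (b01 : BezoutCoeffs n (p 0) (p 1)) (ξ : Fin 3 → ℂ) :
    Matrix (Expo n × Fin m) (Expo n × Fin m) ℂ :=
  ξ 0 • bezout D b12 - ξ 1 • bezout D b02 + ξ 2 • bezout D b01

variable (D) in
/-- The sesquilinear form of `bezoutNet`. -/
def netForm (b12 : BezoutCoeffs n (p 1) (p 2)) (b02 : BezoutCoeffs n (p 0) (p 2))
    (b01 : BezoutCoeffs n (p 0) (p 1)) (ξ : Fin 3 → ℂ) (w' : BlownUp m n) :
    BlownUp m n →ₗ[ℂ] ℂ :=
  (innerₛₗ ℂ w').comp (Matrix.toEuclideanLin (bezoutNet D b12 b02 b01 ξ))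

variable (b12 : BezoutCoeffs n (p 1) (p 2)) (b02 : BezoutCoeffs n (p 0) (p 2))
    (b01 : BezoutCoeffs n (p 0) (p 1))

theorem netForm_eq (ξ : Fin 3 → ℂ) (w' w : BlownUp m n) :
    netForm D b12 b02 b01 ξ w' w =
      ξ 0 * inner ℂ w' (Matrix.toEuclideanLin (bezout D b12) w)
      - ξ 1 * inner ℂ w' (Matrix.toEuclideanLin (bezout D b02) w)
      + ξ 2 * inner ℂ w' (Matrix.toEuclideanLin (bezout D b01) w) := by
  simp only [netForm, LinearMap.comp_apply, innerₛₗ_apply_apply, bezoutNet, map_add, map_sub, map_smul,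
    LinearMap.add_apply, LinearMap.sub_apply, LinearMap.smul_apply, inner_add_right,
    inner_sub_right, smul_eq_mul]

theorem netForm_conj (hD : ∀ k, (D k).IsHermitian) (hirr : Irreducible (netDet (signed D)))
    (hn : 0 < n) (ξ : Fin 3 → ℂ) {w' w : BlownUp m n}
    (hw' : w' ∈ principal n D) (hw : w ∈ principal n D) :
    star (netForm D b12 b02 b01 ξ w' w) = netForm D b12 b02 b01 (star ξ) w w' := by
  rw [netForm_eq, netForm_eq, inner_bezout_comm hD hirr hn b12 hw hw',
    inner_bezout_comm hD hirr hn b02 hw hw', inner_bezout_comm hD hirr hn b01 hw hw']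
  have hs : ∀ u v : BlownUp m n, star (inner ℂ u v) = inner ℂ v u := fun u v => inner_conj_symm v u
  rw [star_add, star_sub, star_mul', star_mul', star_mul', hs, hs, hs]
  rfl

/-- The coefficients of `bezoutNet`. -/
def netCoef (ξ : Fin 3 → ℂ) : Fin 3 → Expo n → Expo n → ℂ := fun k i j =>
  ξ 0 * bezCoef b12 k i j - ξ 1 * bezCoef b02 k i j + ξ 2 * bezCoef b01 k i j

/-- The left hand side is (a × b) · (p(x) × p(y)), and the three given decompositions are the
coordinates of p(x) × p(y) up to the sign of the middle one. -/
theorem netCoef_isBezout (a b : Fin 3 → ℂ) : IsBezout (netCoef b12 b02 b01 (crossProduct a b))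
    (lin a (cmap p)) (lin b (cmap p)) := by
  intro x y
  have h12 := bezCoef_isBezout b12 x y
  have h02 := bezCoef_isBezout b02 x y
  have h01 := bezCoef_isBezout b01 x y
  have key : MvPolynomial.eval x (lin a (cmap p)) * MvPolynomial.eval y (lin b (cmap p)) -
      MvPolynomial.eval x (lin b (cmap p)) * MvPolynomial.eval y (lin a (cmap p)) =
      crossProduct a b 0 * (MvPolynomial.eval x (toPoly (p 1)) * MvPolynomial.eval y (toPoly (p 2))
        - MvPolynomial.eval x (toPoly (p 2)) * MvPolynomial.eval y (toPoly (p 1)))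
      - crossProduct a b 1 * (MvPolynomial.eval x (toPoly (p 0)) *
          MvPolynomial.eval y (toPoly (p 2))
        - MvPolynomial.eval x (toPoly (p 2)) * MvPolynomial.eval y (toPoly (p 0)))
      + crossProduct a b 2 * (MvPolynomial.eval x (toPoly (p 0)) *
          MvPolynomial.eval y (toPoly (p 1))
        - MvPolynomial.eval x (toPoly (p 1)) * MvPolynomial.eval y (toPoly (p 0))) := by
    simp only [eval_lin, dotProduct, Fin.sum_univ_three, cross_apply, cmap]
    simp
    ring
  rw [key, h12, h02, h01]
  simp only [Finset.mul_sum, ← Finset.sum_sub_distrib, ← Finset.sum_add_distrib]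
  refine Finset.sum_congr rfl fun i _ => Finset.sum_congr rfl fun j _ => ?_
  simp only [netCoef]
  ring

theorem bezoutNet_eq (ξ : Fin 3 → ℂ) :
    bezoutNet D b12 b02 b01 ξ = tensorMat (netCoef b12 b02 b01 ξ) (signed D) := by
  rw [bezoutNet, bezout_eq_tensorMat, bezout_eq_tensorMat, bezout_eq_tensorMat]
  ext is jt
  simp only [tensorMat, Matrix.add_apply, Matrix.sub_apply, Matrix.smul_apply, Matrix.of_apply,
    smul_eq_mul, Finset.mul_sum, ← Finset.sum_sub_distrib, ← Finset.sum_add_distrib, netCoef]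
  exact Finset.sum_congr rfl fun k _ => by ring

theorem netForm_eq_bez (ξ : Fin 3 → ℂ) {F E : Functional m} {w' w : BlownUp m n}
    (hF : toBlown n F = conjBlown w') (hE : toBlown n E = w) :
    netForm D b12 b02 b01 ξ w' w = bez (netCoef b12 b02 b01 ξ) (signed D) F E := by
  rw [← inner_tensorMat _ _ hF hE, ← bezoutNet_eq]
  rfl

/-- The image of the curve is not a point. -/
def IsNonconstant (D : Fin 3 → Matrix (Fin m) (Fin m) ℂ) (p : Fin 3 → MvPolynomial (Fin 3) ℝ) :
    Prop :=
  ∀ ξ : Fin 3 → ℂ, ξ ≠ 0 → ∃ x, MvPolynomial.eval x (netDet (signed D)) = 0 ∧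
    crossProduct ξ (values p x) ≠ 0

/-- The pencil of curves that pass through the fibre over `ξ` has a member that does not contain
the curve. -/
theorem exists_adapted_pair (hnc : IsNonconstant D p) {ξ : Fin 3 → ℂ} (hξ : ξ ≠ 0) :
    ∃ a b, crossProduct a b = ξ ∧ ¬ netDet (signed D) ∣ lin a (cmap p) := by
  obtain ⟨x, hx, hc⟩ := hnc ξ hξ
  obtain ⟨c, hc⟩ := exists_dotProduct_eq_one hc
  -- a = c × ξ is orthogonal to ξ, so a × b = ξ is solvable. By the triple product, a · p(x) = c ·
  -- (ξ × p(x)) = 1 at a point of the curve.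
  have h1 : crossProduct c ξ ⬝ᵥ values p x = 1 := by
    rw [← hc]
    simp only [dotProduct, Fin.sum_univ_three, cross_apply]
    simp
    ring
  obtain ⟨b, hb⟩ := exists_cross_eq (a := crossProduct c ξ) (ξ := ξ)
    (fun h => by rw [h, zero_dotProduct] at h1; exact zero_ne_one h1)
    (by rw [dotProduct_comm, dot_cross_self])
  refine ⟨_, b, hb, fun hdvd => ?_⟩
  obtain ⟨q, hq⟩ := hdvd
  have := congrArg (MvPolynomial.eval x) hq
  rw [map_mul, hx, zero_mul, eval_lin_cmap, h1] at this
  exact one_ne_zero this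

/-- Vandermonde vectors over `ξ` are in the kernel of the Bezout form at `ξ`. -/
theorem netForm_vandermonde (hD : ∀ k, (D k).IsHermitian)
    (hirr : Irreducible (netDet (signed D))) (hn : 0 < n) (hp : ∀ k, (p k).IsHomogeneous n)
    (hnc : IsNonconstant D p) {ξ : Fin 3 → ℂ} (hξ : ξ ≠ 0) {y : Fin 3 → ℂ} (hy : y ≠ 0)
    {c : ℂ} (hyξ : values p y = c • ξ) {e : Fin m → ℂ} (he : (comb (signed D) y).mulVec e = 0)
    {w' : BlownUp m n} (hw' : w' ∈ principal n D) :
    netForm D b12 b02 b01 ξ w' (vandermonde n y e) = 0 := by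
  by_cases he0 : e = 0
  · have : vandermonde n y e = 0 := by
      ext is
      change monom is.1.1 y * e is.2 = 0
      rw [he0, Pi.zero_apply, mul_zero]
    rw [this, map_zero]
  have hyΔ : MvPolynomial.eval y (netDet (signed D)) = 0 := by
    rw [eval_netDet, det_eq_zero_of_mulVec he0 he]
  obtain ⟨a, b, rfl, hdvd⟩ := exists_adapted_pair hnc hξ
  have hlin := lin_isHomogeneous a (cmap_isHomogeneous hp)
  obtain ⟨g, hg⟩ := exists_isAdapted hirr hdvd hlin
  have hyP : MvPolynomial.eval y (lin a (cmap p)) = 0 := by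
    rw [eval_lin_cmap, hyξ, dotProduct_smul, dot_self_cross, smul_zero]
  have hyQ : MvPolynomial.eval y (lin b (cmap p)) = 0 := by
    rw [eval_lin_cmap, hyξ, dotProduct_smul, dot_cross_self, smul_zero]
  have hz := hg.ne_zero y hy hyΔ hyP
  -- Normalizes y to z = 1, which is possible because no common zero lies at infinity. The
  -- Vandermonde vector changes by a power of t.
  set t := (MvPolynomial.eval y (g.form 2))⁻¹ with ht
  have ht0 : t ≠ 0 := inv_ne_zero hz
  have hz1 : MvPolynomial.eval (t • y) (g.form 2) = 1 := by
    rw [eval_smul_of_hom (g.form_isHomogeneous 2), pow_one, ht, inv_mul_cancel₀ hz]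
  have het : (comb (signed D) (t • y)).mulVec e = 0 := by
    rw [comb_smul, Matrix.smul_mulVec, he, smul_zero]
  have hyt : vandermonde n y e = (t ^ (n - 1))⁻¹ • vandermonde n (t • y) e := by
    rw [vandermonde_smul, smul_smul, inv_mul_cancel₀ (pow_ne_zero _ ht0), one_smul]
  have h0t := isUnit_transpose_comb g hg.unit
  rw [← signed_transpose] at h0t
  obtain ⟨F, hF, hFw⟩ := exists_affine_toBlown h0t hn (conjBlown_mem hD hw')
  rw [signed_transpose] at hF
  rw [hyt, map_smul, netForm_eq_bez b12 b02 b01 _ hFw (toBlown_evalFun _ _),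
    bez_eq_zero_of_eigen g hg.unit (netCoef_isBezout b12 b02 b01 a b)
      (evalFun_mem_affine g het hz1) (c := MvPolynomial.eval (t • y) (g.form 1)) ?_ ?_ ?_ hF,
    smul_zero]
  · refine LinearMap.ext fun h => ?_
    rw [act_apply, evalFun_apply, map_mul, mul_smul]
    rfl
  · rw [evalFun_apply, eval_smul_of_hom hlin, hyP, mul_zero, zero_smul]
  · rw [evalFun_apply, eval_smul_of_hom (lin_isHomogeneous b (cmap_isHomogeneous hp)), hyQ,
      mul_zero, zero_smul]

/-- If the fibre over `ξ` carries no tangent functionals, then the kernel of the Bezout form at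
`ξ` is spanned by Vandermonde vectors. -/
theorem mem_span_vandermonde (hD : ∀ k, (D k).IsHermitian)
    (hirr : Irreducible (netDet (signed D))) (hn : 0 < n) (hp : ∀ k, (p k).IsHomogeneous n)
    (hnc : IsNonconstant D p) {ξ : Fin 3 → ℂ} (hξ : ξ ≠ 0)
    (htr : ∀ y, MvPolynomial.eval y (netDet (signed D)) = 0 → (∃ c : ℂ, values p y = c • ξ) →
      ∀ (ε : Fin m → ℂ) (e : Fin 3 → Fin m → ℂ) (z : Fin 3 → ℂ),
      (comb (signed D) y).mulVec ε + ∑ k, (signed D k).mulVec (e k) = 0 →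
      (∀ k, (comb (signed D) y).mulVec (e k) = 0) → z ⬝ᵥ y ≠ 0 → ∑ k, z k • e k = 0 →
      (∀ i, ∃ c : ℂ, jac (cmap p) y (fun k => e k i) = c • ξ) → ∀ k, e k = 0)
    {w : BlownUp m n} (hw : w ∈ principal n D)
    (hker : ∀ w' ∈ principal n D, netForm D b12 b02 b01 ξ w' w = 0) :
    w ∈ Submodule.span ℂ {u | ∃ y e, y ≠ 0 ∧ MvPolynomial.eval y (netDet (signed D)) = 0 ∧
      (∃ c : ℂ, values p y = c • ξ) ∧ (comb (signed D) y).mulVec e = 0 ∧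
      u = vandermonde n y e} := by
  obtain ⟨a, b, rfl, hdvd⟩ := exists_adapted_pair hnc hξ
  obtain ⟨c, hc⟩ := exists_dotProduct_eq_one hξ
  have hlin := lin_isHomogeneous a (cmap_isHomogeneous hp)
  obtain ⟨g, hg⟩ := exists_isAdapted hirr hdvd hlin
  obtain ⟨E₀, hE₀, hE₀w⟩ := exists_affine_toBlown hg.unit hn hw
  -- The lift of w is replaced by one killed by a·p with the same first n terms, hence with the same
  -- restriction to degree n - 1.
  obtain ⟨E, hE, hPE, hEs⟩ := exists_affine_of_initial g hg.unit hlin hg.lead (seqOf g E₀)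
  have hEw : toBlown n E = w := by
    rw [← hE₀w]
    exact toBlown_eq_of_seqOf hg.unit hn hE hE₀ hEs
  have hQE : act (lin b (cmap p)) E = 0 := by
    refine act_eq_zero_of_bez g hg.unit hn hlin (netCoef_isBezout b12 b02 b01 a b)
      hg.lead_transpose hE hPE fun F hF => ?_
    have hF' : toBlown n F ∈ principal n (fun k => (D k).transpose) := by
      apply toBlown_mem_principal
      rw [signed_transpose]
      exact hF.1
    have hw' := conjBlown_mem (fun k => (hD k).transpose) hF'
    simp only [Matrix.transpose_transpose] at hw'
    rw [← netForm_eq_bez b12 b02 b01 _ (conjBlown_conjBlown _).symm hEw]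
    exact hker _ hw'
  have hmem : E ∈ commonKer (signed D) g (lin a (cmap p)) (lin b (cmap p)) := ⟨hE, hPE, hQE⟩
  have hspan := mem_span_evalFun g hg.unit hlin hg.lead (by
    intro y ε e hz hP hQ h1 h2 h3 h4 h5
    by_contra hne
    push Not at hne
    obtain ⟨k₀, hk₀⟩ := hne
    have hyΔ : MvPolynomial.eval y (netDet (signed D)) = 0 := by
      rw [eval_netDet, det_eq_zero_of_mulVec hk₀ (h2 k₀)]
    rw [eval_lin_cmap] at hP hQ
    have hdir : ∀ (b : Fin 3 → ℂ),
        ∑ k, MvPolynomial.eval y (MvPolynomial.pderiv k (lin b (cmap p))) • e k = 0 →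
        ∀ i, b ⬝ᵥ jac (cmap p) y (fun k => e k i) = 0 := by
      intro b hb i
      rw [← dirDeriv_lin, dirDeriv]
      simpa using congrFun hb i
    refine hk₀ (htr y hyΔ ⟨_, eq_smul_cross hP hQ hc⟩ ε e (g.inv 2) h1 h2 ?_ h3 (fun i => ⟨_,
      eq_smul_cross (hdir a h4 i) (hdir b h5 i) hc⟩) k₀)
    rw [g.eval_form] at hz
    rw [dotProduct, hz]
    exact one_ne_zero) hmem
  have hmap := Submodule.mem_map_of_mem (f := toBlown n) hspan
  rw [hEw, Submodule.map_span] at hmap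
  refine Submodule.span_le.2 ?_ hmap
  rintro _ ⟨_, ⟨y, e, rfl, hT⟩, rfl⟩
  by_cases he : e = 0
  · have : evalFun y e = 0 := by
      refine LinearMap.ext fun h => ?_
      rw [evalFun_apply, he, smul_zero]
      rfl
    rw [this, map_zero]
    exact Submodule.zero_mem _
  · obtain ⟨h1, h2, h3, h4⟩ := evalFun_mem_commonKer g he hT
    rw [eval_lin_cmap] at h3 h4
    refine Submodule.subset_span ⟨y, e, ?_, ?_, ⟨_, eq_smul_cross h3 h4 hc⟩, h1,
      toBlown_evalFun _ _⟩
    · rintro rfl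
      rw [g.eval_form] at h2
      simp at h2
    · rw [eval_netDet, det_eq_zero_of_mulVec he h1]

end

end CurveElim
end

noncomputable section
namespace CurveElim

/-! ### Points of the plane -/

section

variable {m n : ℕ} {D : Fin 3 → Matrix (Fin m) (Fin m) ℂ} {p : Fin 3 → MvPolynomial (Fin 3) ℝ}

theorem exists_rep_eq_smul {x : Fin 3 → ℂ} (hx : x ≠ 0) :
    ∃ c : ℂ, c ≠ 0 ∧ (Projectivization.mk ℂ x hx).rep = c • x := by
  obtain ⟨a, ha⟩ := Projectivization.exists_smul_eq_mk_rep ℂ x hx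
  exact ⟨a, a.ne_zero, ha.symm⟩

theorem mk_mem_zeroLocus {G : Poly} {d : ℕ} (hG : G.IsHomogeneous d) {x : Fin 3 → ℂ}
    (hx : x ≠ 0) : Projectivization.mk ℂ x hx ∈ zeroLocus G ↔ MvPolynomial.eval x G = 0 := by
  obtain ⟨c, hc, h⟩ := exists_rep_eq_smul hx
  change MvPolynomial.eval _ G = 0 ↔ _
  rw [h, eval_smul_of_hom hG, mul_eq_zero, or_iff_right (pow_ne_zero _ hc)]

theorem mem_curve_iff (P : Plane) :
    P ∈ curve D ↔ MvPolynomial.eval P.rep (netDet (signed D)) = 0 := by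
  rw [netDet_signed]
  rfl

theorem mk_mem_curve {x : Fin 3 → ℂ} (hx : x ≠ 0) :
    Projectivization.mk ℂ x hx ∈ curve D ↔ MvPolynomial.eval x (netDet (signed D)) = 0 := by
  rw [curve, ← netDet_signed, mk_mem_zeroLocus (netDet_isHomogeneous _)]

theorem mk_mem_image (hp : ∀ k, (p k).IsHomogeneous n) {x : Fin 3 → ℂ} (hx : x ≠ 0) :
    Projectivization.mk ℂ x hx ∈ image p (curve D) ↔
      ∃ y, y ≠ 0 ∧ MvPolynomial.eval y (netDet (signed D)) = 0 ∧
        ∃ c : ℂ, c ≠ 0 ∧ values p y = c • x := by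
  constructor
  · rintro ⟨P, hP, h, heq⟩
    rw [Projectivization.mk_eq_mk_iff'] at heq
    obtain ⟨c, hc⟩ := heq
    have hc0 : c ≠ 0 := by
      rintro rfl
      exact hx (by rw [← hc, zero_smul])
    exact ⟨P.rep, P.rep_nonzero, (mem_curve_iff P).1 hP, c⁻¹, inv_ne_zero hc0, by
      rw [← hc, smul_smul, inv_mul_cancel₀ hc0, one_smul]⟩
  · rintro ⟨y, hy, hyΔ, c, hc, hyx⟩
    obtain ⟨t, ht, hrep⟩ := exists_rep_eq_smul hy
    have hval : values p (Projectivization.mk ℂ y hy).rep = (t ^ n * c) • x := by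
      rw [hrep, values_smul hp, hyx, smul_smul]
    have htc : t ^ n * c ≠ 0 := mul_ne_zero (pow_ne_zero _ ht) hc
    refine ⟨_, (mk_mem_curve hy).2 hyΔ, by rw [hval]; exact smul_ne_zero htc hx, ?_⟩
    rw [Projectivization.mk_eq_mk_iff']
    exact ⟨(t ^ n * c)⁻¹, by rw [hval, smul_smul, inv_mul_cancel₀ htc, one_smul]⟩

/-! ### Vandermonde vectors at the base points -/

theorem vandermonde_mem_baseSpan (hp : ∀ k, (p k).IsHomogeneous n) {y : Fin 3 → ℂ} (hy : y ≠ 0)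
    (hyΔ : MvPolynomial.eval y (netDet (signed D)) = 0) (hyp : values p y = 0) {e : Fin m → ℂ}
    (he : (comb (signed D) y).mulVec e = 0) : vandermonde n y e ∈ baseSpan n D p := by
  obtain ⟨c, hc, h⟩ := exists_rep_eq_smul hy
  have h1 : vandermonde n (Projectivization.mk ℂ y hy).rep e ∈ baseSpan n D p := by
    refine Submodule.subset_span ⟨_, ⟨(mk_mem_curve hy).2 hyΔ, ?_⟩, e, ?_, rfl⟩
    · rw [h, values_smul hp, hyp, smul_zero]
    · rw [← comb_signed, h, comb_smul, Matrix.smul_mulVec, he, smul_zero]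
  rw [h, vandermonde_smul] at h1
  exact (Submodule.smul_mem_iff _ (pow_ne_zero _ hc)).1 h1

theorem baseSpan_induction {S : Submodule ℂ (BlownUp m n)}
    (h : ∀ y e, y ≠ 0 → MvPolynomial.eval y (netDet (signed D)) = 0 → values p y = 0 →
      (comb (signed D) y).mulVec e = 0 → vandermonde n y e ∈ S) : baseSpan n D p ≤ S := by
  refine Submodule.span_le.2 ?_
  rintro _ ⟨P, ⟨hP, hPp⟩, e, he, rfl⟩
  rw [← comb_signed] at he
  exact h _ _ P.rep_nonzero ((mem_curve_iff P).1 hP) hPp he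

theorem baseSpan_le_principal : baseSpan n D p ≤ principal n D :=
  baseSpan_induction fun _ _ _ _ _ he => vandermonde_mem_principal he

variable (b12 : BezoutCoeffs n (p 1) (p 2)) (b02 : BezoutCoeffs n (p 0) (p 2))
    (b01 : BezoutCoeffs n (p 0) (p 1))

theorem netForm_baseSpan (hD : ∀ k, (D k).IsHermitian)
    (hirr : Irreducible (netDet (signed D))) (hn : 0 < n) (hp : ∀ k, (p k).IsHomogeneous n)
    (hnc : IsNonconstant D p) {ξ : Fin 3 → ℂ} (hξ : ξ ≠ 0) {w' u : BlownUp m n}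
    (hw' : w' ∈ principal n D) (hu : u ∈ baseSpan n D p) :
    netForm D b12 b02 b01 ξ w' u = 0 := by
  have : baseSpan n D p ≤ LinearMap.ker (netForm D b12 b02 b01 ξ w') := by
    refine baseSpan_induction fun y e hy hyΔ hyp he => ?_
    exact netForm_vandermonde b12 b02 b01 hD hirr hn hp hnc hξ hy (c := 0)
      (by rw [hyp, zero_smul]) he hw'
  exact this hu

/-- Hermitian symmetry exchanges the arguments at the price of conjugating ξ, and the right hand
version holds for every nonzero ξ. -/
theorem netForm_baseSpan_left (hD : ∀ k, (D k).IsHermitian)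
    (hirr : Irreducible (netDet (signed D))) (hn : 0 < n) (hp : ∀ k, (p k).IsHomogeneous n)
    (hnc : IsNonconstant D p) {ξ : Fin 3 → ℂ} (hξ : ξ ≠ 0) {w u : BlownUp m n}
    (hw : w ∈ principal n D) (hu : u ∈ baseSpan n D p) :
    netForm D b12 b02 b01 ξ u w = 0 := by
  rw [← star_eq_zero, netForm_conj b12 b02 b01 hD hirr hn ξ (baseSpan_le_principal hu) hw]
  exact netForm_baseSpan b12 b02 b01 hD hirr hn hp hnc (star_ne_zero.2 hξ) hw hu

/-- Vandermonde vectors away from the base points are not in the span of those at the base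
points. -/
theorem vandermonde_notMem_baseSpan (hirr : Irreducible (netDet (signed D)))
    (hp : ∀ k, (p k).IsHomogeneous n) (hnc : IsNonconstant D p) {y : Fin 3 → ℂ} (hy : y ≠ 0)
    (hyp : values p y ≠ 0) {e : Fin m → ℂ} (he0 : e ≠ 0)
    (he : (comb (signed D) y).mulVec e = 0) : vandermonde n y e ∉ baseSpan n D p := by
  intro hmem
  have hyΔ : MvPolynomial.eval y (netDet (signed D)) = 0 := by
    rw [eval_netDet, det_eq_zero_of_mulVec he0 he]
  obtain ⟨a, b, hab, hdvd⟩ := exists_adapted_pair hnc hyp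
  have hlin := lin_isHomogeneous a (cmap_isHomogeneous hp)
  obtain ⟨g, hg⟩ := exists_isAdapted hirr hdvd hlin
  have hzy : ∀ y : Fin 3 → ℂ, y ≠ 0 → MvPolynomial.eval y (netDet (signed D)) = 0 →
      MvPolynomial.eval y (lin a (cmap p)) = 0 → ∃ t : ℂ, t ≠ 0 ∧
        MvPolynomial.eval (t • y) (g.form 2) = 1 ∧
        ∀ e, vandermonde n y e = (t ^ (n - 1))⁻¹ • toBlown (m := m) n (evalFun (t • y) e) := by
    intro y hy hyΔ hyP
    have hz := hg.ne_zero y hy hyΔ hyP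
    refine ⟨(MvPolynomial.eval y (g.form 2))⁻¹, inv_ne_zero hz, ?_, fun e => ?_⟩
    · rw [eval_smul_of_hom (g.form_isHomogeneous 2), pow_one, inv_mul_cancel₀ hz]
    · rw [toBlown_evalFun, vandermonde_smul, smul_smul,
        inv_mul_cancel₀ (pow_ne_zero _ (inv_ne_zero hz)), one_smul]
  have hP : MvPolynomial.eval y (lin a (cmap p)) = 0 := by
    rw [eval_lin_cmap, ← hab, dot_self_cross]
  obtain ⟨t, ht, htz, htv⟩ := hzy y hy hyΔ hP
  -- Evaluations at base points are killed by every p k. Restriction to degree n - 1 is injective on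
  -- affine functionals killed by a·p, so if the vector at y were in the base span, the evaluation
  -- at y would also be killed by every p k.
  let S : Submodule ℂ (Functional m) :=
    { carrier := {E | E ∈ affineFunctionals (signed D) g ∧ act (lin a (cmap p)) E = 0 ∧
        ∀ k, act (cmap p k) E = 0}
      zero_mem' := ⟨Submodule.zero_mem _, LinearMap.ext fun _ => rfl,
        fun _ => LinearMap.ext fun _ => rfl⟩
      add_mem' := by
        rintro E E' ⟨h1, h2, h3⟩ ⟨h1', h2', h3'⟩
        refine ⟨Submodule.add_mem _ h1 h1', LinearMap.ext fun h => ?_, fun k =>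
          LinearMap.ext fun h => ?_⟩
        · have e1 := LinearMap.congr_fun h2 h
          have e2 := LinearMap.congr_fun h2' h
          rw [act_apply] at e1 e2 ⊢
          rw [LinearMap.add_apply, e1, e2]
          simp
        · have e1 := LinearMap.congr_fun (h3 k) h
          have e2 := LinearMap.congr_fun (h3' k) h
          rw [act_apply] at e1 e2 ⊢
          rw [LinearMap.add_apply, e1, e2]
          simp
      smul_mem' := by
        rintro c E ⟨h1, h2, h3⟩
        refine ⟨Submodule.smul_mem _ c h1, LinearMap.ext fun h => ?_, fun k =>
          LinearMap.ext fun h => ?_⟩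
        · have e1 := LinearMap.congr_fun h2 h
          rw [act_apply] at e1 ⊢
          rw [LinearMap.smul_apply, e1]
          simp
        · have e1 := LinearMap.congr_fun (h3 k) h
          rw [act_apply] at e1 ⊢
          rw [LinearMap.smul_apply, e1]
          simp }
  have hle : baseSpan n D p ≤ S.map (toBlown n) := by
    refine baseSpan_induction fun y e hy hyΔ hyp he => ?_
    have hP0 : MvPolynomial.eval y (lin a (cmap p)) = 0 := by
      rw [eval_lin_cmap, hyp, dotProduct_zero]
    obtain ⟨t, ht, htz, htv⟩ := hzy y hy hyΔ hP0
    rw [htv]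
    refine Submodule.smul_mem _ _ (Submodule.mem_map_of_mem ⟨evalFun_mem_affine g ?_ htz, ?_, ?_⟩)
    · rw [comb_smul, Matrix.smul_mulVec, he, smul_zero]
    · refine LinearMap.ext fun h => ?_
      rw [act_apply, evalFun_apply, map_mul, eval_smul_of_hom hlin, hP0, mul_zero, zero_mul,
        zero_smul]
      rfl
    · intro k
      refine LinearMap.ext fun h => ?_
      have hk : MvPolynomial.eval y (cmap p k) = 0 :=
        (congrFun (eval_cmap p y) k).trans (congrFun hyp k)
      rw [act_apply, evalFun_apply, map_mul, eval_smul_of_hom (cmap_isHomogeneous hp k), hk,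
        mul_zero, zero_mul, zero_smul]
      rfl
  obtain ⟨E, ⟨hE, hPE, hqE⟩, hEw⟩ := hle hmem
  set T := evalFun (t • y) e with hT
  have hT' : (t ^ (n - 1))⁻¹ • T ∈ affineFunctionals (signed D) g :=
    Submodule.smul_mem _ _ (evalFun_mem_affine g
      (by rw [comb_smul, Matrix.smul_mulVec, he, smul_zero]) htz)
  have hdiff : E - (t ^ (n - 1))⁻¹ • T = 0 := by
    refine affine_eq_zero_of_act g hg.unit hlin hg.lead (Submodule.sub_mem _ hE hT') ?_
      (seqOf_eq_of_toBlown (Submodule.sub_mem _ hE hT') (by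
        rw [map_sub, hEw, map_smul, htv, sub_self]))
    refine LinearMap.ext fun h => ?_
    have e1 := LinearMap.congr_fun hPE h
    rw [act_apply] at e1 ⊢
    rw [LinearMap.sub_apply, e1, LinearMap.smul_apply, hT, evalFun_apply, map_mul,
      eval_smul_of_hom hlin, hP]
    simp
  rw [sub_eq_zero] at hdiff
  obtain ⟨k, hk⟩ := Function.ne_iff.1 hyp
  have e1 := LinearMap.congr_fun (hqE k) 1
  rw [act_apply, hdiff, LinearMap.smul_apply, hT, evalFun_apply, mul_one,
    eval_smul_of_hom (cmap_isHomogeneous hp k)] at e1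
  have e2 : MvPolynomial.eval y (cmap p k) ≠ 0 := by
    have := congrFun (eval_cmap p y) k
    rw [this]
    exact hk
  simp [ht, e2, he0] at e1

/-! ### The compressed matrices -/

/-- The orthonormal basis of the reduced space. -/
def redBasis (n : ℕ) (D : Fin 3 → Matrix (Fin m) (Fin m) ℂ) (p : Fin 3 → MvPolynomial (Fin 3) ℝ) :
    OrthonormalBasis (Fin (Module.finrank ℂ (reduced n D p))) ℂ (reduced n D p) :=
  stdOrthonormalBasis ℂ (reduced n D p)

theorem bezoutBar_apply {f g : MvPolynomial (Fin 3) ℝ} (b : BezoutCoeffs n f g)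
    (i j : Fin (Module.finrank ℂ (reduced n D p))) :
    bezoutBar D p b i j = inner ℂ (redBasis n D p i : BlownUp m n)
      (Matrix.toEuclideanLin (bezout D b) (redBasis n D p j : BlownUp m n)) := by
  have hU : ∀ j, ((redBasis n D p j : reduced n D p) : BlownUp m n) ∈ principal n D :=
    fun j => (redBasis n D p j).2.1
  rw [bezoutBar, compress, LinearMap.toMatrix_apply]
  change (redBasis n D p).toBasis.repr _ i = _
  rw [OrthonormalBasis.coe_toBasis_repr_apply, OrthonormalBasis.repr_apply_apply]
  simp only [LinearMap.comp_apply, Submodule.coe_inner, OrthonormalBasis.coe_toBasis]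
  change inner ℂ _ (((reduced n D p).orthogonalProjectionOnto (bezoutCurve D b
    (redBasis n D p j : BlownUp m n)) : reduced n D p) : BlownUp m n) = _
  rw [Submodule.coe_orthogonalProjectionOnto_apply,
    ← Submodule.inner_starProjection_left_eq_right,
    Submodule.starProjection_eq_self_iff.2 (redBasis n D p i).2, bezoutCurve]
  simp only [LinearMap.comp_apply]
  change inner ℂ _ ((principal n D).starProjection (Matrix.toEuclideanLin (bezout D b)
    ((principal n D).starProjection _))) = _
  rw [← Submodule.inner_starProjection_left_eq_right,
    Submodule.starProjection_eq_self_iff.2 (hU i), Submodule.starProjection_eq_self_iff.2 (hU j)]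

theorem bezoutBar_isHermitian (hD : ∀ k, (D k).IsHermitian)
    (hirr : Irreducible (netDet (signed D))) (hn : 0 < n) {f g : MvPolynomial (Fin 3) ℝ}
    (b : BezoutCoeffs n f g) : (bezoutBar D p b).IsHermitian := by
  ext i j
  rw [Matrix.conjTranspose_apply, bezoutBar_apply, bezoutBar_apply,
    inner_bezout_comm hD hirr hn b (redBasis n D p j).2.1 (redBasis n D p i).2.1]
  exact inner_conj_symm _ _

variable (D) in
/-- The compressed net of Bezout matrices. -/
def barNet : Fin 3 → Matrix (Fin (Module.finrank ℂ (reduced n D p)))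
    (Fin (Module.finrank ℂ (reduced n D p))) ℂ :=
  ![bezoutBar D p b12, -bezoutBar D p b02, -bezoutBar D p b01]

/-- The vector of the reduced space with given coordinates. -/
def redVec (n : ℕ) (D : Fin 3 → Matrix (Fin m) (Fin m) ℂ) (p : Fin 3 → MvPolynomial (Fin 3) ℝ)
    (x : Fin (Module.finrank ℂ (reduced n D p)) → ℂ) : BlownUp m n :=
  ∑ j, x j • (redBasis n D p j : BlownUp m n)

theorem redVec_mem (x : Fin (Module.finrank ℂ (reduced n D p)) → ℂ) :
    redVec n D p x ∈ reduced n D p :=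
  Submodule.sum_mem _ fun j _ => Submodule.smul_mem _ _ (redBasis n D p j).2

theorem exists_redVec {w : BlownUp m n} (hw : w ∈ reduced n D p) : ∃ x, redVec n D p x = w := by
  refine ⟨(redBasis n D p).repr ⟨w, hw⟩, ?_⟩
  have := congrArg Subtype.val ((redBasis n D p).sum_repr ⟨w, hw⟩)
  rw [redVec]
  refine Eq.trans ?_ this
  simp

theorem redVec_zero : redVec n D p 0 = 0 := by simp [redVec]

theorem redVec_eq_zero {x : Fin (Module.finrank ℂ (reduced n D p)) → ℂ}
    (h : redVec n D p x = 0) : x = 0 := by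
  have h1 : ∑ j, x j • redBasis n D p j = 0 := by
    apply Subtype.ext
    rw [redVec] at h
    simpa using h
  have := (redBasis n D p).toBasis.linearIndependent
  rw [Fintype.linearIndependent_iff] at this
  funext j
  exact this x (by simpa using h1) j

/-- The signs in `barNet` and `signed` combine to those of `bezoutNet`. -/
theorem barNet_mulVec (ξ : Fin 3 → ℂ) (x : Fin (Module.finrank ℂ (reduced n D p)) → ℂ)
    (i : Fin (Module.finrank ℂ (reduced n D p))) :
    (comb (signed (barNet D b12 b02 b01)) ξ).mulVec x i =
      netForm D b12 b02 b01 ξ (redBasis n D p i) (redVec n D p x) := by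
  rw [redVec, map_sum, Matrix.mulVec, dotProduct]
  refine Finset.sum_congr rfl fun j _ => ?_
  rw [map_smul, netForm_eq, ← bezoutBar_apply, ← bezoutBar_apply, ← bezoutBar_apply, comb_signed,
    pencil, barNet]
  simp only [Matrix.cons_val_zero, Matrix.cons_val_one, Matrix.cons_val, Matrix.sub_apply,
    Matrix.add_apply, Matrix.smul_apply, Matrix.neg_apply, smul_eq_mul]
  ring

/-- Orthogonality to the reduced space and to the base span implies orthogonality to the
principal subspace. -/
theorem inner_eq_zero_of_reduced {Z : BlownUp m n}
    (h1 : ∀ i, inner ℂ (redBasis n D p i : BlownUp m n) Z = 0)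
    (h2 : ∀ u ∈ baseSpan n D p, inner ℂ u Z = 0) {w' : BlownUp m n} (hw' : w' ∈ principal n D) :
    inner ℂ w' Z = 0 := by
  have hdec : w' = (baseSpan n D p).starProjection w' + (w' - (baseSpan n D p).starProjection w') := by
    abel
  have hmem : w' - (baseSpan n D p).starProjection w' ∈ reduced n D p :=
    ⟨Submodule.sub_mem _ hw' (baseSpan_le_principal (Submodule.starProjection_apply_mem _ _)),
      Submodule.sub_starProjection_mem_orthogonal _⟩
  obtain ⟨x, hx⟩ := exists_redVec hmem
  rw [hdec, inner_add_left, h2 _ (Submodule.starProjection_apply_mem _ _), zero_add, ← hx, redVec,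
    sum_inner]
  refine Finset.sum_eq_zero fun j _ => ?_
  rw [inner_smul_left, h1, mul_zero]

/-- The principal space is the orthogonal sum of the reduced space and the base span, and the base
span lies in the left kernel. Testing on the reduced space therefore loses nothing. -/
theorem barNet_mulVec_eq_zero (hD : ∀ k, (D k).IsHermitian)
    (hirr : Irreducible (netDet (signed D))) (hn : 0 < n) (hp : ∀ k, (p k).IsHomogeneous n)
    (hnc : IsNonconstant D p) {ξ : Fin 3 → ℂ} (hξ : ξ ≠ 0)
    {x : Fin (Module.finrank ℂ (reduced n D p)) → ℂ} :
    (comb (signed (barNet D b12 b02 b01)) ξ).mulVec x = 0 ↔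
      ∀ w' ∈ principal n D, netForm D b12 b02 b01 ξ w' (redVec n D p x) = 0 := by
  constructor
  · intro h w' hw'
    refine inner_eq_zero_of_reduced (p := p) (fun i => ?_) (fun u hu => ?_) hw'
    · have := congrFun h i
      rwa [barNet_mulVec] at this
    · exact netForm_baseSpan_left b12 b02 b01 hD hirr hn hp hnc hξ (redVec_mem x).1 hu
  · intro h
    funext i
    rw [barNet_mulVec, h _ (redBasis n D p i).2.1]
    rfl

theorem exists_det_eq_zero_iff (hD : ∀ k, (D k).IsHermitian)
    (hirr : Irreducible (netDet (signed D))) (hn : 0 < n) (hp : ∀ k, (p k).IsHomogeneous n)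
    (hnc : IsNonconstant D p) {ξ : Fin 3 → ℂ} (hξ : ξ ≠ 0) :
    (comb (signed (barNet D b12 b02 b01)) ξ).det = 0 ↔
      ∃ w ∈ reduced n D p, w ≠ 0 ∧ ∀ w' ∈ principal n D, netForm D b12 b02 b01 ξ w' w = 0 := by
  rw [← Matrix.exists_mulVec_eq_zero_iff]
  constructor
  · rintro ⟨x, hx, h⟩
    exact ⟨_, redVec_mem x, fun h0 => hx (redVec_eq_zero h0),
      (barNet_mulVec_eq_zero b12 b02 b01 hD hirr hn hp hnc hξ).1 h⟩
  · rintro ⟨w, hw, hw0, h⟩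
    obtain ⟨x, rfl⟩ := exists_redVec hw
    exact ⟨x, fun h0 => hw0 (by rw [h0, redVec_zero]),
      (barNet_mulVec_eq_zero b12 b02 b01 hD hirr hn hp hnc hξ).2 h⟩

/-- The reduced part of a Vandermonde vector. -/
theorem exists_reduced_part (w : BlownUp m n) (hw : w ∈ principal n D) :
    ∃ u ∈ baseSpan n D p, w - u ∈ reduced n D p :=
  ⟨_, Submodule.starProjection_apply_mem _ w,
    Submodule.sub_mem _ hw (baseSpan_le_principal (Submodule.starProjection_apply_mem _ _)),
      Submodule.sub_starProjection_mem_orthogonal _⟩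

end

end CurveElim
end

noncomputable section
namespace CurveElim

/-! ### The zero locus of the eliminant -/

section

variable {m n : ℕ} {D : Fin 3 → Matrix (Fin m) (Fin m) ℂ} {p : Fin 3 → MvPolynomial (Fin 3) ℝ}

theorem diffComb_eq (a y v : Fin 3 → ℂ) : diffComb p a y v = a ⬝ᵥ jac (cmap p) y v := by
  simp only [diffComb, dotProduct, jac_apply, dirDeriv, cmap, toPoly, MvPolynomial.pderiv_map]
  refine Finset.sum_congr rfl fun k _ => ?_
  congr 1
  refine Finset.sum_congr rfl fun l _ => ?_
  rw [← toPoly, eval_toPoly]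

theorem exists_ker {y : Fin 3 → ℂ} (hy : MvPolynomial.eval y (netDet (signed D)) = 0) :
    ∃ e, e ≠ 0 ∧ (comb (signed D) y).mulVec e = 0 := by
  rw [eval_netDet] at hy
  exact Matrix.exists_mulVec_eq_zero_iff.2 hy

theorem IsSimpleBasePoint.exists_isSimpleAt {y : Fin 3 → ℂ} (h : IsSimpleBasePoint D p y)
    (hy : MvPolynomial.eval y (netDet (signed D)) = 0) :
    ∃ a v, IsSimpleAt (signed D) (cmap p) y a v := by
  obtain ⟨a, v, ⟨u, hu⟩, hv, hmult⟩ := h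
  refine ⟨a, v, ⟨u, by rwa [← diffComb_eq]⟩, by rwa [← diffComb_eq], ?_⟩
  rw [← netDet_signed, alongLine_netDet, ← comb_signed,
    Polynomial.rootMultiplicity_eq_natTrailingDegree'] at hmult
  rw [isTangent_iff_coeff, ← hmult]
  -- If the critical coefficient vanished, the restriction to the line would be the zero polynomial,
  -- whose root multiplicity is 0 by convention, whereas the kernel has positive dimension.
  intro h0
  have h1 : detLine (comb (signed D) y) (comb (signed D) v) = 0 :=
    Polynomial.trailingCoeff_eq_zero.1 h0
  rw [h1, Polynomial.natTrailingDegree_zero] at hmult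
  exact (finrank_ker_pos (exists_ker hy)).ne hmult

theorem jac_smul_pt (hp : ∀ k, (p k).IsHomogeneous n) (s : ℂ) (y v : Fin 3 → ℂ) :
    jac (cmap p) (s • y) v = s ^ (n - 1) • jac (cmap p) y v := by
  funext k
  simp only [jac_apply, dirDeriv, Pi.smul_apply, smul_eq_mul, Finset.mul_sum]
  refine Finset.sum_congr rfl fun l _ => ?_
  rw [eval_smul_of_hom (cmap_isHomogeneous hp k).pderiv, mul_assoc]

theorem jac_self_of_values (hp : ∀ k, (p k).IsHomogeneous n) {y : Fin 3 → ℂ}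
    (hy : values p y = 0) : jac (cmap p) y y = 0 := by
  rw [jac_self (cmap_isHomogeneous hp), eval_cmap, hy, smul_zero]

/-- Every base point is simple. -/
def SimpleBase (D : Fin 3 → Matrix (Fin m) (Fin m) ℂ) (p : Fin 3 → MvPolynomial (Fin 3) ℝ) :
    Prop :=
  ∀ P ∈ basePoints p (curve D), ∃ a v, IsSimpleAt (signed D) (cmap p) P.rep a v

theorem mk_mem_basePoints (hp : ∀ k, (p k).IsHomogeneous n) {y : Fin 3 → ℂ} (hy : y ≠ 0)
    (hyΔ : MvPolynomial.eval y (netDet (signed D)) = 0) (hyp : values p y = 0) :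
    Projectivization.mk ℂ y hy ∈ basePoints p (curve D) := by
  obtain ⟨c, hc, h⟩ := exists_rep_eq_smul hy
  exact ⟨(mk_mem_curve hy).2 hyΔ, by rw [h, values_smul hp, hyp, smul_zero]⟩

/-- Tangent functionals at a base point come from tangent directions. -/
theorem SimpleBase.exists_isTangent (hb : SimpleBase D p) (hp : ∀ k, (p k).IsHomogeneous n)
    {ξ : Fin 3 → ℂ} (hξ : ξ ≠ 0) {y : Fin 3 → ℂ} (hy : y ≠ 0)
    (hyΔ : MvPolynomial.eval y (netDet (signed D)) = 0) (hyp : values p y = 0)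
    {ε : Fin m → ℂ} {e : Fin 3 → Fin m → ℂ} {z : Fin 3 → ℂ}
    (h1 : (comb (signed D) y).mulVec ε + ∑ k, (signed D k).mulVec (e k) = 0)
    (h2 : ∀ k, (comb (signed D) y).mulVec (e k) = 0) (hz : z ⬝ᵥ y ≠ 0)
    (hze : ∑ k, z k • e k = 0)
    (hJ : ∀ i, ∃ c : ℂ, jac (cmap p) y (fun k => e k i) = c • ξ) :
    (∀ k, e k = 0) ∨ ∃ P ∈ basePoints p (curve D), ∃ τ, jac (cmap p) P.rep τ = ξ ∧
      IsTangent (comb (signed D) P.rep) (comb (signed D) τ) := by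
  obtain ⟨c, hc, h⟩ := exists_rep_eq_smul hy
  have hP := mk_mem_basePoints hp hy hyΔ hyp
  set P := Projectivization.mk ℂ y hy
  obtain ⟨a, v, hav⟩ := hb P hP
  obtain ⟨a', ha', b', hb'⟩ : ∃ a', a' ≠ 0 ∧ ∃ b', crossProduct a' b' = ξ := by
    obtain ⟨w, hw⟩ : ∃ w, crossProduct ξ w ≠ 0 := by
      by_contra! h
      obtain ⟨k, hk⟩ := Function.ne_iff.1 hξ
      have e0 := h (Pi.single 0 1)
      have e1 := h (Pi.single 1 1)
      rw [cross_apply] at e0 e1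
      simp at e0 e1
      apply hξ
      funext k
      fin_cases k
      · simpa using e1.2
      · simpa using e0.2
      · simpa using e0.1
    obtain ⟨b', hb'⟩ := exists_cross_eq hw (by rw [dotProduct_comm]; exact dot_self_cross _ _)
    exact ⟨_, hw, b', hb'⟩
  have hperp : ∀ b : Fin 3 → ℂ, b ⬝ᵥ ξ = 0 →
      ∀ i, b ⬝ᵥ jac (cmap p) P.rep (fun k => e k i) = 0 := by
    intro b hb i
    obtain ⟨t, ht⟩ := hJ i
    rw [h, jac_smul_pt hp, ht, dotProduct_smul, dotProduct_smul, hb, smul_zero, smul_zero]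
  have hres := hav.exists_isTangent (exists_ker ((mem_curve_iff P).1 hP.1)) P.rep_nonzero
    (jac_self_of_values hp hP.2) (b := a') (b' := b') (by rw [hb']; exact hξ)
    (ε := c⁻¹ • ε) (e := e) (z := z) ?_ ?_ ?_ hze ?_ ?_
  · rw [hb'] at hres
    exact hres.imp_right fun ⟨τ, hτ⟩ => ⟨P, hP, τ, hτ⟩
  · rw [h, comb_smul, Matrix.smul_mulVec, Matrix.mulVec_smul, smul_smul, mul_inv_cancel₀ hc,
      one_smul, h1]
  · intro k
    rw [h, comb_smul, Matrix.smul_mulVec, h2, smul_zero]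
  · rw [h, dotProduct_smul]
    exact mul_ne_zero hc hz
  · exact hperp a' (by rw [← hb']; exact dot_self_cross _ _)
  · exact hperp b' (by rw [← hb']; exact dot_cross_self _ _)

theorem eval_aeval_cmap (G : Poly) (x : Fin 3 → ℂ) :
    MvPolynomial.eval x (MvPolynomial.aeval (cmap p) G) = MvPolynomial.eval (values p x) G := by
  rw [← eval_cmap, ← MvPolynomial.aeval_eq_eval, MvPolynomial.comp_aeval_apply,
    MvPolynomial.aeval_eq_eval]

theorem exists_values_ne_zero (hnc : IsNonconstant D p) : ∃ x,
    MvPolynomial.eval x (netDet (signed D)) = 0 ∧ values p x ≠ 0 := by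
  obtain ⟨x, hx, h⟩ := hnc (Pi.single 0 1) (by simp)
  exact ⟨x, hx, fun h0 => h (by rw [h0, map_zero])⟩

/-- Forms that vanish on the image of the curve are multiples of the equation of the curve after
substitution. -/
theorem dvd_aeval_of_image_subset (hirr : Irreducible (netDet (signed D))) (hn : 0 < n)
    (hp : ∀ k, (p k).IsHomogeneous n) (hnc : IsNonconstant D p) {G : Poly} {d : ℕ}
    (hG : G.IsHomogeneous d) (h : image p (curve D) ⊆ zeroLocus G) :
    netDet (signed D) ∣ MvPolynomial.aeval (cmap p) G := by
  have hne : ∀ x, MvPolynomial.eval x (netDet (signed D)) = 0 → values p x ≠ 0 →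
      MvPolynomial.eval (values p x) G = 0 := by
    intro x hx hxp
    have hx0 : x ≠ 0 := by
      rintro rfl
      apply hxp
      have := values_smul hp 0 0
      rwa [zero_smul, zero_pow hn.ne', zero_smul] at this
    rw [← mk_mem_zeroLocus hG hxp]
    exact h ((mk_mem_image hp hxp).2 ⟨x, hx0, hx, 1, one_ne_zero, (one_smul _ _).symm⟩)
  refine dvd_of_forall_eval_eq_zero hirr fun x hx => ?_
  rw [eval_aeval_cmap]
  -- At a common zero of the p k the value is G(0). It vanishes because G vanishes at some image
  -- point, which also covers constant G.
  by_cases hxp : values p x = 0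
  · obtain ⟨y, hy, hyp⟩ := exists_values_ne_zero hnc
    have h1 := hne y hy hyp
    have h2 := eval_smul_of_hom hG 0 (values p y)
    rw [h1, mul_zero, zero_smul] at h2
    rw [hxp, h2]
  · exact hne x hx hxp

/-- Any form G vanishing on the image has G ∘ p divisible by the equation of the curve. The
non-tangent direction at a simple base point identifies the lowest term needed for
`eval_dirDeriv_eq_zero`. -/
theorem SimpleBase.mem_zariskiClosure (hb : SimpleBase D p)
    (hirr : Irreducible (netDet (signed D))) (hn : 0 < n)
    (hp : ∀ k, (p k).IsHomogeneous n) (hnc : IsNonconstant D p) {P : Plane}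
    (hP : P ∈ basePoints p (curve D)) {τ : Fin 3 → ℂ}
    (hτ : IsTangent (comb (signed D) P.rep) (comb (signed D) τ)) {ξ : Fin 3 → ℂ} (hξ : ξ ≠ 0)
    (hJ : jac (cmap p) P.rep τ = ξ) :
    Projectivization.mk ℂ ξ hξ ∈ zariskiClosure (image p (curve D)) := by
  intro d G hG himg
  rw [mk_mem_zeroLocus hG]
  obtain ⟨a, v, hav⟩ := hb P hP
  have := eval_dirDeriv_eq_zero hG (p := cmap p) (y := P.rep) (Δ := netDet (signed D))
    (d := Module.finrank ℂ (LinearMap.ker (comb (signed D) P.rep).mulVecLin))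
    (fun k => (congrFun (eval_cmap p P.rep) k).trans (congrFun hP.2 k))
    (dvd_aeval_of_image_subset hirr hn hp hnc hG himg) ?_ ⟨v, ?_⟩ (v := τ) ?_
  · rw [← hJ]
    exact this
  · intro v i hi
    obtain ⟨q, hq⟩ := pow_dvd_detLine (comb (signed D) P.rep) (comb (signed D) v)
    rw [alongLine_netDet, hq, Polynomial.coeff_X_pow_mul', if_neg (by omega)]
  · rw [alongLine_netDet]
    exact fun h0 => hav.transversal ((isTangent_iff_coeff _ _).2 h0)
  · rw [alongLine_netDet]
    exact (isTangent_iff_coeff _ _).1 hτ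

variable (b12 : BezoutCoeffs n (p 1) (p 2)) (b02 : BezoutCoeffs n (p 0) (p 2))
    (b01 : BezoutCoeffs n (p 0) (p 1))

/-- The reduced part of a Vandermonde vector over the point is a kernel vector, and it is nonzero by
`vandermonde_notMem_baseSpan`. -/
theorem image_subset_zeroLocus (hD : ∀ k, (D k).IsHermitian)
    (hirr : Irreducible (netDet (signed D))) (hn : 0 < n) (hp : ∀ k, (p k).IsHomogeneous n)
    (hnc : IsNonconstant D p) :
    image p (curve D) ⊆ zeroLocus (netDet (signed (barNet D b12 b02 b01))) := by
  intro P hP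
  have hξ := P.rep_nonzero
  rw [← P.mk_rep] at hP
  obtain ⟨y, hy, hyΔ, c, hc, hyξ⟩ := (mk_mem_image hp hξ).1 hP
  obtain ⟨e, he0, he⟩ := exists_ker hyΔ
  have hmem := vandermonde_mem_principal (n := n) he
  obtain ⟨u, hu, hred⟩ := exists_reduced_part (p := p) _ hmem
  change MvPolynomial.eval P.rep _ = 0
  rw [eval_netDet, exists_det_eq_zero_iff b12 b02 b01 hD hirr hn hp hnc hξ]
  refine ⟨_, hred, fun h0 => ?_, fun w' hw' => ?_⟩
  · rw [sub_eq_zero] at h0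
    refine vandermonde_notMem_baseSpan hirr hp hnc hy ?_ he0 he (h0 ▸ hu)
    rw [hyξ]
    exact smul_ne_zero hc hξ
  · rw [map_sub, netForm_vandermonde b12 b02 b01 hD hirr hn hp hnc hξ hy hyξ he hw',
      netForm_baseSpan b12 b02 b01 hD hirr hn hp hnc hξ hw' hu, sub_zero]

theorem eq_zero_of_mem_reduced {w : BlownUp m n} (h1 : w ∈ reduced n D p)
    (h2 : w ∈ baseSpan n D p) : w = 0 := by
  have := Submodule.inner_right_of_mem_orthogonal h2 h1.2
  exact inner_self_eq_zero.1 this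

/-- Over a point outside the closure there are only base points, and none of them carries a second
order functional. So the kernel lies in the base span, to which the reduced space is orthogonal. -/
theorem zeroLocus_subset_closure (hD : ∀ k, (D k).IsHermitian)
    (hirr : Irreducible (netDet (signed D))) (hn : 0 < n) (hp : ∀ k, (p k).IsHomogeneous n)
    (hnc : IsNonconstant D p) (hb : SimpleBase D p) {P : Plane}
    (hP : P ∈ zeroLocus (netDet (signed (barNet D b12 b02 b01)))) :
    P ∈ zariskiClosure (image p (curve D)) := by
  by_contra hcl
  have hξ := P.rep_nonzero
  have himg : ∀ y, y ≠ 0 → MvPolynomial.eval y (netDet (signed D)) = 0 →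
      (∃ c : ℂ, values p y = c • P.rep) → values p y = 0 := by
    rintro y hy hyΔ ⟨c, hc⟩
    by_cases hc0 : c = 0
    · rw [hc, hc0, zero_smul]
    · exact absurd (fun d G _ hG => hG (by
        rw [← P.mk_rep]
        exact (mk_mem_image hp hξ).2 ⟨y, hy, hyΔ, c, hc0, hc⟩)) hcl
  change MvPolynomial.eval P.rep _ = 0 at hP
  rw [eval_netDet, exists_det_eq_zero_iff b12 b02 b01 hD hirr hn hp hnc hξ] at hP
  obtain ⟨w, hw, hw0, hker⟩ := hP
  refine hw0 (eq_zero_of_mem_reduced hw ?_)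
  have hspan := mem_span_vandermonde b12 b02 b01 hD hirr hn hp hnc hξ (by
    intro y hyΔ hyc ε e z h1 h2 hz hze hJ
    have hy : y ≠ 0 := by
      rintro rfl
      rw [dotProduct_zero] at hz
      exact hz rfl
    rcases hb.exists_isTangent hp hξ hy hyΔ (himg y hy hyΔ hyc) h1 h2 hz hze hJ with h | h
    · exact h
    · obtain ⟨Q, hQ, τ, hτ, hτt⟩ := h
      refine absurd ?_ hcl
      rw [← P.mk_rep]
      exact hb.mem_zariskiClosure hirr hn hp hnc hQ hτt hξ hτ) hw.1 hker
  refine Submodule.span_le.2 ?_ hspan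
  rintro _ ⟨y, e, hy, hyΔ, hyc, he, rfl⟩
  exact vandermonde_mem_baseSpan hp hy hyΔ (himg y hy hyΔ hyc) he

theorem zeroLocus_eq_closure (hD : ∀ k, (D k).IsHermitian)
    (hirr : Irreducible (netDet (signed D))) (hn : 0 < n) (hp : ∀ k, (p k).IsHomogeneous n)
    (hnc : IsNonconstant D p) (hb : SimpleBase D p) :
    zeroLocus (netDet (signed (barNet D b12 b02 b01))) =
      zariskiClosure (image p (curve D)) :=
  Set.Subset.antisymm (fun _ hP => zeroLocus_subset_closure b12 b02 b01 hD hirr hn hp hnc hb hP)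
    fun _ hP => hP _ _ (netDet_isHomogeneous _)
      (image_subset_zeroLocus b12 b02 b01 hD hirr hn hp hnc)

theorem zeroLocus_eq_image (hD : ∀ k, (D k).IsHermitian)
    (hirr : Irreducible (netDet (signed D))) (hn : 0 < n) (hp : ∀ k, (p k).IsHomogeneous n)
    (hnc : IsNonconstant D p) (hb : basePoints p (curve D) = ∅) :
    zeroLocus (netDet (signed (barNet D b12 b02 b01))) = image p (curve D) := by
  refine Set.Subset.antisymm (fun P hP => ?_)
    (image_subset_zeroLocus b12 b02 b01 hD hirr hn hp hnc)
  by_contra himg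
  have hξ := P.rep_nonzero
  have hno : ∀ y, y ≠ 0 → MvPolynomial.eval y (netDet (signed D)) = 0 →
      ¬ ∃ c : ℂ, values p y = c • P.rep := by
    rintro y hy hyΔ ⟨c, hc⟩
    by_cases hc0 : c = 0
    · have := mk_mem_basePoints hp hy hyΔ (by rw [hc, hc0, zero_smul])
      rw [hb] at this
      exact this
    · apply himg
      rw [← P.mk_rep]
      exact (mk_mem_image hp hξ).2 ⟨y, hy, hyΔ, c, hc0, hc⟩
  change MvPolynomial.eval P.rep _ = 0 at hP
  rw [eval_netDet, exists_det_eq_zero_iff b12 b02 b01 hD hirr hn hp hnc hξ] at hP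
  obtain ⟨w, hw, hw0, hker⟩ := hP
  have hspan := mem_span_vandermonde b12 b02 b01 hD hirr hn hp hnc hξ (by
    intro y hyΔ hyc ε e z h1 h2 hz hze hJ
    refine absurd hyc (hno y ?_ hyΔ)
    rintro rfl
    rw [dotProduct_zero] at hz
    exact hz rfl) hw.1 hker
  refine hw0 ((Submodule.mem_bot ℂ).1 (Submodule.span_le.2 ?_ hspan))
  rintro _ ⟨y, e, hy, hyΔ, hyc, he, rfl⟩
  exact absurd hyc (hno y hy hyΔ)

end

end CurveElim
end

noncomputable section
namespace CurveElim

/-! ### Finiteness of intersections -/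

theorem finite_eigenvalues {V : Type*} [AddCommGroup V] [Module ℂ V] [FiniteDimensional ℂ V]
    (T : Module.End ℂ V) : {c : ℂ | ∃ v, v ≠ 0 ∧ T v = c • v}.Finite := by
  refine (Module.End.finite_hasEigenvalue T).subset ?_
  rintro c ⟨v, hv, h⟩
  exact Module.End.hasEigenvalue_of_hasEigenvector (x := v)
    ⟨Module.End.mem_eigenspace_iff.2 h, hv⟩

section

variable {m n : ℕ} {A : Fin 3 → Matrix (Fin m) (Fin m) ℂ}

/-- A form that is not a multiple of the equation of an irreducible curve has finitely many
zeros on the curve. -/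
theorem finite_zeros (hΔ : Irreducible (netDet A)) {P : Poly} (hP : ¬ netDet A ∣ P)
    (hPn : P.IsHomogeneous n) :
    {Q : Plane | MvPolynomial.eval Q.rep (netDet A) = 0 ∧ MvPolynomial.eval Q.rep P = 0}.Finite := by
  obtain ⟨g, hg⟩ := exists_isAdapted hΔ hP hPn
  have hfin := commonKer_finite g hg.unit (Q := P) hPn hg.lead
  -- In the chart z = 1 the coordinates of a common zero are eigenvalues of the coordinate operators
  -- on a finite dimensional space, with an evaluation as eigenvector.
  have hT : {y : Fin 3 → ℂ | ∀ l, y l ∈ {c : ℂ | ∃ v, v ≠ 0 ∧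
      coordOp A g P P l v = c • v}}.Finite :=
    Set.Finite.pi' fun l : Fin 3 => finite_eigenvalues (V := commonKer A g P P)
      (coordOp A g P P l)
  refine Set.Finite.of_injOn (f := fun Q : Plane => (MvPolynomial.eval Q.rep (g.form 2))⁻¹ • Q.rep)
    ?_ ?_ hT
  · rintro Q ⟨hQ, hQP⟩ l
    have hz := hg.ne_zero _ Q.rep_nonzero hQ hQP
    set t := (MvPolynomial.eval Q.rep (g.form 2))⁻¹ with ht
    set y := t • Q.rep with hy
    have hz1 : MvPolynomial.eval y (g.form 2) = 1 := by
      rw [hy, eval_smul_of_hom (g.form_isHomogeneous 2), pow_one, ht, inv_mul_cancel₀ hz]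
    have hyP : MvPolynomial.eval y P = 0 := by rw [hy, eval_smul_of_hom hPn, hQP, mul_zero]
    obtain ⟨e, he0, he⟩ : ∃ e, e ≠ 0 ∧ (comb A y).mulVec e = 0 := by
      apply Matrix.exists_mulVec_eq_zero_iff.2
      rw [← eval_netDet, hy, eval_smul_of_hom (netDet_isHomogeneous A), hQ, mul_zero]
    have hact : act P (evalFun y e) = 0 := by
      refine LinearMap.ext fun h => ?_
      rw [act_apply, evalFun_apply, map_mul, hyP, zero_mul, zero_smul]
      rfl
    have hmem : evalFun y e ∈ commonKer A g P P := ⟨evalFun_mem_affine g he hz1, hact, hact⟩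
    refine ⟨⟨evalFun y e, hmem⟩, fun h0 => he0 ?_, ?_⟩
    · have h1 := LinearMap.congr_fun (congrArg Subtype.val h0) 1
      simpa using h1
    · apply Subtype.ext
      refine LinearMap.ext fun h => ?_
      change act (MvPolynomial.X l) (evalFun y e) h = y l • evalFun y e h
      rw [act_apply, evalFun_apply, evalFun_apply, map_mul, MvPolynomial.eval_X, mul_smul]
  · rintro Q ⟨hQ, hQP⟩ Q' ⟨hQ', hQP'⟩ heq
    have hz := hg.ne_zero _ Q.rep_nonzero hQ hQP
    have hz' := hg.ne_zero _ Q'.rep_nonzero hQ' hQP'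
    simp only at heq
    rw [← Q.mk_rep, ← Q'.mk_rep, Projectivization.mk_eq_mk_iff']
    refine ⟨MvPolynomial.eval Q.rep (g.form 2) * (MvPolynomial.eval Q'.rep (g.form 2))⁻¹, ?_⟩
    rw [mul_smul, ← heq, smul_smul, mul_inv_cancel₀ hz, one_smul]

theorem degree_pos_of_irreducible (hΔ : Irreducible (netDet A)) : m ≠ 0 := by
  rintro rfl
  exact hΔ.not_isUnit (by rw [netDet, Matrix.det_isEmpty]; exact isUnit_one)

/-- Every line in the direction of a point off the curve meets the curve, and the lines through pt 1
+ s pt 2 yield different points for different s. -/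
theorem infinite_curve (hΔ : Irreducible (netDet A)) :
    {Q : Plane | MvPolynomial.eval Q.rep (netDet A) = 0}.Infinite := by
  obtain ⟨g, hg⟩ := exists_isAdapted hΔ (P := 1)
    (fun h => hΔ.not_isUnit (isUnit_of_dvd_one h)) (MvPolynomial.isHomogeneous_one _ _)
  have hex : ∀ s : ℂ, ∃ α : ℂ,
      MvPolynomial.eval ((g.pt 1 + s • g.pt 2) + α • g.pt 0) (netDet A) = 0 := by
    intro s
    obtain ⟨h1, h2⟩ := alongLine_top (netDet_isHomogeneous A) (g.pt 1 + s • g.pt 2) (g.pt 0)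
    rw [eval_netDet] at h2
    have h3 : (alongLine (netDet A) (g.pt 1 + s • g.pt 2) (g.pt 0)).coeff m ≠ 0 := by
      rw [h2]
      exact hg.unit.ne_zero
    obtain ⟨α, hα⟩ := IsAlgClosed.exists_root
      (alongLine (netDet A) (g.pt 1 + s • g.pt 2) (g.pt 0)) (by
        intro h0
        have h4 := Polynomial.le_degree_of_ne_zero h3
        rw [h0] at h4
        exact degree_pos_of_irreducible hΔ (by exact_mod_cast Nat.le_zero.1 (by exact_mod_cast h4)))
    exact ⟨α, by rw [← eval_alongLine]; exact hα⟩
  choose α hα using hex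
  set f : ℂ → Fin 3 → ℂ := fun s => (g.pt 1 + s • g.pt 2) + α s • g.pt 0 with hf
  have hform : ∀ s i, MvPolynomial.eval (f s) (g.form i) =
      (if i = 1 then 1 else 0) + s * (if i = 2 then 1 else 0) +
        α s * (if i = 0 then 1 else 0) := by
    intro s i
    rw [← g.eval_form_pt i 1, ← g.eval_form_pt i 2, ← g.eval_form_pt i 0]
    simp only [g.eval_form, hf, Pi.add_apply, Pi.smul_apply, smul_eq_mul, Finset.mul_sum,
      ← Finset.sum_add_distrib]
    exact Finset.sum_congr rfl fun k _ => by ring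
  have hne : ∀ s, f s ≠ 0 := by
    intro s h0
    have h1 := hform s 1
    rw [h0, g.eval_form] at h1
    simp at h1
  refine Set.infinite_of_injective_forall_mem (f := fun s : ℂ => Projectivization.mk ℂ (f s) (hne s))
    ?_ ?_
  · intro s s' h
    rw [Projectivization.mk_eq_mk_iff'] at h
    obtain ⟨c, hc⟩ := h
    have h1 := hform s 1
    have h2 := hform s 2
    rw [← hc, eval_smul_of_hom (g.form_isHomogeneous _), hform] at h1 h2
    simp at h1 h2
    rw [h1, one_mul] at h2
    exact h2.symm
  · intro s
    exact (mk_mem_zeroLocus (netDet_isHomogeneous A) (hne s)).2 (hα s)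

/-- For degree reasons a divisible partial derivative is zero, and if all were zero Euler's relation
would annihilate the determinant. -/
theorem exists_pderiv_not_dvd (hΔ : Irreducible (netDet A)) :
    ∃ l, ¬ netDet A ∣ MvPolynomial.pderiv l (netDet A) := by
  by_contra! h
  have hm := degree_pos_of_irreducible hΔ
  have h0 : ∀ l, MvPolynomial.pderiv l (netDet A) = 0 := by
    intro l
    by_contra hne
    obtain ⟨q, hq⟩ := h l
    have hq0 : q ≠ 0 := by
      rintro rfl
      exact hne (by rw [hq, mul_zero])
    have h1 := (netDet_isHomogeneous A).pderiv (i := l)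
    have h2 := h1.totalDegree hne
    rw [hq, MvPolynomial.totalDegree_mul_of_isDomain hΔ.ne_zero hq0,
      (netDet_isHomogeneous A).totalDegree hΔ.ne_zero] at h2
    omega
  apply hΔ.ne_zero
  refine MvPolynomial.funext fun x => ?_
  have h1 := dirDeriv_self (netDet_isHomogeneous A) x
  simp only [dirDeriv, h0, map_zero, zero_mul, Finset.sum_const_zero] at h1
  rw [map_zero]
  exact (mul_eq_zero.1 h1.symm).resolve_left (by exact_mod_cast hm)

theorem finite_singular (hΔ : Irreducible (netDet A)) :
    {Q : Plane | MvPolynomial.eval Q.rep (netDet A) = 0 ∧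
      ∀ v, dirDeriv (netDet A) Q.rep v = 0}.Finite := by
  obtain ⟨l, hl⟩ := exists_pderiv_not_dvd hΔ
  refine (finite_zeros hΔ hl (netDet_isHomogeneous A).pderiv).subset ?_
  rintro Q ⟨hQ, hv⟩
  refine ⟨hQ, ?_⟩
  have := hv (Pi.single l 1)
  rw [dirDeriv, Finset.sum_eq_single l] at this
  · simpa using this
  · intro b _ hb
    simp [hb]
  · simp

end

/-! ### Local parametrizations -/

theorem hasDerivAt_eval {γ : ℂ → Fin 3 → ℂ} {γ' : Fin 3 → ℂ} {t : ℂ}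
    (h : ∀ k, HasDerivAt (fun s => γ s k) (γ' k) t) (G : Poly) :
    HasDerivAt (fun s => MvPolynomial.eval (γ s) G) (dirDeriv G (γ t) γ') t := by
  induction G using MvPolynomial.induction_on with
  | C a =>
    simp only [MvPolynomial.eval_C, dirDeriv_C]
    exact hasDerivAt_const _ _
  | add p q hp hq =>
    simp only [map_add, dirDeriv_add]
    exact hp.add hq
  | mul_X p l hp =>
    simp only [map_mul, MvPolynomial.eval_X, dirDeriv_mul, dirDeriv_X]
    exact hp.mul (h l)

theorem contDiff_eval {E : Type*} [NormedAddCommGroup E] [NormedSpace ℂ E] {f : E → Fin 3 → ℂ}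
    (h : ∀ k, ContDiff ℂ 1 (fun s => f s k)) (G : Poly) :
    ContDiff ℂ 1 (fun s => MvPolynomial.eval (f s) G) := by
  induction G using MvPolynomial.induction_on with
  | C a =>
    simp only [MvPolynomial.eval_C]
    exact contDiff_const
  | add p q hp hq =>
    simp only [map_add]
    exact hp.add hq
  | mul_X p l hp =>
    simp only [map_mul, MvPolynomial.eval_X]
    exact hp.mul (h l)

/-- The zero set of a polynomial is locally a graph at a point where its differential does not
vanish. -/
theorem exists_parametrization {Δ : Poly} {y v : Fin 3 → ℂ} (w : Fin 3 → ℂ)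
    (hy : MvPolynomial.eval y Δ = 0) (hv : dirDeriv Δ y v ≠ 0) :
    ∃ ψ : ℂ → ℂ, ψ 0 = 0 ∧ ∀ᶠ t in nhds (0 : ℂ), DifferentiableAt ℂ ψ t ∧
      MvPolynomial.eval (y + t • w + ψ t • v) Δ = 0 := by
  set f : ℂ × ℂ → ℂ := fun x => MvPolynomial.eval (y + x.1 • w + x.2 • v) Δ with hf
  have hcd : ContDiff ℂ 1 f := by
    refine contDiff_eval (fun k => ?_) Δ
    simp only [Pi.add_apply, Pi.smul_apply, smul_eq_mul]
    fun_prop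
  have hcda : ContDiffAt ℂ 1 f (0, 0) := hcd.contDiffAt
  have hf0 : f (0, 0) = 0 := by simp [hf, hy]
  have hpart : (fderiv ℂ f (0, 0) ∘L .inr ℂ ℂ ℂ) =
      (ContinuousLinearEquiv.unitsEquivAut ℂ (Units.mk0 _ hv) : ℂ →L[ℂ] ℂ) := by
    have h1 : HasDerivAt (fun s : ℂ => f (0, s)) (dirDeriv Δ y v) 0 := by
      have := hasDerivAt_eval (γ := fun s : ℂ => y + (0 : ℂ) • w + s • v) (γ' := v) (t := 0)
        (fun k => by
          simp only [Pi.add_apply, Pi.smul_apply, smul_eq_mul]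
          simpa using ((hasDerivAt_id (0 : ℂ)).mul_const (v k)).const_add (y k + 0 * w k)) Δ
      simpa [hf] using this
    have h2 : HasDerivAt (fun s : ℂ => f (0, s)) (fderiv ℂ f (0, 0) (0, 1)) 0 := by
      have h3 := (hcda.differentiableAt one_ne_zero).hasFDerivAt
      exact h3.comp_hasDerivAt (0 : ℂ) ((hasDerivAt_const (0 : ℂ) (0 : ℂ)).prodMk (hasDerivAt_id 0))
    ext
    simp [h2.unique h1]
  have hinv : (fderiv ℂ f (0, 0) ∘L .inr ℂ ℂ ℂ).IsInvertible := ⟨_, hpart.symm⟩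
  refine ⟨hcda.implicitFunction one_ne_zero hinv,
    hcda.implicitFunction_apply_self one_ne_zero hinv, ?_⟩
  have h1 := hcda.eventually_apply_implicitFunction one_ne_zero hinv
  have h2 := (hcda.contDiffAt_implicitFunction one_ne_zero hinv).eventually (by simp)
  filter_upwards [h1, h2] with t ht ht'
  exact ⟨ht'.differentiableAt one_ne_zero, ht.trans hf0⟩

end CurveElim
end

noncomputable section
namespace CurveElim

/-! ### Generic points of the curve -/

section

variable {m n : ℕ} {D : Fin 3 → Matrix (Fin m) (Fin m) ℂ} {p : Fin 3 → MvPolynomial (Fin 3) ℝ}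

theorem finite_fibre (hirr : Irreducible (netDet (signed D))) (hp : ∀ k, (p k).IsHomogeneous n)
    (hnc : IsNonconstant D p) {ξ : Fin 3 → ℂ} (hξ : ξ ≠ 0) :
    {Q : Plane | MvPolynomial.eval Q.rep (netDet (signed D)) = 0 ∧
      ∃ c : ℂ, values p Q.rep = c • ξ}.Finite := by
  obtain ⟨a, b, hab, hdvd⟩ := exists_adapted_pair hnc hξ
  refine (finite_zeros hirr hdvd (lin_isHomogeneous a (cmap_isHomogeneous hp))).subset ?_
  rintro Q ⟨hQ, c, hc⟩
  exact ⟨hQ, by rw [eval_lin_cmap, hc, ← hab, dotProduct_smul, dot_self_cross, smul_zero]⟩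

theorem dirDeriv_smul_pt {G : Poly} {d : ℕ} (hG : G.IsHomogeneous d) (s : ℂ) (y v : Fin 3 → ℂ) :
    dirDeriv G (s • y) v = s ^ (d - 1) * dirDeriv G y v := by
  simp only [dirDeriv, Finset.mul_sum]
  refine Finset.sum_congr rfl fun l _ => ?_
  rw [eval_smul_of_hom hG.pderiv, mul_assoc]

theorem dirDeriv_eq_dotProduct (G : Poly) (y : Fin 3 → ℂ) :
    ∃ l : Fin 3 → ℂ, ∀ v, dirDeriv G y v = l ⬝ᵥ v := ⟨_, fun _ => rfl⟩

/-- The map is immersive at a smooth point `y` of the curve. -/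
structure IsImmersiveAt (D : Fin 3 → Matrix (Fin m) (Fin m) ℂ)
    (p : Fin 3 → MvPolynomial (Fin 3) ℝ) (y : Fin 3 → ℂ) : Prop where
  mem : MvPolynomial.eval y (netDet (signed D)) = 0
  values_ne : values p y ≠ 0
  smooth : ∃ v, dirDeriv (netDet (signed D)) y v ≠ 0
  immersive : ∀ τ, dirDeriv (netDet (signed D)) y τ = 0 →
    (∃ c : ℂ, jac (cmap p) y τ = c • values p y) → ∃ c : ℂ, τ = c • y

/-- The tangent plane is spanned by y and one bad direction, and by Euler the differential maps y
itself to n p(y). -/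
theorem jac_tangent_of_not_immersive (hp : ∀ k, (p k).IsHomogeneous n)
    {y : Fin 3 → ℂ} (hy : y ≠ 0) (hyΔ : MvPolynomial.eval y (netDet (signed D)) = 0)
    (hyp : values p y ≠ 0) (hv : ∃ v, dirDeriv (netDet (signed D)) y v ≠ 0)
    (hni : ¬ IsImmersiveAt D p y) {τ : Fin 3 → ℂ} (hτ : dirDeriv (netDet (signed D)) y τ = 0) :
    ∃ c : ℂ, jac (cmap p) y τ = c • values p y := by
  have : ∃ τ', dirDeriv (netDet (signed D)) y τ' = 0 ∧
      (∃ c : ℂ, jac (cmap p) y τ' = c • values p y) ∧ ¬ ∃ c : ℂ, τ' = c • y := by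
    by_contra! h
    exact hni ⟨hyΔ, hyp, hv, h⟩
  obtain ⟨τ', h1, ⟨c, hc⟩, h3⟩ := this
  obtain ⟨l, hl⟩ := dirDeriv_eq_dotProduct (netDet (signed D)) y
  have hl0 : l ≠ 0 := by
    rintro rfl
    obtain ⟨v, hv⟩ := hv
    exact hv (by rw [hl, zero_dotProduct])
  have hly : l ⬝ᵥ y = 0 := by
    rw [← hl, dirDeriv_self (netDet_isHomogeneous _), hyΔ, mul_zero]
  obtain ⟨α, β, hαβ⟩ := exists_coords hl0 hly (by rw [← hl, h1])
    (fun h0 => h3 (exists_smul_of_cross_eq_zero hy h0))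
  have h4 := hαβ τ (by rw [← hl, hτ])
  refine ⟨(α ⬝ᵥ τ) * n + (β ⬝ᵥ τ) * c, ?_⟩
  rw [h4, map_add, map_smul, map_smul, jac_self (cmap_isHomogeneous hp), eval_cmap, hc, smul_smul,
    smul_smul, ← add_smul, ← h4]

theorem IsImmersiveAt.smul (hp : ∀ k, (p k).IsHomogeneous n) {y : Fin 3 → ℂ} {s : ℂ}
    (hs : s ≠ 0) (h : IsImmersiveAt D p y) : IsImmersiveAt D p (s • y) := by
  refine ⟨?_, ?_, ?_, ?_⟩
  · rw [eval_smul_of_hom (netDet_isHomogeneous _), h.mem, mul_zero]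
  · rw [values_smul hp]
    exact smul_ne_zero (pow_ne_zero _ hs) h.values_ne
  · obtain ⟨v, hv⟩ := h.smooth
    exact ⟨v, by
      rw [dirDeriv_smul_pt (netDet_isHomogeneous _)]
      exact mul_ne_zero (pow_ne_zero _ hs) hv⟩
  · rintro τ h1 ⟨c, hc⟩
    rw [dirDeriv_smul_pt (netDet_isHomogeneous _), mul_eq_zero,
      or_iff_right (pow_ne_zero _ hs)] at h1
    rw [jac_smul_pt hp, values_smul hp, smul_smul] at hc
    obtain ⟨c', hc'⟩ := h.immersive τ h1 ⟨(s ^ (n - 1))⁻¹ * (c * s ^ n), by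
      rw [mul_smul, ← hc, smul_smul, inv_mul_cancel₀ (pow_ne_zero _ hs), one_smul]⟩
    exact ⟨c' * s⁻¹, by rw [smul_smul, mul_assoc, inv_mul_cancel₀ hs, mul_one, hc']⟩

/-- The map is immersive at a generic point of the curve. -/
theorem exists_isImmersiveAt (hirr : Irreducible (netDet (signed D)))
    (hp : ∀ k, (p k).IsHomogeneous n) (hnc : IsNonconstant D p) {E : Set Plane} (hE : E.Finite) :
    ∃ P : Plane, P ∉ E ∧ IsImmersiveAt D p P.rep := by
  by_contra! hbad
  set Δ := netDet (signed D) with hΔ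
  have hΔh := netDet_isHomogeneous (signed D)
  have hbad' : ∀ y (hy : y ≠ 0), Projectivization.mk ℂ y hy ∉ E → ¬ IsImmersiveAt D p y := by
    intro y hy hyE h
    obtain ⟨c, hc, hrep⟩ := exists_rep_eq_smul hy
    exact hbad _ hyE (by rw [hrep]; exact h.smul hp hc)
  obtain ⟨y₀, hy₀, hy₀E, hy₀Δ, hy₀p, v, hv⟩ : ∃ y₀, ∃ hy : y₀ ≠ 0,
      Projectivization.mk ℂ y₀ hy ∉ E ∧ MvPolynomial.eval y₀ Δ = 0 ∧ values p y₀ ≠ 0 ∧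
        ∃ v, dirDeriv Δ y₀ v ≠ 0 := by
    have hfin := (hE.union (finite_singular hirr)).union
      (finite_fibre hirr hp hnc (ξ := Pi.single 0 1) (by simp))
    obtain ⟨Q, hQ, hQE⟩ := (infinite_curve hirr).exists_notMem_finite hfin
    simp only [Set.mem_union, not_or, Set.mem_ofPred_eq, not_and] at hQE
    refine ⟨Q.rep, Q.rep_nonzero, by rw [Q.mk_rep]; exact hQE.1.1, hQ, fun h0 => hQE.2 hQ
      ⟨0, by rw [h0, zero_smul]⟩, ?_⟩
    have := hQE.1.2 hQ
    push Not at this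
    exact this
  obtain ⟨l, hl⟩ := dirDeriv_eq_dotProduct Δ y₀
  -- With y₀ × w equal to the gradient, y₀ and w span the tangent plane and v is transversal to it.
  -- The arc γ is a graph over the direction w.
  obtain ⟨w, hw⟩ := exists_cross_eq hy₀ (ξ := l) (by
    rw [dotProduct_comm, ← hl, dirDeriv_self hΔh, hy₀Δ, mul_zero])
  obtain ⟨ψ, hψ0, hψ⟩ := exists_parametrization w hy₀Δ hv
  set γ : ℂ → Fin 3 → ℂ := fun t => y₀ + t • w + ψ t • v with hγ
  have hγ0 : γ 0 = y₀ := by simp [hγ, hψ0]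
  obtain ⟨k, hk⟩ := Function.ne_iff.1 hy₀p
  -- the coordinates of the curve in the basis `y₀, w, v`
  have hlv : l ⬝ᵥ v ≠ 0 := by rwa [← hl]
  have hc0 : ∀ t, crossProduct w v ⬝ᵥ γ t = l ⬝ᵥ v := by
    intro t
    rw [← hw]
    simp only [hγ, dotProduct, Fin.sum_univ_three, cross_apply, Pi.add_apply, Pi.smul_apply,
      smul_eq_mul]
    simp
    ring
  have hc1 : ∀ t, crossProduct v y₀ ⬝ᵥ γ t = t * (l ⬝ᵥ v) := by
    intro t
    rw [← hw]
    simp only [hγ, dotProduct, Fin.sum_univ_three, cross_apply, Pi.add_apply, Pi.smul_apply,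
      smul_eq_mul]
    simp
    ring
  have hγne : ∀ t, γ t ≠ 0 := by
    intro t h0
    have := hc0 t
    rw [h0, dotProduct_zero] at this
    exact hlv this.symm
  have hinj : Function.Injective fun t => Projectivization.mk ℂ (γ t) (hγne t) := by
    intro t t' h
    rw [Projectivization.mk_eq_mk_iff'] at h
    obtain ⟨c, hc⟩ := h
    have h1 := hc0 t
    have h2 := hc1 t
    rw [← hc, dotProduct_smul, hc0, smul_eq_mul] at h1
    have hc1' : c = 1 := mul_right_cancel₀ hlv (by rw [h1, one_mul])
    rw [← hc, dotProduct_smul, hc1, smul_eq_mul, hc1', one_mul] at h2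
    exact (mul_right_cancel₀ hlv h2).symm
  have hEev : ∀ᶠ t in nhds (0 : ℂ), Projectivization.mk ℂ (γ t) (hγne t) ∉ E := by
    have hfin : ((fun t => Projectivization.mk ℂ (γ t) (hγne t)) ⁻¹' E).Finite :=
      hE.preimage hinj.injOn
    refine hfin.isClosed.isOpen_compl.mem_nhds ?_
    intro h0
    apply hy₀E
    have : Projectivization.mk ℂ y₀ hy₀ = Projectivization.mk ℂ (γ 0) (hγne 0) := by
      congr 1
      exact hγ0.symm
    rw [this]
    exact h0
  have hγd : ∀ t, DifferentiableAt ℂ ψ t →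
      ∀ i, HasDerivAt (fun s => γ s i) ((w + deriv ψ t • v) i) t := by
    intro t ht i
    have h1 := ((hasDerivAt_id' t).mul_const (w i)).const_add (y₀ i)
    have h2 := h1.fun_add (ht.hasDerivAt.mul_const (v i))
    simpa [hγ] using h2
  have hcont : ∀ (G : Poly), MvPolynomial.eval y₀ G ≠ 0 →
      ∀ᶠ t in nhds (0 : ℂ), MvPolynomial.eval (γ t) G ≠ 0 := by
    intro G hG
    have h1 := (hasDerivAt_eval (hγd 0 hψ.self_of_nhds.1) G).continuousAt
    refine h1.eventually_ne ?_
    simpa [hγ0] using hG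
  have hvpoly : ∀ x, MvPolynomial.eval x
      (∑ i, MvPolynomial.C (v i) * MvPolynomial.pderiv i Δ) = dirDeriv Δ x v := by
    intro x
    simp [dirDeriv, mul_comm]
  have hev1 := hcont _ (by rw [hvpoly]; exact hv)
  have hk0 : MvPolynomial.eval y₀ (cmap p k) ≠ 0 := (congrFun (eval_cmap p y₀) k).trans_ne hk
  have hev2 := hcont (cmap p k) hk0
  obtain ⟨r, hr, hball⟩ := Metric.eventually_nhds_iff_ball.1
    (hψ.and (hEev.and (hev1.and hev2)))
  have hval : ∀ t i, MvPolynomial.eval (γ t) (cmap p i) = values p (γ t) i := fun t i =>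
    congrFun (eval_cmap p (γ t)) i
  -- The velocity of γ is tangent to the curve, so failure of immersivity makes the derivative of p
  -- ∘ γ proportional to p ∘ γ. Ratios of coordinates are then constant, and the injective arc lies
  -- in one fibre, contradicting `finite_fibre`.
  have hder : ∀ t ∈ Metric.ball (0 : ℂ) r, ∃ c : ℂ, ∀ i,
      HasDerivAt (fun s => MvPolynomial.eval (γ s) (cmap p i)) (c * values p (γ t) i) t := by
    intro t ht
    obtain ⟨⟨hd, hΔt⟩, htE, hsm, htk⟩ := hball t ht
    have htan : dirDeriv Δ (γ t) (w + deriv ψ t • v) = 0 := by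
      have h1 := hasDerivAt_eval (hγd t hd) Δ
      have h2 : (fun s => MvPolynomial.eval (γ s) Δ) =ᶠ[nhds t] fun _ => 0 := by
        filter_upwards [Metric.isOpen_ball.mem_nhds ht] with s hs
        exact (hball s hs).1.2
      exact h1.unique ((hasDerivAt_const t (0 : ℂ)).congr_of_eventuallyEq h2)
    obtain ⟨c, hc⟩ := jac_tangent_of_not_immersive hp (hγne t) hΔt
      (fun h0 => htk (by rw [hval, h0]; rfl)) ⟨v, by rw [← hvpoly]; exact hsm⟩
      (hbad' _ (hγne t) htE) htan
    refine ⟨c, fun i => ?_⟩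
    have h1 := hasDerivAt_eval (hγd t hd) (cmap p i)
    have h2 := congrFun hc i
    rw [jac_apply] at h2
    rw [h2] at h1
    exact h1
  have hconst : ∀ t ∈ Metric.ball (0 : ℂ) r, ∀ i,
      values p (γ t) i / values p (γ t) k = values p y₀ i / values p y₀ k := by
    intro t ht i
    have hd : ∀ t ∈ Metric.ball (0 : ℂ) r, HasDerivAt (fun s => MvPolynomial.eval (γ s) (cmap p i) /
        MvPolynomial.eval (γ s) (cmap p k)) 0 t := by
      intro t ht
      obtain ⟨c, hc⟩ := hder t ht
      have htk := (hball t ht).2.2.2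
      have h1 := (hc i).fun_div (hc k) htk
      rwa [show c * values p (γ t) i * MvPolynomial.eval (γ t) (cmap p k) -
        MvPolynomial.eval (γ t) (cmap p i) * (c * values p (γ t) k) = 0 by
          rw [hval, hval]; ring, zero_div] at h1
    have h1 := Metric.isOpen_ball.is_const_of_deriv_eq_zero (convex_ball (0 : ℂ) r).isPreconnected
      (fun s hs => (hd s hs).differentiableAt.differentiableWithinAt)
      (fun s hs => (hd s hs).deriv) ht (Metric.mem_ball_self hr)
    simp only [hval] at h1
    rw [h1, hγ0]
  have hinf : ((fun t => Projectivization.mk ℂ (γ t) (hγne t)) '' Metric.ball (0 : ℂ) r).Infinite :=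
    (infinite_of_mem_nhds 0 (Metric.ball_mem_nhds 0 hr)).image hinj.injOn
  refine hinf ((finite_fibre hirr hp hnc hy₀p).subset ?_)
  rintro _ ⟨t, ht, rfl⟩
  obtain ⟨⟨hd, hΔt⟩, htE, hsm, htk⟩ := hball t ht
  obtain ⟨c, hc, hrep⟩ := exists_rep_eq_smul (hγne t)
  refine ⟨(mk_mem_zeroLocus hΔh (hγne t)).2 hΔt,
    c ^ n * (values p (γ t) k / values p y₀ k), ?_⟩
  simp only [hrep, values_smul hp, mul_smul]
  congr 1
  funext i
  have h1 := hconst t ht i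
  rw [hval] at htk
  have hk' : values p y₀ k ≠ 0 := hk
  rw [Pi.smul_apply, smul_eq_mul]
  field_simp at h1 ⊢
  linear_combination h1

end

end CurveElim
end

noncomputable section
namespace CurveElim

/-! ### The Bezout form on Vandermonde vectors at smooth points -/

theorem bez_evalFun {m n : ℕ} (γ : Fin 3 → Expo n → Expo n → ℂ)
    (A : Fin 3 → Matrix (Fin m) (Fin m) ℂ) (y : Fin 3 → ℂ) (f e : Fin m → ℂ) :
    bez γ A (evalFun y f) (evalFun y e) =
      ∑ i : Expo n, ∑ j : Expo n, ∑ k, γ k i j * (monom i.1 y * monom j.1 y *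
        (f ⬝ᵥ (A k).mulVec e)) := by
  refine Finset.sum_congr rfl fun i _ => Finset.sum_congr rfl fun j _ =>
    Finset.sum_congr rfl fun k _ => ?_
  simp only [pair, evalFun_apply, eval_mon, smul_dotProduct, Matrix.mulVec_smul, dotProduct_smul,
    smul_eq_mul]
  ring

/-- The differential of a Bezout decomposition on the diagonal. -/
theorem IsBezout.dirDeriv_sub {n : ℕ} {γ : Fin 3 → Expo n → Expo n → ℂ} {P Q : Poly}
    (h : IsBezout γ P Q) (y τ : Fin 3 → ℂ) :
    dirDeriv P y τ * MvPolynomial.eval y Q - dirDeriv Q y τ * MvPolynomial.eval y P =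
      ∑ i : Expo n, ∑ j : Expo n, ∑ k, γ k i j * (monom i.1 y * monom j.1 y *
        crossProduct τ y k) := by
  let ψ : Poly →ₗ[ℂ] ℂ :=
    { toFun := fun G => dirDeriv G y τ
      map_add' := fun G H => dirDeriv_add G H y τ
      map_smul' := fun c G => by
        rw [MvPolynomial.smul_eq_C_mul, dirDeriv_mul, dirDeriv_C, MvPolynomial.eval_C]
        simp }
  have h1 := h.functional ψ (MvPolynomial.aeval y : Poly →ₐ[ℂ] ℂ).toLinearMap
  have hψ : ∀ G, ψ G = dirDeriv G y τ := fun G => rfl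
  have hφ : ∀ G, (MvPolynomial.aeval y : Poly →ₐ[ℂ] ℂ).toLinearMap G = MvPolynomial.eval y G := by
    intro G
    simp [MvPolynomial.aeval_eq_eval]
  simp only [hψ, hφ] at h1
  rw [h1]
  refine Finset.sum_congr rfl fun i _ => Finset.sum_congr rfl fun j _ => ?_
  -- On the diagonal the derivatives of the monomials carry factors y_a y_b - y_b y_a and cancel.
  -- Only the derivatives of the linear factors remain.
  simp only [dirDeriv_mul, dirDeriv_X, map_mul, MvPolynomial.eval_X, eval_mon, Fin.sum_univ_three,
    cross_apply]
  simp
  ring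

section

variable {m : ℕ} {A : Fin 3 → Matrix (Fin m) (Fin m) ℂ} {y : Fin 3 → ℂ}

/-- The kernel at a smooth point is a line. -/
theorem finrank_ker_eq_one (hy : MvPolynomial.eval y (netDet A) = 0)
    (hs : ∃ v, dirDeriv (netDet A) y v ≠ 0) :
    Module.finrank ℂ (LinearMap.ker (comb A y).mulVecLin) = 1 := by
  obtain ⟨v, hv⟩ := hs
  rw [← alongLine_coeff_one, alongLine_netDet] at hv
  have hker : ∃ e, e ≠ 0 ∧ (comb A y).mulVec e = 0 := by
    rw [eval_netDet] at hy
    exact Matrix.exists_mulVec_eq_zero_iff.2 hy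
  refine le_antisymm ?_ (finrank_ker_pos hker)
  by_contra hlt
  exact hv (Polynomial.X_pow_dvd_iff.1 (pow_dvd_detLine _ _) 1 (by omega))

theorem isTangent_iff_dirDeriv (hy : MvPolynomial.eval y (netDet A) = 0)
    (hs : ∃ v, dirDeriv (netDet A) y v ≠ 0) (v : Fin 3 → ℂ) :
    IsTangent (comb A y) (comb A v) ↔ dirDeriv (netDet A) y v = 0 := by
  rw [isTangent_iff_coeff, finrank_ker_eq_one hy hs, ← alongLine_netDet, alongLine_coeff_one]

/-- The left and right kernels at a smooth point. -/
theorem exists_kernels (hy : MvPolynomial.eval y (netDet A) = 0)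
    (hs : ∃ v, dirDeriv (netDet A) y v ≠ 0) :
    ∃ e f : Fin m → ℂ, e ≠ 0 ∧ (comb A y).mulVec e = 0 ∧
      (∀ e', (comb A y).mulVec e' = 0 → ∃ c : ℂ, e' = c • e) ∧
      (comb A y).transpose.mulVec f = 0 ∧
      ∀ v, dirDeriv (netDet A) y v = 0 ↔ f ⬝ᵥ (comb A v).mulVec e = 0 := by
  have hdet := hy
  rw [eval_netDet] at hdet
  obtain ⟨e, he0, he⟩ := Matrix.exists_mulVec_eq_zero_iff.2 hdet
  obtain ⟨f, hf0, hf⟩ := Matrix.exists_mulVec_eq_zero_iff.2 ((Matrix.det_transpose _).trans hdet)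
  have hone := finrank_ker_eq_one hy hs
  have hspan : ∀ e', (comb A y).mulVec e' = 0 → ∃ c : ℂ, e' = c • e := by
    intro e' he'
    obtain ⟨c, hc⟩ := (finrank_eq_one_iff_of_nonzero' (⟨e, he⟩ : LinearMap.ker
      (comb A y).mulVecLin) (fun h => he0 (congrArg Subtype.val h))).1 hone ⟨e', he'⟩
    exact ⟨c, (congrArg Subtype.val hc).symm⟩
  refine ⟨e, f, he0, he, hspan, hf, fun v => ?_⟩
  have hfM : ∀ x, f ⬝ᵥ (comb A y).mulVec x = 0 := by
    intro x
    rw [Matrix.dotProduct_mulVec, ← Matrix.mulVec_transpose, hf, zero_dotProduct]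
  rw [← isTangent_iff_dirDeriv hy hs]
  constructor
  · rintro ⟨x, e', he'0, he', h⟩
    obtain ⟨c, rfl⟩ := hspan e' he'
    have hc : c ≠ 0 := fun h0 => he'0 (by rw [h0, zero_smul])
    have h1 := congrArg (fun u => f ⬝ᵥ u) h
    simp only [dotProduct_add, hfM, zero_add, Matrix.mulVec_smul, dotProduct_smul, smul_eq_mul,
      dotProduct_zero] at h1
    exact (mul_eq_zero.1 h1).resolve_left hc
  · intro h
    let φ : (Fin m → ℂ) →ₗ[ℂ] ℂ := dotProductBilin ℂ ℂ f
    have hφ : ∀ u, φ u = f ⬝ᵥ u := fun u => rfl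
    have hφ0 : φ ≠ 0 := by
      intro h0
      apply hf0
      funext i
      have := LinearMap.congr_fun h0 (Pi.single i 1)
      simpa [hφ] using this
    -- The range of the pencil at y lies in the kernel of f, and both have codimension one. So
    -- orthogonality to f decides solvability.
    have h1 := Module.Dual.finrank_ker_add_one_of_ne_zero hφ0
    have h2 := LinearMap.finrank_range_add_finrank_ker (comb A y).mulVecLin
    rw [hone] at h2
    have h3 : LinearMap.range (comb A y).mulVecLin = LinearMap.ker φ := by
      refine Submodule.eq_of_le_of_finrank_eq ?_ (by omega)
      rintro _ ⟨x, rfl⟩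
      exact hfM x
    have h4 : (comb A v).mulVec e ∈ LinearMap.range (comb A y).mulVecLin := by
      rw [h3]
      exact h
    obtain ⟨x, hx⟩ := h4
    refine ⟨-x, e, he0, he, ?_⟩
    rw [← hx, Matrix.mulVec_neg]
    exact neg_add_cancel _

end

section

variable {m n : ℕ} {D : Fin 3 → Matrix (Fin m) (Fin m) ℂ} {p : Fin 3 → MvPolynomial (Fin 3) ℝ}
variable (b12 : BezoutCoeffs n (p 1) (p 2)) (b02 : BezoutCoeffs n (p 0) (p 2))
  (b01 : BezoutCoeffs n (p 0) (p 1))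

/-- At a point where the map is immersive, the Bezout form does not vanish on the kernels in all
directions. -/
theorem IsImmersiveAt.exists_netForm_ne_zero {y : Fin 3 → ℂ} (h : IsImmersiveAt D p y)
    (hy : y ≠ 0) {e f : Fin m → ℂ} (he : (comb (signed D) y).mulVec e = 0)
    (hef : ∀ v, dirDeriv (netDet (signed D)) y v = 0 ↔
      f ⬝ᵥ (comb (signed D) v).mulVec e = 0) :
    ∃ η, netForm D b12 b02 b01 η (conjBlown (vandermonde n y f)) (vandermonde n y e) ≠ 0 := by
  set g : Fin 3 → ℂ := fun k => f ⬝ᵥ (signed D k).mulVec e with hg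
  have hcomb : ∀ v, f ⬝ᵥ (comb (signed D) v).mulVec e = v ⬝ᵥ g := by
    intro v
    rw [comb, Matrix.sum_mulVec, dotProduct_sum]
    simp only [Matrix.smul_mulVec, dotProduct_smul, smul_eq_mul, hg]
    rfl
  simp only [hcomb] at hef
  have hg0 : g ≠ 0 := by
    intro h0
    obtain ⟨v, hv⟩ := h.smooth
    exact hv ((hef v).2 (by rw [h0, dotProduct_zero]))
  have hyg : y ⬝ᵥ g = 0 := by rw [← hcomb, he, dotProduct_zero]
  obtain ⟨c, hc⟩ := exists_dotProduct_eq_one hy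
  -- From c · y = 1 and y · g = 0, the tangent vector τ = c × g satisfies τ × y = g. This identifies
  -- the form on the two kernels with the derivative of the Bezout decomposition along τ.
  have hτ : crossProduct (crossProduct c g) y = g := by
    have h1 : crossProduct (crossProduct c g) y = (c ⬝ᵥ y) • g - (y ⬝ᵥ g) • c := by
      ext i
      fin_cases i <;>
      · simp [cross_apply, dotProduct, Fin.sum_univ_three]
        ring
    rw [h1, hc, hyg, one_smul, zero_smul, sub_zero]
  set τ := crossProduct c g with hτd
  have hτt : dirDeriv (netDet (signed D)) y τ = 0 :=
    (hef τ).2 (by rw [dotProduct_comm, hτd, dot_cross_self])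
  have hω : crossProduct (values p y) (jac (cmap p) y τ) ≠ 0 := by
    intro h0
    obtain ⟨c', hc'⟩ := h.immersive τ hτt (exists_smul_of_cross_eq_zero h.values_ne h0)
    rw [hc', map_smul, LinearMap.smul_apply, cross_self, smul_zero] at hτ
    exact hg0 hτ.symm
  set ω := crossProduct (values p y) (jac (cmap p) y τ) with hωd
  -- For η = a × b the form equals -a · (b × ω), so b is chosen with b × ω nonzero and then a with
  -- pairing 1.
  obtain ⟨b, hb⟩ : ∃ b, crossProduct b ω ≠ 0 := by
    by_contra! hall
    have h1 := hall (Pi.single 0 1)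
    have h2 := hall (Pi.single 1 1)
    apply hω
    funext i
    have h3 := congrFun h1 1
    have h4 := congrFun h1 2
    have h5 := congrFun h2 2
    simp [cross_apply] at h3 h4 h5
    fin_cases i
    · exact h5
    · exact h4
    · exact h3
  obtain ⟨a, ha⟩ := exists_dotProduct_eq_one hb
  refine ⟨crossProduct a b, ?_⟩
  rw [netForm_eq_bez b12 b02 b01 _ (F := evalFun y f) (E := evalFun y e)
    (by rw [toBlown_evalFun, conjBlown_conjBlown]) (toBlown_evalFun _ _), bez_evalFun]
  have h1 := (netCoef_isBezout b12 b02 b01 a b).dirDeriv_sub y τ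
  rw [hτ] at h1
  simp only [hg] at h1
  rw [← h1, dirDeriv_lin, dirDeriv_lin, eval_lin_cmap, eval_lin_cmap]
  have h2 : a ⬝ᵥ jac (cmap p) y τ * b ⬝ᵥ values p y - b ⬝ᵥ jac (cmap p) y τ * a ⬝ᵥ values p y =
      - (a ⬝ᵥ crossProduct b ω) := by
    rw [hωd]
    simp only [dotProduct, Fin.sum_univ_three, cross_apply]
    simp
    ring
  rw [h2, ha]
  exact neg_ne_zero.2 one_ne_zero

theorem values_star (y : Fin 3 → ℂ) : values p (star y) = star (values p y) := by
  funext k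
  have h := MvPolynomial.map_aeval y (starRingEnd ℂ) (p k)
  have hcomp : (starRingEnd ℂ).comp (algebraMap ℝ ℂ) = algebraMap ℝ ℂ :=
    RingHom.ext fun r => Complex.conj_ofReal r
  rw [hcomp] at h
  exact h.symm

theorem conjBlown_vandermonde (y : Fin 3 → ℂ) (f : Fin m → ℂ) :
    conjBlown (vandermonde n y f) = vandermonde n (star y) (star f) := by
  ext is
  change star (monom is.1.1 y * f is.2) = monom is.1.1 (star y) * star f is.2
  rw [star_mul', monom, monom, star_prod]
  simp

theorem comb_signed_star (hD : ∀ k, (D k).IsHermitian) (y : Fin 3 → ℂ) :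
    comb (signed D) (star y) = (comb (signed D) y).conjTranspose := by
  rw [comb_signed, comb_signed, pencil, pencil]
  simp [Matrix.conjTranspose_sub, Matrix.conjTranspose_smul, (hD _).eq]

theorem comb_signed_star_mulVec (hD : ∀ k, (D k).IsHermitian) {y : Fin 3 → ℂ} {f : Fin m → ℂ}
    (hf : (comb (signed D) y).transpose.mulVec f = 0) :
    (comb (signed D) (star y)).mulVec (star f) = 0 := by
  rw [comb_signed_star hD]
  have h := congrArg star hf
  rwa [Matrix.star_mulVec, star_zero, ← Matrix.mulVec_transpose] at h

/-- Conjugate Vandermonde vectors over `ξ` are in the left kernel of the Bezout form at `ξ`. -/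
theorem netForm_conj_vandermonde (hD : ∀ k, (D k).IsHermitian)
    (hirr : Irreducible (netDet (signed D))) (hn : 0 < n) (hp : ∀ k, (p k).IsHomogeneous n)
    (hnc : IsNonconstant D p) {y : Fin 3 → ℂ} (hy : y ≠ 0) (hyp : values p y ≠ 0)
    {f : Fin m → ℂ} (hf : (comb (signed D) y).transpose.mulVec f = 0)
    {w : BlownUp m n} (hw : w ∈ principal n D) :
    netForm D b12 b02 b01 (values p y) (conjBlown (vandermonde n y f)) w = 0 := by
  have hk := comb_signed_star_mulVec hD hf
  rw [conjBlown_vandermonde]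
  have h1 := netForm_vandermonde b12 b02 b01 hD hirr hn hp hnc (ξ := star (values p y))
    (star_ne_zero.2 hyp) (y := star y) (star_ne_zero.2 hy) (c := 1)
    (by rw [one_smul, values_star]) hk hw
  have h2 := netForm_conj b12 b02 b01 hD hirr hn (star (values p y)) hw
    (vandermonde_mem_principal (n := n) hk)
  rw [h1, star_zero, star_star] at h2
  exact h2.symm

end

end CurveElim
end

noncomputable section
namespace CurveElim

/-! ### The determinant is reduced if the map is generically injective -/

section

variable {m n : ℕ} {D : Fin 3 → Matrix (Fin m) (Fin m) ℂ} {p : Fin 3 → MvPolynomial (Fin 3) ℝ}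

/-- The point `y` is the only point over its image, also counted infinitesimally. -/
structure IsGenericAt (D : Fin 3 → Matrix (Fin m) (Fin m) ℂ)
    (p : Fin 3 → MvPolynomial (Fin 3) ℝ) (y : Fin 3 → ℂ) : Prop extends IsImmersiveAt D p y where
  fibre : ∀ z, z ≠ 0 → MvPolynomial.eval z (netDet (signed D)) = 0 → values p z ≠ 0 →
    (∃ c : ℂ, values p z = c • values p y) → ∃ s : ℂ, s ≠ 0 ∧ z = s • y
  base : ∀ P ∈ basePoints p (curve D), ∀ τ, jac (cmap p) P.rep τ = values p y →
    ¬ IsTangent (comb (signed D) P.rep) (comb (signed D) τ)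

/-- An immersive point is chosen outside finitely many bad ones: the exceptional set S, the fibres
through S, and the fibres over the finitely many images of tangent directions at each of the
finitely many base points. -/
theorem exists_isGenericAt (hirr : Irreducible (netDet (signed D)))
    (hp : ∀ k, (p k).IsHomogeneous n) (hnc : IsNonconstant D p) (hb : SimpleBase D p)
    (hinj : GenericallyInjective p (curve D)) : ∃ y, y ≠ 0 ∧ IsGenericAt D p y := by
  obtain ⟨S, hS, hinj⟩ := hinj
  have hbfin : (basePoints p (curve D)).Finite := by
    refine (finite_fibre hirr hp hnc (ξ := Pi.single 0 1) (by simp)).subset ?_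
    rintro Q ⟨hQ, hQp⟩
    exact ⟨(mem_curve_iff Q).1 hQ, 0, by rw [hQp, zero_smul]⟩
  let fib : (Fin 3 → ℂ) → Set Plane := fun ξ =>
    {Q : Plane | ξ ≠ 0 ∧ MvPolynomial.eval Q.rep (netDet (signed D)) = 0 ∧
      ∃ c : ℂ, values p Q.rep = c • ξ}
  have hfib : ∀ ξ, (fib ξ).Finite := by
    intro ξ
    by_cases hξ : ξ = 0
    · convert Set.finite_empty
      ext Q
      simp [fib, hξ]
    · exact (finite_fibre hirr hp hnc hξ).subset fun Q hQ => hQ.2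
  have hR : ∀ P : Plane, ∃ R : Set (Fin 3 → ℂ), R.Finite ∧ (P ∈ basePoints p (curve D) →
      ∀ τ, IsTangent (comb (signed D) P.rep) (comb (signed D) τ) → jac (cmap p) P.rep τ ≠ 0 →
      ∃ c : ℂ, c ≠ 0 ∧ ∃ ζ ∈ R, jac (cmap p) P.rep τ = c • ζ) := by
    intro P
    by_cases hP : P ∈ basePoints p (curve D)
    · obtain ⟨a, v, h⟩ := hb P hP
      obtain ⟨R, hR, h'⟩ := h.finite_tangents (exists_ker ((mem_curve_iff P).1 hP.1))
        P.rep_nonzero (jac_self_of_values hp hP.2)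
      exact ⟨R, hR, fun _ => h'⟩
    · exact ⟨∅, Set.finite_empty, fun h => absurd h hP⟩
  choose R hRf hR using hR
  obtain ⟨P, hPE, hP⟩ := exists_isImmersiveAt hirr hp hnc
    ((hS.union (hS.biUnion fun Q _ => hfib (values p Q.rep))).union
      (hbfin.biUnion fun Q _ => (hRf Q).biUnion fun ζ _ => hfib ζ))
  simp only [Set.mem_union, Set.mem_iUnion, not_or, not_exists] at hPE
  obtain ⟨⟨hPS, hPf⟩, hPR⟩ := hPE
  have hPC : P ∈ curve D := (mem_curve_iff P).2 hP.mem
  refine ⟨P.rep, P.rep_nonzero, hP, ?_, ?_⟩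
  · rintro z hz hzΔ hzp ⟨c, hc⟩
    obtain ⟨s, hs, hrep⟩ := exists_rep_eq_smul hz
    set Q := Projectivization.mk ℂ z hz with hQ
    have hQC : Q ∈ curve D := (mk_mem_curve hz).2 hzΔ
    have hc0 : c ≠ 0 := by
      rintro rfl
      exact hzp (by rw [hc, zero_smul])
    have hQp : values p Q.rep = (s ^ n * c) • values p P.rep := by
      rw [hrep, values_smul hp, hc, smul_smul]
    have hsc : s ^ n * c ≠ 0 := mul_ne_zero (pow_ne_zero _ hs) hc0
    have hQ0 : values p Q.rep ≠ 0 := by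
      rw [hQp]
      exact smul_ne_zero hsc hP.values_ne
    have hQS : Q ∉ S := by
      intro hQS
      refine hPf Q hQS ⟨hQ0, hP.mem, (s ^ n * c)⁻¹, ?_⟩
      rw [hQp, smul_smul, inv_mul_cancel₀ hsc, one_smul]
    have hPQ := hinj Q ⟨hQC, hQS⟩ P ⟨hPC, hPS⟩ hQ0 hP.values_ne
      ((Projectivization.mk_eq_mk_iff' ..).2 ⟨_, hQp.symm⟩)
    refine ⟨s⁻¹, inv_ne_zero hs, ?_⟩
    rw [← hPQ, hrep, smul_smul, inv_mul_cancel₀ hs, one_smul]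
  · intro Q hQ τ hτ ht
    obtain ⟨c, hc, ζ, hζ, h⟩ := hR Q hQ τ ht (by rw [hτ]; exact hP.values_ne)
    refine hPR Q hQ ζ hζ ⟨?_, hP.mem, c, by rw [← hτ, h]⟩
    rintro rfl
    rw [hτ, smul_zero] at h
    exact hP.values_ne h

/-- Base points are excluded by `base`. Otherwise x is a multiple of y, where the kernel is a line,
so the jet amounts to one tangent direction. Immersivity makes that direction a multiple of y, and
the normalization by z makes it zero. -/
theorem IsGenericAt.eq_zero_of_second_order {y : Fin 3 → ℂ} (hy : IsGenericAt D p y)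
    (hp : ∀ k, (p k).IsHomogeneous n) (hb : SimpleBase D p) {x : Fin 3 → ℂ}
    (hx : MvPolynomial.eval x (netDet (signed D)) = 0) (hxy : ∃ c : ℂ, values p x = c • values p y)
    {ε : Fin m → ℂ} {e : Fin 3 → Fin m → ℂ} {z : Fin 3 → ℂ}
    (h1 : (comb (signed D) x).mulVec ε + ∑ k, (signed D k).mulVec (e k) = 0)
    (h2 : ∀ k, (comb (signed D) x).mulVec (e k) = 0) (hz : z ⬝ᵥ x ≠ 0)
    (hze : ∑ k, z k • e k = 0)
    (hJ : ∀ i, ∃ c : ℂ, jac (cmap p) x (fun k => e k i) = c • values p y) (k : Fin 3) :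
    e k = 0 := by
  have hx0 : x ≠ 0 := by
    rintro rfl
    exact hz (dotProduct_zero z)
  by_cases hxp : values p x = 0
  · rcases hb.exists_isTangent hp hy.values_ne hx0 hx hxp h1 h2 hz hze hJ with h | h
    · exact h k
    · obtain ⟨P, hP, τ, hτ, ht⟩ := h
      exact absurd ht (hy.base P hP τ hτ)
  obtain ⟨s, hs, rfl⟩ := hy.fibre x hx0 hx hxp hxy
  obtain ⟨e₀, f, he₀0, he₀, hspan, hf, hef⟩ := exists_kernels hy.mem hy.smooth
  have h2' : ∀ k, ∃ c : ℂ, e k = c • e₀ := by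
    intro k
    apply hspan
    have := h2 k
    rw [comb_smul, Matrix.smul_mulVec] at this
    exact (smul_eq_zero.1 this).resolve_left hs
  choose t ht using h2'
  have hsum : ∑ k, (signed D k).mulVec (e k) = (comb (signed D) t).mulVec e₀ := by
    rw [comb, Matrix.sum_mulVec]
    refine Finset.sum_congr rfl fun k _ => ?_
    rw [ht, Matrix.mulVec_smul, Matrix.smul_mulVec]
  have htan : dirDeriv (netDet (signed D)) y t = 0 := by
    rw [← isTangent_iff_dirDeriv hy.mem hy.smooth]
    refine ⟨s • ε, e₀, he₀0, he₀, ?_⟩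
    rw [← hsum, Matrix.mulVec_smul, ← Matrix.smul_mulVec, ← comb_smul]
    exact h1
  obtain ⟨i, hi⟩ := Function.ne_iff.1 he₀0
  obtain ⟨c, hc⟩ := hJ i
  have hfun : (fun k => e k i) = e₀ i • t := by
    funext k
    rw [ht, Pi.smul_apply, Pi.smul_apply, smul_eq_mul, smul_eq_mul, mul_comm]
  have hi' : e₀ i ≠ 0 := hi
  rw [hfun, map_smul, jac_smul_pt hp, smul_smul] at hc
  have hne := mul_ne_zero hi' (pow_ne_zero (n - 1) hs)
  obtain ⟨c', rfl⟩ := hy.immersive t htan ⟨(e₀ i * s ^ (n - 1))⁻¹ * c, by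
    rw [mul_smul, ← hc, smul_smul, inv_mul_cancel₀ hne, one_smul]⟩
  simp only [ht, Pi.smul_apply, smul_eq_mul, smul_smul] at hze ⊢
  rw [← Finset.sum_smul] at hze
  have h3 := (smul_eq_zero.1 hze).resolve_right he₀0
  have h4 : ∑ k, z k * (c' * y k) = c' * (z ⬝ᵥ y) := by
    rw [dotProduct, Finset.mul_sum]
    exact Finset.sum_congr rfl fun k _ => by ring
  rw [h4] at h3
  rw [dotProduct_smul, smul_eq_mul] at hz
  rw [(mul_eq_zero.1 h3).resolve_right (right_ne_zero_of_mul hz), zero_mul, zero_smul]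

variable (b12 : BezoutCoeffs n (p 1) (p 2)) (b02 : BezoutCoeffs n (p 0) (p 2))
  (b01 : BezoutCoeffs n (p 0) (p 1))

/-- The kernel of the Bezout form over a generic point. -/
theorem IsGenericAt.exists_sub_mem_baseSpan {y : Fin 3 → ℂ} (hy : IsGenericAt D p y)
    (hD : ∀ k, (D k).IsHermitian)
    (hirr : Irreducible (netDet (signed D))) (hn : 0 < n) (hp : ∀ k, (p k).IsHomogeneous n)
    (hnc : IsNonconstant D p) (hb : SimpleBase D p) {e : Fin m → ℂ}
    (hspan : ∀ e', (comb (signed D) y).mulVec e' = 0 → ∃ c : ℂ, e' = c • e)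
    {w : BlownUp m n} (hw : w ∈ principal n D)
    (hker : ∀ w' ∈ principal n D, netForm D b12 b02 b01 (values p y) w' w = 0) :
    ∃ c : ℂ, w - c • vandermonde n y e ∈ baseSpan n D p := by
  have hmem := mem_span_vandermonde b12 b02 b01 hD hirr hn hp hnc hy.values_ne
    (fun x hx hxy ε e' z h1 h2 hz hze hJ => hy.eq_zero_of_second_order hp hb hx hxy h1 h2 hz hze hJ)
    hw hker
  have hle : Submodule.span ℂ {u | ∃ x e', x ≠ 0 ∧ MvPolynomial.eval x (netDet (signed D)) = 0 ∧
      (∃ c : ℂ, values p x = c • values p y) ∧ (comb (signed D) x).mulVec e' = 0 ∧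
      u = vandermonde n x e'} ≤ baseSpan n D p ⊔ Submodule.span ℂ {vandermonde n y e} := by
    refine Submodule.span_le.2 ?_
    rintro _ ⟨x, e', hx, hxΔ, hxy, he', rfl⟩
    by_cases hxp : values p x = 0
    · exact Submodule.mem_sup_left (vandermonde_mem_baseSpan hp hx hxΔ hxp he')
    · obtain ⟨s, hs, rfl⟩ := hy.fibre x hx hxΔ hxp hxy
      rw [comb_smul, Matrix.smul_mulVec, smul_eq_zero, or_iff_right hs] at he'
      obtain ⟨c, rfl⟩ := hspan e' he'
      refine Submodule.mem_sup_right (Submodule.mem_span_singleton.2 ⟨s ^ (n - 1) * c, ?_⟩)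
      rw [vandermonde_smul, mul_smul]
      congr 1
      ext is
      change c * (monom is.1.1 y * e is.2) = monom is.1.1 y * (c * e is.2)
      ring
  obtain ⟨u, hu, v, hv, huv⟩ := Submodule.mem_sup.1 (hle hmem)
  obtain ⟨c, rfl⟩ := Submodule.mem_span_singleton.1 hv
  exact ⟨c, by rw [← huv, add_sub_cancel_right]; exact hu⟩

theorem netForm_apply (ξ : Fin 3 → ℂ) (w' w : BlownUp m n) : netForm D b12 b02 b01 ξ w' w =
    inner ℂ w' (Matrix.toEuclideanLin (bezoutNet D b12 b02 b01 ξ) w) := rfl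

/-- Second order solutions of the compressed net are second order solutions of the Bezout form. -/
theorem netForm_add_eq_zero (hD : ∀ k, (D k).IsHermitian)
    (hirr : Irreducible (netDet (signed D))) (hn : 0 < n) (hp : ∀ k, (p k).IsHomogeneous n)
    (hnc : IsNonconstant D p) {ξ η : Fin 3 → ℂ} (hξ : ξ ≠ 0) (hη : η ≠ 0)
    {x₁ x₀ : Fin (Module.finrank ℂ (reduced n D p)) → ℂ}
    (h : (comb (signed (barNet D b12 b02 b01)) ξ).mulVec x₁ +
      (comb (signed (barNet D b12 b02 b01)) η).mulVec x₀ = 0) {w' : BlownUp m n}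
    (hw' : w' ∈ principal n D) : netForm D b12 b02 b01 ξ w' (redVec n D p x₁) +
      netForm D b12 b02 b01 η w' (redVec n D p x₀) = 0 := by
  rw [netForm_apply, netForm_apply, ← inner_add_right]
  refine inner_eq_zero_of_reduced (p := p) (fun i => ?_) (fun u hu => ?_) hw'
  · rw [inner_add_right, ← netForm_apply, ← netForm_apply, ← barNet_mulVec, ← barNet_mulVec]
    exact congrFun h i
  · rw [inner_add_right, ← netForm_apply, ← netForm_apply,
      netForm_baseSpan_left b12 b02 b01 hD hirr hn hp hnc hξ (redVec_mem x₁).1 hu,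
      netForm_baseSpan_left b12 b02 b01 hD hirr hn hp hnc hη (redVec_mem x₀).1 hu, add_zero]

/-- Over a generic point, the determinant of the compressed net vanishes to first order only. -/
theorem IsGenericAt.exists_alongLine_ne_zero {y : Fin 3 → ℂ} (hy : IsGenericAt D p y)
    (hy0 : y ≠ 0) (hD : ∀ k, (D k).IsHermitian)
    (hirr : Irreducible (netDet (signed D))) (hn : 0 < n) (hp : ∀ k, (p k).IsHomogeneous n)
    (hnc : IsNonconstant D p) (hb : SimpleBase D p) :
    ∃ η, ∃ k ≤ 1, (alongLine (netDet (signed (barNet D b12 b02 b01))) (values p y) η).coeff k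
      ≠ 0 := by
  obtain ⟨e, f, he0, he, hspan, hf, hef⟩ := exists_kernels hy.mem hy.smooth
  obtain ⟨η, hη⟩ := hy.exists_netForm_ne_zero b12 b02 b01 hy0 he hef
  have hη0 : η ≠ 0 := by
    rintro rfl
    rw [netForm_eq] at hη
    simp at hη
  set ξ := values p y with hξ
  set N := comb (signed (barNet D b12 b02 b01)) ξ with hN
  set w' := conjBlown (vandermonde n y f) with hw'd
  have hw' : w' ∈ principal n D := by
    rw [hw'd, conjBlown_vandermonde]
    exact vandermonde_mem_principal (comb_signed_star_mulVec hD hf)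
  have hdec : ∀ x, N.mulVec x = 0 →
      ∃ c : ℂ, redVec n D p x - c • vandermonde n y e ∈ baseSpan n D p := by
    intro x hx
    exact hy.exists_sub_mem_baseSpan b12 b02 b01 hD hirr hn hp hnc hb hspan (redVec_mem x).1
      ((barNet_mulVec_eq_zero b12 b02 b01 hD hirr hn hp hnc hy.values_ne).1 hx)
  have hzero : ∀ x, redVec n D p x ∈ baseSpan n D p → x = 0 := fun x hx =>
    redVec_eq_zero (eq_zero_of_mem_reduced (redVec_mem x) hx)
  have hred : ∀ (x x' : Fin (Module.finrank ℂ (reduced n D p)) → ℂ) (c c' : ℂ),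
      redVec n D p (c • x + c' • x') = c • redVec n D p x + c' • redVec n D p x' := by
    intro x x' c c'
    simp only [redVec, Pi.add_apply, Pi.smul_apply, smul_eq_mul, add_smul, mul_smul,
      Finset.sum_add_distrib, Finset.smul_sum]
  -- Pair a second order solution with the left kernel vector w'. The term at ξ disappears, and the
  -- term at η is a nonzero number times the Vandermonde coefficient of x₀, which must therefore
  -- vanish.
  have htan : ¬ IsTangent N (comb (signed (barNet D b12 b02 b01)) η) := by
    rintro ⟨x₁, x₀, hx₀0, hx₀, h⟩
    obtain ⟨c, hc⟩ := hdec x₀ hx₀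
    have h1 : netForm D b12 b02 b01 ξ w' (redVec n D p x₁) +
        netForm D b12 b02 b01 η w' (redVec n D p x₀) = 0 := 
      netForm_add_eq_zero b12 b02 b01 hD hirr hn hp hnc hy.values_ne hη0 h hw'
    rw [netForm_conj_vandermonde b12 b02 b01 hD hirr hn hp hnc hy0 hy.values_ne hf
      (redVec_mem x₁).1, zero_add] at h1
    have h2 := netForm_baseSpan b12 b02 b01 hD hirr hn hp hnc hη0 hw' hc
    rw [map_sub, h1, map_smul, zero_sub, neg_eq_zero, smul_eq_mul] at h2
    have hc0 := (mul_eq_zero.1 h2).resolve_right hη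
    rw [hc0, zero_smul, sub_zero] at hc
    exact hx₀0 (hzero _ hc)
  refine ⟨η, _, ?_, by
    rw [alongLine_netDet]
    exact fun h0 => htan ((isTangent_iff_coeff _ _).2 h0)⟩
  -- The order of vanishing along η is dim ker N. It is at most one because modulo the base span
  -- every kernel vector is a multiple of one Vandermonde vector.
  by_cases hbot : ∀ x, N.mulVec x = 0 → x = 0
  · have : LinearMap.ker N.mulVecLin = ⊥ := (Submodule.eq_bot_iff _).2 hbot
    rw [this, finrank_bot]
    exact zero_le_one
  push Not at hbot
  obtain ⟨x, hx, hx0⟩ := hbot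
  obtain ⟨c, hc⟩ := hdec x hx
  have hc0 : c ≠ 0 := by
    rintro rfl
    rw [zero_smul, sub_zero] at hc
    exact hx0 (hzero _ hc)
  refine finrank_le_one (⟨x, hx⟩ : LinearMap.ker N.mulVecLin) ?_
  rintro ⟨x', hx'⟩
  obtain ⟨c', hc'⟩ := hdec x' hx'
  refine ⟨c' * c⁻¹, Subtype.ext ?_⟩
  have h1 := hzero ((c' * c⁻¹) • x + (-1 : ℂ) • x') (by
    rw [hred]
    have h2 := Submodule.sub_mem _ (Submodule.smul_mem _ (c' * c⁻¹) hc) hc'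
    convert h2 using 1
    rw [smul_sub, smul_smul, mul_assoc, inv_mul_cancel₀ hc0, mul_one, neg_one_smul]
    abel)
  rw [neg_one_smul, ← sub_eq_add_neg, sub_eq_zero] at h1
  exact h1

end

end CurveElim
end

noncomputable section
namespace CurveElim

/-! ### Irreducibility of the determinant -/

/-- The values on the line through 0 and v are a polynomial in s with these numbers as coefficients.
-/
theorem eval_homogeneousComponent_eq_zero {G : Poly} {v : Fin 3 → ℂ}
    (h : ∀ s : ℂ, MvPolynomial.eval (s • v) G = 0) (d : ℕ) :
    MvPolynomial.eval v (MvPolynomial.homogeneousComponent d G) = 0 := by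
  set Q : Polynomial ℂ := ∑ i ∈ Finset.range (G.totalDegree + 1),
    Polynomial.C (MvPolynomial.eval v (MvPolynomial.homogeneousComponent i G)) * Polynomial.X ^ i
    with hQ
  have hQ0 : Q = 0 := by
    refine Polynomial.funext fun s => ?_
    have h1 := h s
    rw [← MvPolynomial.sum_homogeneousComponent G, map_sum] at h1
    rw [Polynomial.eval_zero, ← h1, hQ, Polynomial.eval_finsetSum]
    refine Finset.sum_congr rfl fun i _ => ?_
    rw [eval_smul_of_hom (MvPolynomial.homogeneousComponent_isHomogeneous i G)]
    rw [Polynomial.eval_mul, Polynomial.eval_C, Polynomial.eval_pow, Polynomial.eval_X, mul_comm]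
  by_cases hd : d < G.totalDegree + 1
  · have h1 := congrArg (fun q => q.coeff d) hQ0
    simp only [hQ, Polynomial.finsetSum_coeff, Polynomial.coeff_C_mul_X_pow,
      Polynomial.coeff_zero] at h1
    rwa [Finset.sum_ite_eq, if_pos (Finset.mem_range.2 hd)] at h1
  · rw [MvPolynomial.homogeneousComponent_eq_zero _ _ (by omega), map_zero]

/-- An irreducible polynomial that divides the image of `F` under a homomorphism divides the image
of an irreducible factor of `F`. -/
theorem exists_irreducible_factor_map {Δ : Poly} (hΔ : Irreducible Δ) (φ : Poly →ₐ[ℂ] Poly)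
    (F : Poly) : F ≠ 0 → Δ ∣ φ F → ∃ G, Irreducible G ∧ G ∣ F ∧ Δ ∣ φ G := by
  refine UniqueFactorizationMonoid.induction_on_prime F (fun h => absurd rfl h) ?_ ?_
  · intro u hu _ hd
    exact absurd (isUnit_of_dvd_unit hd (hu.map φ)) hΔ.not_isUnit
  · intro a q ha hq ih _ hd
    rw [map_mul] at hd
    rcases hΔ.prime.dvd_or_dvd hd with h | h
    · exact ⟨q, hq.irreducible, dvd_mul_right _ _, h⟩
    · obtain ⟨G, hG, hGa, hGd⟩ := ih ha h
      exact ⟨G, hG, hGa.mul_left _, hGd⟩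

section

variable {m n : ℕ} {D : Fin 3 → Matrix (Fin m) (Fin m) ℂ} {p : Fin 3 → MvPolynomial (Fin 3) ℝ}

/-- The components of an equation of the cone over the image vanish on the closure of the
image. -/
theorem eval_eq_zero_of_closure (hn : 0 < n) (hp : ∀ k, (p k).IsHomogeneous n) {G : Poly}
    (hG : netDet (signed D) ∣ MvPolynomial.aeval (cmap p) G) {x : Fin 3 → ℂ} (hx : x ≠ 0)
    (hxc : Projectivization.mk ℂ x hx ∈ zariskiClosure (image p (curve D))) :
    MvPolynomial.eval x G = 0 := by
  rw [← MvPolynomial.sum_homogeneousComponent G, map_sum]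
  refine Finset.sum_eq_zero fun d _ => ?_
  have hGd := MvPolynomial.homogeneousComponent_isHomogeneous d G
  refine (mk_mem_zeroLocus hGd hx).1 (hxc d _ hGd ?_)
  rintro _ ⟨P, hP, hPp, rfl⟩
  refine (mk_mem_zeroLocus hGd hPp).2 (eval_homogeneousComponent_eq_zero (fun s => ?_) d)
  -- With s = t^n the multiple s p(x) is p(t x), so the entire cone over the image is covered.
  obtain ⟨t, rfl⟩ := IsAlgClosed.exists_pow_nat_eq s hn
  obtain ⟨q, hq⟩ := hG
  rw [← values_smul hp, ← eval_aeval_cmap, hq, map_mul,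
    eval_smul_of_hom (netDet_isHomogeneous _), (mem_curve_iff P).1 hP, mul_zero, zero_mul]

variable (b12 : BezoutCoeffs n (p 1) (p 2)) (b02 : BezoutCoeffs n (p 0) (p 2))
  (b01 : BezoutCoeffs n (p 0) (p 1))

/-- One irreducible factor G of F vanishes on the closure of the image, which is the whole zero
locus of F. A further factor would have its zeros there too and so coincide with G, but F has only a
first order zero at the image of a generic point. -/
theorem irreducible_netDet_barNet (hD : ∀ k, (D k).IsHermitian)
    (hirr : Irreducible (netDet (signed D))) (hn : 0 < n) (hp : ∀ k, (p k).IsHomogeneous n)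
    (hnc : IsNonconstant D p) (hb : SimpleBase D p) (hinj : GenericallyInjective p (curve D)) :
    Irreducible (netDet (signed (barNet D b12 b02 b01))) := by
  set F := netDet (signed (barNet D b12 b02 b01)) with hF
  have hFh := netDet_isHomogeneous (signed (barNet D b12 b02 b01))
  obtain ⟨y, hy0, hy⟩ := exists_isGenericAt hirr hp hnc hb hinj
  obtain ⟨η, k, hk, hcoeff⟩ := hy.exists_alongLine_ne_zero b12 b02 b01 hy0 hD hirr hn hp hnc hb
  rw [← hF] at hcoeff
  have hF0 : F ≠ 0 := by
    intro h0
    rw [h0, alongLine, map_zero, Polynomial.coeff_zero] at hcoeff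
    exact hcoeff rfl
  have hsub := image_subset_zeroLocus b12 b02 b01 hD hirr hn hp hnc
  have hcl := zeroLocus_eq_closure b12 b02 b01 hD hirr hn hp hnc hb
  obtain ⟨G, hG, ⟨B, hB⟩, hGd⟩ := exists_irreducible_factor_map hirr
    (MvPolynomial.aeval (cmap p)) F hF0 (dvd_aeval_of_image_subset hirr hn hp hnc hFh hsub)
  have hξ : Projectivization.mk ℂ (values p y) hy.values_ne ∈ image p (curve D) :=
    (mk_mem_image hp hy.values_ne).2 ⟨y, hy0, hy.mem, 1, one_ne_zero, (one_smul _ _).symm⟩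
  have hGξ : MvPolynomial.eval (values p y) G = 0 :=
    eval_eq_zero_of_closure hn hp hGd hy.values_ne (hcl ▸ hsub hξ)
  have hG0 : MvPolynomial.eval 0 G = 0 := by
    obtain ⟨q, hq⟩ := hGd
    have h1 := congrArg (MvPolynomial.eval ((0 : ℂ) • y)) hq
    rwa [eval_aeval_cmap, values_smul hp, zero_pow hn.ne', zero_smul, map_mul,
      eval_smul_of_hom (netDet_isHomogeneous _), hy.mem, mul_zero, zero_mul] at h1
  by_cases hBu : IsUnit B
  · rw [hB]
    exact (irreducible_mul_isUnit hBu).2 hG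
  have hB0 : B ≠ 0 := by
    rintro rfl
    exact hF0 (by rw [hB, mul_zero])
  obtain ⟨H, hH, hHB⟩ := WfDvdMonoid.exists_irreducible_factor hBu hB0
  have hHG : H ∣ G := by
    refine dvd_of_forall_eval_eq_zero hH fun x hx => ?_
    by_cases hx0 : x = 0
    · rw [hx0, hG0]
    refine eval_eq_zero_of_closure hn hp hGd hx0 ?_
    rw [← hcl, mk_mem_zeroLocus hFh, ← hF, hB, map_mul]
    obtain ⟨q, rfl⟩ := hHB
    rw [map_mul, hx, zero_mul, mul_zero]
  -- H and G are associated, so G divides the cofactor as well and G² divides F.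
  obtain ⟨q, rfl⟩ := ((hH.associated_of_dvd hG hHG).symm.dvd).trans hHB
  have hX : (Polynomial.X : Polynomial ℂ) ∣ alongLine G (values p y) η := by
    rw [Polynomial.X_dvd_iff, alongLine_coeff_zero, hGξ]
  have hX2 : (Polynomial.X : Polynomial ℂ) ^ 2 ∣ alongLine F (values p y) η := by
    rw [hB, alongLine_mul, alongLine_mul, ← mul_assoc, pow_two]
    exact (mul_dvd_mul hX hX).mul_right _
  exact absurd (Polynomial.X_pow_dvd_iff.1 hX2 k (by omega)) hcoeff

theorem isNonconstant_of_nontrivial (h : (image p (curve D)).Nontrivial) :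
    IsNonconstant D p := by
  intro ξ hξ
  by_contra! hall
  have hconst : ∀ Q ∈ image p (curve D), Q = Projectivization.mk ℂ ξ hξ := by
    rintro _ ⟨P, hP, hPp, rfl⟩
    obtain ⟨c, hc⟩ := exists_smul_of_cross_eq_zero hξ (hall P.rep ((mem_curve_iff P).1 hP))
    exact (Projectivization.mk_eq_mk_iff' ..).2 ⟨c, hc.symm⟩
  obtain ⟨Q, hQ, Q', hQ', hne⟩ := h
  exact hne ((hconst Q hQ).trans (hconst Q' hQ').symm)

theorem netDet_barNet : netDet (signed (barNet D b12 b02 b01)) =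
    detForm (bezoutBar D p b12) (-bezoutBar D p b02) (-bezoutBar D p b01) :=
  netDet_signed _

end

end CurveElim
end

/-! ### The determinantal representation of the image. -/

theorem theorem2p7 {m n : ℕ} (D : Fin 3 → Matrix (Fin m) (Fin m) ℂ)
    (hD : ∀ k, (D k).IsHermitian)
    (hirr : Irreducible (CurveElim.detForm (D 0) (D 1) (D 2)))
    (p : Fin 3 → MvPolynomial (Fin 3) ℝ)
    (hn : 0 < n)
    (hp : ∀ k, (p k).IsHomogeneous n)
    -- the image of the curve is not a point
    (hr : (CurveElim.image p (CurveElim.curve D)).Nontrivial)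
    (hbase : ∀ P ∈ CurveElim.basePoints p (CurveElim.curve D),
      CurveElim.IsSimpleBasePoint D p P.rep)
    (b12 : CurveElim.BezoutCoeffs n (p 1) (p 2))
    (b02 : CurveElim.BezoutCoeffs n (p 0) (p 2))
    (b01 : CurveElim.BezoutCoeffs n (p 0) (p 1)) :
    (CurveElim.bezoutBar D p b12).IsHermitian ∧
    (CurveElim.bezoutBar D p b02).IsHermitian ∧
    (CurveElim.bezoutBar D p b01).IsHermitian ∧
    -- `detForm A₀ (-A₁) (-A₂)` is `det (x₀ A₀ - x₁ A₁ + x₂ A₂)`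
    CurveElim.zeroLocus (CurveElim.detForm (CurveElim.bezoutBar D p b12)
        (-CurveElim.bezoutBar D p b02) (-CurveElim.bezoutBar D p b01)) =
      CurveElim.zariskiClosure (CurveElim.image p (CurveElim.curve D)) ∧
    (CurveElim.basePoints p (CurveElim.curve D) = ∅ →
      CurveElim.zeroLocus (CurveElim.detForm (CurveElim.bezoutBar D p b12)
          (-CurveElim.bezoutBar D p b02) (-CurveElim.bezoutBar D p b01)) =
        CurveElim.image p (CurveElim.curve D)) ∧
    (CurveElim.GenericallyInjective p (CurveElim.curve D) →
      Irreducible (CurveElim.detForm (CurveElim.bezoutBar D p b12)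
        (-CurveElim.bezoutBar D p b02) (-CurveElim.bezoutBar D p b01))) := by
  rw [← CurveElim.netDet_signed] at hirr
  have hnc := CurveElim.isNonconstant_of_nontrivial hr
  have hb : CurveElim.SimpleBase D p := fun P hP =>
    (hbase P hP).exists_isSimpleAt ((CurveElim.mem_curve_iff P).1 hP.1)
  rw [← CurveElim.netDet_barNet b12 b02 b01]
  exact ⟨CurveElim.bezoutBar_isHermitian hD hirr hn b12,
    CurveElim.bezoutBar_isHermitian hD hirr hn b02,
    CurveElim.bezoutBar_isHermitian hD hirr hn b01,
    CurveElim.zeroLocus_eq_closure b12 b02 b01 hD hirr hn hp hnc hb,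
    CurveElim.zeroLocus_eq_image b12 b02 b01 hD hirr hn hp hnc,
    CurveElim.irreducible_netDet_barNet b12 b02 b01 hD hirr hn hp hnc hb⟩
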